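/- Let $v_0,v_1,v_2,v_3\in\mathbb{R}^3$ have pairwise distances $1$, and let $C$ be their convex hull, a regular tetrahedron of unit edge. Let $U$ be uniformly distributed on the unit sphere of $\mathbb{R}^3$, and let $S=U^{\perp}$ be the plane through the origin orthogonal to $U$. Let the chorowidth $cw$ be the area, and the periwidth $pw$ the perimeter, of the orthogonal projection of $C$ on $S$. Then $cw$, $cw^2$ and $pw$ are integrable, and $$\mathbb{E}(cw)=\frac{\sqrt3}{4},\qquad \mathbb{E}(cw^2)=\frac18+\frac{\sqrt2}{4\pi}-\frac{\operatorname{arcsec}(3)}{8\pi},\qquad \mathbb{E}(pw)=\frac32\bigl(\pi-\operatorname{arcsec}(3)\bigr).$$ Moreover $$\mathbb{P}(\text{the projection has 3 vertices})=\frac{2}{\pi}\bigl(3\operatorname{arcsec}(3)-\pi\bigr),\qquad \mathbb{P}(\text{the projection has 4 vertices})=\frac{3}{\pi}\bigl(\pi-2\operatorname{arcsec}(3)\bigr).$$ Now let $C$ be the tetrahedron with vertices $(0,0,\frac{\sqrt6}{4})$, $(\frac{\sqrt3}{3},0,-\frac{\sqrt6}{12})$, $(-\frac{\sqrt3}{6},\frac12,-\frac{\sqrt6}{12})$,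 $(-\frac{\sqrt3}{6},-\frac12,-\frac{\sqrt6}{12})$; it is regular with unit edges. Write $cw(\theta,\varphi)$ and $pw(\theta,\varphi)$ for the area and the perimeter of its projection on the plane orthogonal to $(x,y,z)=(\cos\theta\sin\varphi,\sin\theta\sin\varphi,\cos\varphi)$. Both functions are invariant under $(\theta,\varphi)\mapsto(\theta+\frac{2\pi}{3},\varphi)$, $(\theta,\varphi)\mapsto(-\theta,\varphi)$ and $(\theta,\varphi)\mapsto(\theta+\pi,\pi-\varphi)$. Call $0\le\theta\le\frac{\pi}{3}$, $0\le\varphi\le\frac{\pi}{2}$ the dodecant. Let $\gamma=\operatorname{arccot}(2\sqrt2)$ and $\delta=\operatorname{arccot}(\sqrt2)$. For $0\le\varphi\le\frac{\pi}{2}$ let $\alpha(\varphi)=\operatorname{arcsec}(2\sqrt2\tan\varphi)$ if $\varphi\ge\gamma$ (with $\alpha(\frac{\pi}{2})=\frac{\pi}{2}$), $\alpha(\varphi)=0$ if $\varphi\le\gamma$, and $\beta(\varphi)=\frac{2\pi}{3}-\alpha(\varphi)$. The dodecant is the union of the following three regions, on which $cw$ and $pw$ are as stated. 1. If $\delta\le\varphi\le\frac{\pi}{2}$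 and $\beta(\varphi)\le\theta\le\frac{\pi}{3}$, then $cw=\frac1{12}\bigl(\sqrt6\,x+3\sqrt2\,y+\sqrt3\,z\bigr)$ and $$pw=\tfrac16\Bigl(3\sqrt{4-(\sqrt3x-y)^2}+\sqrt3\sqrt{12-(x-\sqrt3y+2\sqrt2z)^2}+2\sqrt3\sqrt{3-(x-\sqrt2z)^2}\Bigr).$$ 2. If $\gamma\le\varphi\le\frac{\pi}{2}$ and $0\le\theta\le\min\{\alpha(\varphi),\beta(\varphi)\}$, then $cw=\frac{\sqrt3}{6}\bigl(\sqrt2\,x+z\bigr)$ and $$pw=\tfrac{\sqrt3}6\Bigl(\sqrt3\sqrt{4-(\sqrt3x-y)^2}+\sqrt3\sqrt{4-(\sqrt3x+y)^2}+\sqrt{12-(x-\sqrt3y+2\sqrt2z)^2}+\sqrt{12-(x+\sqrt3y+2\sqrt2z)^2}\Bigr).$$ 3. If $0\le\varphi\le\delta$ and $\alpha(\varphi)\le\theta\le\frac{\pi}{3}$, then $cw=\frac{\sqrt3}{4}z$ and $$pw=\tfrac12\Bigl(\sqrt{4-(\sqrt3x-y)^2}+2\sqrt{1-y^2}+\sqrt{4-(\sqrt3x+y)^2}\Bigr).$$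 -/

import Mathlib

open Real MeasureTheory Set

noncomputable section

/-- Euclidean three-space. -/
abbrev E3 : Type := EuclideanSpace ℝ (Fin 3)

/-- The uniform probability measure on the unit sphere of `E3`: the surface measure, divided by its
total mass. -/
def uniformSphere : Measure (Metric.sphere (0 : E3) 1) :=
  ((volume : Measure E3).toSphere univ)⁻¹ • (volume : Measure E3).toSphere

/-- The plane through the origin orthogonal to `u`. -/
abbrev orthPlane (u : E3) : Submodule ℝ E3 := (Submodule.span ℝ {u})ᗮ

/-- The orthogonal projection of `C` on the subspace `S`, as a subset of `S`. -/
def shadow (C : Set E3) (S : Submodule ℝ E3) : Set S :=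
  S.orthogonalProjectionOnto '' C

/-- The chorowidth of `C` on the plane `S`: the area of the orthogonal projection of `C` on `S`
(Lebesgue measure of the Euclidean plane `S`). -/
def chorowidth (C : Set E3) (S : Submodule ℝ E3) : ℝ :=
  (volume : Measure S).real (shadow C S)

/-- The periwidth of `C` on the plane `S`: the length (one-dimensional Hausdorff measure) of the
boundary, relative to `S`, of the orthogonal projection of `C` on `S`. -/
def periwidth (C : Set E3) (S : Submodule ℝ E3) : ℝ :=
  (Measure.hausdorffMeasure 1 : Measure S).real (frontier (shadow C S))

/-- The number of vertices (extreme points) of the orthogonal projection of `C` on `S`. -/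
def shadowVertexCount (C : Set E3) (S : Submodule ℝ E3) : ℕ :=
  ((shadow C S).extremePoints ℝ).ncard

/-- The four points `v i` are the vertices of a regular tetrahedron of unit edge. -/
def IsUnitRegularSimplex (v : Fin 4 → E3) : Prop :=
  Pairwise fun i j => dist (v i) (v j) = 1

/-- The solid tetrahedron with the vertices `v i`. -/
def tetrahedron (v : Fin 4 → E3) : Set E3 := convexHull ℝ (range v)

/-- The chorowidth of the tetrahedron with vertices `v i` on the plane orthogonal to the unit
vector `u`. -/
def cw (v : Fin 4 → E3) (u : Metric.sphere (0 : E3) 1) : ℝ :=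
  chorowidth (tetrahedron v) (orthPlane u)

/-- The periwidth of the tetrahedron with vertices `v i` on the plane orthogonal to `u`. -/
def pw (v : Fin 4 → E3) (u : Metric.sphere (0 : E3) 1) : ℝ :=
  periwidth (tetrahedron v) (orthPlane u)

/-- The number of vertices of the projection of the tetrahedron on the plane orthogonal to `u`. -/
def vertexCount (v : Fin 4 → E3) (u : Metric.sphere (0 : E3) 1) : ℕ :=
  shadowVertexCount (tetrahedron v) (orthPlane u)

/-- The vertices of the centered regular tetrahedron of unit edge in standard position. -/
def stdVertex : Fin 4 → E3 :=
  ![!₂[0, 0, √6 / 4],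
    !₂[√3 / 3, 0, -√6 / 12],
    !₂[-√3 / 6, 1 / 2, -√6 / 12],
    !₂[-√3 / 6, -1 / 2, -√6 / 12]]

/-- The unit vector with azimuth `θ` and polar angle `φ`. -/
def sphericalPoint (θ φ : ℝ) : E3 := !₂[cos θ * sin φ, sin θ * sin φ, cos φ]

/-- Chorowidth of the standard tetrahedron on the plane orthogonal to the direction `(θ, φ)`. -/
def stdCw (θ φ : ℝ) : ℝ :=
  chorowidth (tetrahedron stdVertex) (orthPlane (sphericalPoint θ φ))

/-- Periwidth of the standard tetrahedron on the plane orthogonal to the direction `(θ, φ)`. -/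
def stdPw (θ φ : ℝ) : ℝ :=
  periwidth (tetrahedron stdVertex) (orthPlane (sphericalPoint θ φ))

/-- The inverse secant, for `1 ≤ |x|`. -/
def arcsec (x : ℝ) : ℝ := arccos (1 / x)

/-- The inverse cotangent, with values in `(0, π)`. -/
def arccot (x : ℝ) : ℝ := π / 2 - arctan x

/-- The angle `γ = arccot (2√2) = 0.339...`. -/
def gammaAngle : ℝ := arccot (2 * √2)

/-- The angle `δ = arccot √2 = 0.615...`. -/
def deltaAngle : ℝ := arccot (√2)

/-- The function `α` on `[0, π/2]`. At `φ = π/2`, where the tangent is infinite, the conventions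
`tan (π / 2) = 0` and `1 / 0 = 0` give the intended value `arcsec ∞ = π / 2`. -/
def alphaFn (φ : ℝ) : ℝ :=
  if gammaAngle ≤ φ then arcsec (2 * √2 * tan φ) else 0

/-- The function `β` on `[0, π/2]`. -/
def betaFn (φ : ℝ) : ℝ := 2 * π / 3 - alphaFn φ

/-- First region of the dodecant `0 ≤ θ ≤ π/3`, `0 ≤ φ ≤ π/2`. -/
def region1 (θ φ : ℝ) : Prop :=
  deltaAngle ≤ φ ∧ φ ≤ π / 2 ∧ betaFn φ ≤ θ ∧ θ ≤ π / 3

/-- Second region of the dodecant. -/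
def region2 (θ φ : ℝ) : Prop :=
  gammaAngle ≤ φ ∧ φ ≤ π / 2 ∧ 0 ≤ θ ∧ θ ≤ min (alphaFn φ) (betaFn φ)

/-- Third region of the dodecant. -/
def region3 (θ φ : ℝ) : Prop :=
  0 ≤ φ ∧ φ ≤ deltaAngle ∧ alphaFn φ ≤ θ ∧ θ ≤ π / 3

end

/-! Everything is read off from the four heights `height v u i`, the inner products of `u` with the
vertices taken relative to the centroid. They sum to 0, their squares sum to 1/2, and they are, up
to a factor, the only affine dependence of the four projected vertices
(`IsUnitRegularSimplex.isAffineCircuit`). Their signs therefore decide the shape of the shadow: one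
sign against three gives a triangle, two against two a quadrilateral whose diagonals join vertices
of equal sign. The projected face opposite to vertex i has area |height i| / √2, and in both shapes
this yields area = (∑ |height i|) / (2√2) (`IsUnitRegularSimplex.chorowidth_eq`).

For almost every `u` no height vanishes, and an edge k l lies on the boundary of the shadow exactly
when the two other vertices i, j have heights of opposite sign. Perimeter and vertex count are thus
both sums over the six edges of a weight times the indicator of height i * height j < 0, the weight
being the projected length or 1 (`IsUnitRegularSimplex.generic_shadow`).

By linearity it remains to integrate over single edges. The directions of two opposite edges and the
common perpendicular form an orthonormal basis, in which height i * height j and the projected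
length of k l are functions of the same two coordinates
(`IsUnitRegularSimplex.exists_basis_height`). Such a function is homogeneous, and comparing its
Gaussian integral in spherical and in cylindrical coordinates turns the mean over the sphere into an
integral over a circle (`integral_uniformSphere_coord`). The indicator changes at the angle arctan
√2 = (π - arcsec 3) / 2, which brings in arcsec 3. As the vertex count is almost surely 3 or 4, its
mean determines both probabilities.

On the dodecant, height 0 is nonnegative and height 3 nonpositive; the curves α and β are the zero
sets of heights 1 and 2. Each region fixes the weak signs of all four heights, hence the formulas
for area and perimeter. The symmetries only permute the heights or replace `u` by `-u`. -/

/-! ### Convex hulls of finite families in barycentric coordinates -/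

section ConvexHullOfFamily

variable {S : Type*} [NormedAddCommGroup S] [NormedSpace ℝ S]

/-- `w` is a system of barycentric coordinates of `x` with respect to the family `p`. -/
structure IsBary {ι : Type*} [Fintype ι] (p : ι → S) (w : ι → ℝ) (x : S) : Prop where
  sum_eq_one : ∑ i, w i = 1
  sum_smul_eq : ∑ i, w i • p i = x

theorem mem_convexHull_range_iff {ι : Type*} [Fintype ι] {p : ι → S} {x : S} :
    x ∈ convexHull ℝ (range p) ↔ ∃ w : ι → ℝ, (∀ i, 0 ≤ w i) ∧ IsBary p w x := by
  classical
  constructor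
  · intro hx
    have hsub : convexHull ℝ (range p) ⊆ {x | ∃ w : ι → ℝ, (∀ i, 0 ≤ w i) ∧ IsBary p w x} := by
      apply convexHull_min
      · rintro _ ⟨i, rfl⟩
        refine ⟨Pi.single i 1, fun j => ?_, ⟨by simp, ?_⟩⟩
        · by_cases h : j = i
          · subst h; simp
          · simp [h]
        · rw [Finset.sum_eq_single i] <;> simp +contextual
      · rintro x ⟨w, hw, hx⟩ y ⟨w', hw', hy⟩ a b ha hb hab
        refine ⟨fun i => a * w i + b * w' i, fun i => ?_, ⟨?_, ?_⟩⟩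
        · have := hw i; have := hw' i; positivity
        · rw [Finset.sum_add_distrib, ← Finset.mul_sum, ← Finset.mul_sum, hx.1, hy.1]; simpa
        · simp only [add_smul, Finset.sum_add_distrib, mul_smul, ← Finset.smul_sum, hx.2, hy.2]
    exact hsub hx
  · rintro ⟨w, hw, hx⟩
    exact mem_convexHull_of_exists_fintype w p hw hx.1 (fun i => mem_range_self i) hx.2

theorem IsBary.combo {ι : Type*} [Fintype ι] {p : ι → S} {w w' : ι → ℝ} {x y : S}
    (hx : IsBary p w x) (hy : IsBary p w' y) {a b : ℝ} (hab : a + b = 1) :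
    IsBary p (fun i => a * w i + b * w' i) (a • x + b • y) := by
  constructor
  · rw [Finset.sum_add_distrib, ← Finset.mul_sum, ← Finset.mul_sum, hx.1, hy.1]; simpa
  · simp only [add_smul, Finset.sum_add_distrib, mul_smul, ← Finset.smul_sum, hx.2, hy.2]

/-- The interior of the convex hull of a finite family consists of the points with positive
barycentric coordinates, provided that it is not empty. -/
theorem mem_interior_convexHull_range_iff {ι : Type*} [Fintype ι] [Nonempty ι] {p : ι → S}
    (hne : (interior (convexHull ℝ (range p))).Nonempty) {x : S} :
    x ∈ interior (convexHull ℝ (range p)) ↔ ∃ w : ι → ℝ, (∀ i, 0 < w i) ∧ IsBary p w x := by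
  set K := convexHull ℝ (range p) with hK
  have hconv : Convex ℝ K := convex_convexHull ℝ _
  constructor
  · intro hx
    set n : ℝ := (Fintype.card ι : ℝ) with hn
    have hn0 : 0 < n := by simp [hn, Fintype.card_pos]
    set c : S := ∑ i, n⁻¹ • p i with hc
    have hcb : IsBary p (fun _ => n⁻¹) c := ⟨by simp [hn], rfl⟩
    -- An interior point can be pushed slightly away from the barycentre `c` without leaving the
    -- hull. It is then a proper mixture of the pushed point and `c`, so each weight is at least a
    -- positive multiple of 1/n.
    have hcont : ContinuousAt (fun e : ℝ => x + e • (x - c)) 0 := by fun_prop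
    have hmem : ∀ᶠ e in nhds (0 : ℝ), x + e • (x - c) ∈ K := by
      apply hcont.eventually_mem
      simpa using mem_interior_iff_mem_nhds.1 hx
    obtain ⟨e, he, hpos⟩ := ((hmem.filter_mono nhdsWithin_le_nhds).and
      (self_mem_nhdsWithin : Ioi (0 : ℝ) ∈ nhdsWithin 0 (Ioi 0))).exists
    have hpos : 0 < e := hpos
    obtain ⟨w, hw, hwb⟩ := mem_convexHull_range_iff.1 he
    have h1 : 1 / (1 + e) + e / (1 + e) = 1 := by field_simp
    refine ⟨fun i => 1 / (1 + e) * w i + e / (1 + e) * n⁻¹, fun i => ?_, ?_⟩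
    rotate_left
    · have := hwb.combo hcb h1
      convert this using 1
      have h2 : (1 / (1 + e)) * (1 + e) = 1 := by field_simp
      have h3 : e / (1 + e) = 1 / (1 + e) * e := by ring
      rw [h3, mul_smul, ← smul_add]
      have : x + e • (x - c) + e • c = (1 + e) • x := by module
      rw [this, smul_smul, h2, one_smul]
    · have := hw i
      positivity
  · rintro ⟨w, hw, hx⟩
    obtain ⟨c, hc⟩ := hne
    obtain ⟨m, hm, hcb⟩ := mem_convexHull_range_iff.1 (interior_subset hc)
    -- Positive coordinates survive a small push away from the interior point `c`; hence `x` lies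
    -- strictly between `c` and a point of the hull.
    have hev : ∀ᶠ e in nhds (0 : ℝ), ∀ i, 0 < (1 + e) * w i + (-e) * m i := by
      rw [Filter.eventually_all]
      intro i
      have hcont : ContinuousAt (fun e : ℝ => (1 + e) * w i + (-e) * m i) 0 := by fun_prop
      exact hcont.eventually_mem (Ioi_mem_nhds (by simpa using hw i))
    obtain ⟨e, he, hpos⟩ := ((hev.filter_mono nhdsWithin_le_nhds).and
      (self_mem_nhdsWithin : Ioi (0 : ℝ) ∈ nhdsWithin 0 (Ioi 0))).exists
    have hpos : 0 < e := hpos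
    have hy := hx.combo hcb (a := 1 + e) (b := -e) (by ring)
    have hyK : (1 + e) • x + (-e) • c ∈ K := mem_convexHull_range_iff.2 ⟨_, fun i => (he i).le, hy⟩
    have := hconv.combo_interior_self_mem_interior hc hyK (a := e / (1 + e)) (b := 1 / (1 + e))
      (by positivity) (by positivity) (by field_simp; ring)
    convert this using 1
    have h2 : (1 / (1 + e)) * (1 + e) = 1 := by field_simp
    have h3 : e / (1 + e) = 1 / (1 + e) * e := by ring
    rw [h3, mul_smul, ← smul_add]
    have : e • c + ((1 + e) • x + (-e) • c) = (1 + e) • x := by module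
    rw [this, smul_smul, h2, one_smul]

theorem frontier_convexHull_range {ι : Type*} [Finite ι] (p : ι → S) :
    frontier (convexHull ℝ (range p)) =
      convexHull ℝ (range p) \ interior (convexHull ℝ (range p)) := by
  have : IsClosed (convexHull ℝ (range p)) := ((finite_range p).isCompact_convexHull ℝ).isClosed
  rw [frontier, this.closure_eq]

end ConvexHullOfFamily

/-! ### Four points with a single affine dependence -/

section FourPoints

variable {S : Type*} [NormedAddCommGroup S] [NormedSpace ℝ S]

theorem sum_univ_eq_of_four {M : Type*} [AddCommMonoid M] {i j k l : Fin 4}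
    (hu : ({i, j, k, l} : Finset (Fin 4)) = Finset.univ) (f : Fin 4 → M) :
    ∑ m, f m = f i + f j + f k + f l := by
  have hd : i ≠ j ∧ i ≠ k ∧ i ≠ l ∧ j ≠ k ∧ j ≠ l ∧ k ≠ l := by
    revert i j k l; decide
  obtain ⟨h1, h2, h3, h4, h5, h6⟩ := hd
  rw [← hu, Finset.sum_insert (by simp [*]), Finset.sum_insert (by simp [*]),
    Finset.sum_insert (by simp [*]), Finset.sum_singleton, add_assoc, add_assoc]

theorem mem_segment_iff_bary {p : Fin 4 → S} {i j k l : Fin 4}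
    (hu : ({i, j, k, l} : Finset (Fin 4)) = Finset.univ) {x : S} :
    x ∈ segment ℝ (p k) (p l) ↔
      ∃ w : Fin 4 → ℝ, (∀ m, 0 ≤ w m) ∧ IsBary p w x ∧ w i = 0 ∧ w j = 0 := by
  have hd : i ≠ j ∧ i ≠ k ∧ i ≠ l ∧ j ≠ k ∧ j ≠ l ∧ k ≠ l := by
    revert i j k l; decide
  obtain ⟨h1, h2, h3, h4, h5, h6⟩ := hd
  constructor
  · rintro ⟨a, b, ha, hb, hab, rfl⟩
    refine ⟨fun m => if m = k then a else if m = l then b else 0, fun m => ?_, ⟨?_, ?_⟩, ?_, ?_⟩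
    · dsimp only; split_ifs <;> first | assumption | exact le_rfl
    · rw [sum_univ_eq_of_four hu]; simp [*, h6.symm]
    · rw [sum_univ_eq_of_four hu]; simp [*, h6.symm]
    · simp [*]
    · simp [*]
  · rintro ⟨w, hw, ⟨h, rfl⟩, hi, hj⟩
    rw [sum_univ_eq_of_four hu] at h ⊢
    exact ⟨w k, w l, hw k, hw l, by simpa [hi, hj] using h, by simp [hi, hj]⟩

theorem mem_triangle_iff_bary {p : Fin 4 → S} {i j k l : Fin 4}
    (hu : ({i, j, k, l} : Finset (Fin 4)) = Finset.univ) {x : S} :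
    x ∈ convexHull ℝ {p j, p k, p l} ↔
      ∃ w : Fin 4 → ℝ, (∀ m, 0 ≤ w m) ∧ IsBary p w x ∧ w i = 0 := by
  have hd : i ≠ j ∧ i ≠ k ∧ i ≠ l ∧ j ≠ k ∧ j ≠ l ∧ k ≠ l := by
    revert i j k l; decide
  obtain ⟨h1, h2, h3, h4, h5, h6⟩ := hd
  have hr : ({p j, p k, p l} : Set S) = range ![p j, p k, p l] := by
    ext y; simp; tauto
  rw [hr, mem_convexHull_range_iff]
  constructor
  · rintro ⟨w, hw, ⟨h, rfl⟩⟩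
    rw [Fin.sum_univ_three] at h
    refine ⟨fun m => if m = j then w 0 else if m = k then w 1 else if m = l then w 2 else 0,
      fun m => ?_, ⟨?_, ?_⟩, ?_⟩
    · dsimp only; split_ifs <;> first | exact hw _ | exact le_rfl
    · rw [sum_univ_eq_of_four hu]; simp [*, h4.symm, h5.symm, h6.symm]
    · rw [sum_univ_eq_of_four hu]; simp [*, h4.symm, h5.symm, h6.symm, Fin.sum_univ_three]
    · simp [*]
  · rintro ⟨w, hw, ⟨h, rfl⟩, hi⟩
    rw [sum_univ_eq_of_four hu] at h ⊢
    refine ⟨![w j, w k, w l], fun m => ?_, ⟨?_, ?_⟩⟩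
    · fin_cases m <;> simp [hw]
    · simpa [Fin.sum_univ_three, hi] using h
    · simp [Fin.sum_univ_three, hi]

/-- The affine dependences of the four points `p i` are exactly the multiples of `t`. -/
structure IsAffineCircuit (p : Fin 4 → S) (t : Fin 4 → ℝ) : Prop where
  sum_eq_zero : ∑ i, t i = 0
  sum_smul_eq_zero : ∑ i, t i • p i = 0
  exists_eq_mul : ∀ μ : Fin 4 → ℝ, ∑ i, μ i = 0 → ∑ i, μ i • p i = 0 → ∃ s, ∀ i, μ i = s * t i

namespace IsAffineCircuit

variable {p : Fin 4 → S} {t : Fin 4 → ℝ}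

theorem neg (ht : IsAffineCircuit p t) : IsAffineCircuit p (-t) where
  sum_eq_zero := by simp [ht.sum_eq_zero]
  sum_smul_eq_zero := by simp [ht.sum_smul_eq_zero]
  exists_eq_mul μ h1 h2 := by
    obtain ⟨s, hs⟩ := ht.exists_eq_mul μ h1 h2
    exact ⟨-s, fun i => by simp [hs i]⟩

theorem bary_shift (ht : IsAffineCircuit p t) {w : Fin 4 → ℝ} {x : S} (hw : IsBary p w x) (s : ℝ) :
    IsBary p (fun i => w i + s * t i) x where
  sum_eq_one := by
    rw [Finset.sum_add_distrib, ← Finset.mul_sum, hw.1, ht.sum_eq_zero]; simp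
  sum_smul_eq := by
    simp only [add_smul, Finset.sum_add_distrib, mul_smul, ← Finset.smul_sum, hw.2,
      ht.sum_smul_eq_zero]; simp

/-- The difference of two coordinate systems is an affine dependence. With `bary_shift`, the
coordinates of a point form a line of direction `t`, so geometric questions become questions about
the signs of `t`. -/
theorem bary_unique (ht : IsAffineCircuit p t) {w w' : Fin 4 → ℝ} {x : S} (hw : IsBary p w x) (hw' : IsBary p w' x) :
    ∃ s, ∀ i, w' i = w i + s * t i := by
  obtain ⟨s, hs⟩ := ht.exists_eq_mul (fun i => w' i - w i)
    (by rw [Finset.sum_sub_distrib, hw.1, hw'.1, sub_self])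
    (by simp only [sub_smul, Finset.sum_sub_distrib, hw.2, hw'.2, sub_self])
  exact ⟨s, fun i => by rw [← hs i]; ring⟩

/-- A small positive multiple of `t` makes the vanishing coordinates positive and keeps the others
positive. -/
theorem mem_interior_of_bary (ht : IsAffineCircuit p t) (hne : (interior (convexHull ℝ (range p))).Nonempty)
    {w : Fin 4 → ℝ} {x : S} (hw : IsBary p w x) (h : ∀ i, 0 < w i ∨ (w i = 0 ∧ 0 < t i)) :
    x ∈ interior (convexHull ℝ (range p)) := by
  have hev : ∀ᶠ e in nhdsWithin (0 : ℝ) (Ioi 0), ∀ i, 0 < w i + e * t i := by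
    rw [Filter.eventually_all]
    intro i
    rcases h i with h | ⟨h, h'⟩
    · have hcont : ContinuousAt (fun e : ℝ => w i + e * t i) 0 := by fun_prop
      exact (hcont.eventually_mem (Ioi_mem_nhds (by simpa using h))).filter_mono
        nhdsWithin_le_nhds
    · filter_upwards [self_mem_nhdsWithin] with e he
      rw [h, zero_add]
      exact mul_pos he h'
  obtain ⟨e, he⟩ := hev.exists
  exact (mem_interior_convexHull_range_iff hne).2 ⟨_, he, ht.bary_shift hw e⟩

/-- Any other coordinates are `w + s t`. Positivity at i forces s > 0, and then the coordinate at j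
is nonpositive. -/
theorem notMem_interior_of_bary (ht : IsAffineCircuit p t) (hne : (interior (convexHull ℝ (range p))).Nonempty)
    {w : Fin 4 → ℝ} {x : S} (hw : IsBary p w x) {i j : Fin 4} (hi : w i = 0) (hj : w j = 0)
    (hti : 0 ≤ t i) (htj : t j ≤ 0) :
    x ∉ interior (convexHull ℝ (range p)) := by
  intro hx
  obtain ⟨w', hw', hb⟩ := (mem_interior_convexHull_range_iff hne).1 hx
  obtain ⟨s, hs⟩ := ht.bary_unique hw hb
  have h1 := hw' i
  have h2 := hw' j
  rw [hs, hi, zero_add] at h1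
  rw [hs, hj, zero_add] at h2
  nlinarith [pos_of_mul_pos_left h1 hti]

theorem segment_subset_frontier (ht : IsAffineCircuit p t) (hne : (interior (convexHull ℝ (range p))).Nonempty)
    {i j k l : Fin 4} (hu : ({i, j, k, l} : Finset (Fin 4)) = Finset.univ)
    (hti : 0 ≤ t i) (htj : t j ≤ 0) :
    segment ℝ (p k) (p l) ⊆ frontier (convexHull ℝ (range p)) := by
  intro x hx
  obtain ⟨w, hw, hb, hi, hj⟩ := (mem_segment_iff_bary hu).1 hx
  rw [frontier_convexHull_range]
  exact ⟨mem_convexHull_range_iff.2 ⟨w, hw, hb⟩, ht.notMem_interior_of_bary hne hb hi hj hti htj⟩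

/-- A vertex is extreme if it has a single system of nonnegative barycentric coordinates. -/
theorem mem_extremePoints (ht : IsAffineCircuit p t) {m i j : Fin 4} (hi : i ≠ m) (hj : j ≠ m)
    (hti : 0 < t i) (htj : t j < 0) :
    p m ∈ (convexHull ℝ (range p)).extremePoints ℝ := by
  have hm : IsBary p (Pi.single m 1) (p m) :=
    ⟨by simp, by rw [Finset.sum_eq_single m] <;> simp +contextual⟩
  -- The coordinates of `p m` vanish at i and at j, where `t` has opposite signs, so no shift along
  -- `t` stays nonnegative.
  have huniq : ∀ w : Fin 4 → ℝ, (∀ i, 0 ≤ w i) → IsBary p w (p m) → w = Pi.single m 1 := by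
    intro w hw hb
    obtain ⟨s, hs⟩ := ht.bary_unique hm hb
    have h1 := hw i
    have h2 := hw j
    rw [hs, Pi.single_eq_of_ne hi, zero_add] at h1
    rw [hs, Pi.single_eq_of_ne hj, zero_add] at h2
    have hs0 : s = 0 := by nlinarith [nonneg_of_mul_nonneg_left h1 hti]
    ext q
    rw [hs, hs0]; simp
  rw [_root_.mem_extremePoints]
  refine ⟨subset_convexHull ℝ _ (mem_range_self m), ?_⟩
  intro x hx y hy hxy
  obtain ⟨w, hw, hbx⟩ := mem_convexHull_range_iff.1 hx
  obtain ⟨w', hw', hby⟩ := mem_convexHull_range_iff.1 hy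
  obtain ⟨a, b, ha, hb, hab, hm'⟩ := hxy
  have hcombo := hbx.combo hby hab
  rw [hm'] at hcombo
  have hfun := huniq _ (fun q => by have := hw q; have := hw' q; positivity) hcombo
  have hzero : ∀ q, q ≠ m → w q = 0 ∧ w' q = 0 := by
    intro q hq
    have h := congrFun hfun q
    rw [Pi.single_eq_of_ne hq] at h
    have h1 := hw q
    have h2 := hw' q
    have h3 := mul_nonneg ha.le h1
    have h4 := mul_nonneg hb.le h2
    constructor
    · have : a * w q = 0 := by linarith
      simpa [ha.ne'] using this
    · have : b * w' q = 0 := by linarith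
      simpa [hb.ne'] using this
  have hfin : ∀ (v : Fin 4 → ℝ) (z : S), IsBary p v z → (∀ q, q ≠ m → v q = 0) → z = p m := by
    intro v z hv hv0
    have h1 := hv.1
    rw [Finset.sum_eq_single m (fun q _ hq => hv0 q hq) (by simp)] at h1
    have h2 := hv.2
    rw [Finset.sum_eq_single m (fun q _ hq => by rw [hv0 q hq, zero_smul]) (by simp), h1,
      one_smul] at h2
    exact h2.symm
  exact ⟨hfin w x hbx fun q hq => (hzero q hq).1, hfin w' y hby fun q hq => (hzero q hq).2⟩

/-- A coincidence would be a dependence supported on m and n, hence a multiple of `t` that vanishes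
at i, hence zero. -/
theorem apply_ne_apply (ht : IsAffineCircuit p t) {m n i : Fin 4} (hmn : m ≠ n) (hm : i ≠ m) (hn : i ≠ n)
    (hti : t i ≠ 0) : p m ≠ p n := by
  intro h
  have hbm : IsBary p (Pi.single m 1) (p m) :=
    ⟨by simp, by rw [Finset.sum_eq_single m] <;> simp +contextual⟩
  have hbn : IsBary p (Pi.single n 1) (p m) :=
    ⟨by simp, by rw [Finset.sum_eq_single n] <;> simp +contextual [h]⟩
  obtain ⟨s, hs⟩ := ht.bary_unique hbm hbn
  have h1 := hs i
  rw [Pi.single_eq_of_ne hm, Pi.single_eq_of_ne hn, zero_add] at h1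
  have hs0 : s = 0 := by simpa [hti] using h1.symm
  have h2 := hs m
  rw [hs0, Pi.single_eq_same, Pi.single_eq_of_ne hmn] at h2
  norm_num at h2

end IsAffineCircuit

end FourPoints

/-! ### The two shapes: triangle and quadrilateral -/

namespace IsAffineCircuit

variable {S : Type*} [NormedAddCommGroup S] [NormedSpace ℝ S]
  {p : Fin 4 → S} {t : Fin 4 → ℝ}

/-- On both segments the coordinate at i is zero, and `t i ≠ 0` excludes any shift; so a common
point has the same coordinates on both and only k remains. -/
theorem segment_inter_segment_subset (ht : IsAffineCircuit p t) {i j k l : Fin 4}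
    (hu : ({i, j, k, l} : Finset (Fin 4)) = Finset.univ) (hti : t i ≠ 0) :
    segment ℝ (p k) (p l) ∩ segment ℝ (p k) (p j) ⊆ {p k} := by
  rintro x ⟨hx, hx'⟩
  have hu' : ({i, l, k, j} : Finset (Fin 4)) = Finset.univ := by
    rw [← hu]; ext m; simp only [Finset.mem_insert, Finset.mem_singleton]; tauto
  obtain ⟨w, -, hb, hi, hj⟩ := (mem_segment_iff_bary hu).1 hx
  obtain ⟨w', -, hb', hi', hl'⟩ := (mem_segment_iff_bary hu').1 hx'
  obtain ⟨s, hs⟩ := ht.bary_unique hb hb'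
  have hs0 : s = 0 := by
    have := hs i
    rw [hi, hi', zero_add] at this
    simpa [hti] using this.symm
  have hl : w l = 0 := by
    have := hs l
    rw [hl', hs0] at this
    simpa using this.symm
  have h1 := hb.1
  have h2 := hb.2
  rw [sum_univ_eq_of_four hu] at h1 h2
  have hk : w k = 1 := by simpa [hi, hj, hl] using h1
  rw [mem_singleton_iff, ← h2]
  simp [hi, hj, hl, hk]

/-- A common point would have coordinates s * t i and s * t j on the edge i j. Both are nonnegative
only for s = 0, and then they do not sum to 1. -/
theorem segment_inter_segment_eq_empty (ht : IsAffineCircuit p t) {i j k l : Fin 4}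
    (hu : ({i, j, k, l} : Finset (Fin 4)) = Finset.univ) (hti : 0 < t i) (htj : t j < 0) :
    segment ℝ (p k) (p l) ∩ segment ℝ (p i) (p j) = ∅ := by
  rw [eq_empty_iff_forall_notMem]
  rintro x ⟨hx, hx'⟩
  have hu' : ({k, l, i, j} : Finset (Fin 4)) = Finset.univ := by
    rw [← hu]; ext m; simp only [Finset.mem_insert, Finset.mem_singleton]; tauto
  obtain ⟨w, hw, hb, hi, hj⟩ := (mem_segment_iff_bary hu).1 hx
  obtain ⟨w', hw', hb', hk', hl'⟩ := (mem_segment_iff_bary hu').1 hx'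
  obtain ⟨s, hs⟩ := ht.bary_unique hb hb'
  have h1 := hw' i
  have h2 := hw' j
  rw [hs, hi, zero_add] at h1
  rw [hs, hj, zero_add] at h2
  have hs0 : s = 0 := by nlinarith [nonneg_of_mul_nonneg_left h1 hti]
  have h3 := hb'.1
  rw [sum_univ_eq_of_four hu, hk', hl', hs, hs, hi, hj, hs0] at h3
  norm_num at h3

/-- If `p 0` lies in the triangle of the other points, it can be eliminated from the barycentric
coordinates of a point of the hull. -/
theorem exists_bary_zero (ht : IsAffineCircuit p t) (h0 : 0 < t 0) (h1 : t 1 ≤ 0) (h2 : t 2 ≤ 0)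
    (h3 : t 3 ≤ 0) {x : S} (hx : x ∈ convexHull ℝ (range p)) :
    ∃ w : Fin 4 → ℝ, (∀ m, 0 ≤ w m) ∧ IsBary p w x ∧ w 0 = 0 := by
  obtain ⟨w, hw, hb⟩ := mem_convexHull_range_iff.1 hx
  have hr : 0 ≤ w 0 / t 0 := div_nonneg (hw 0) h0.le
  -- This multiple of `t` cancels the coordinate at 0; the others do not decrease, since `t` is
  -- nonpositive there.
  refine ⟨_, fun m => ?_, ht.bary_shift hb (-(w 0 / t 0)), by field_simp; ring⟩
  fin_cases m
  · simp [h0.ne']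
  · simp only [Fin.mk_one]; nlinarith [hw 1]
  · simp only [Fin.reduceFinMk]; nlinarith [hw 2]
  · simp only [Fin.reduceFinMk]; nlinarith [hw 3]

theorem convexHull_eq_triangle (ht : IsAffineCircuit p t) (h0 : 0 < t 0) (h1 : t 1 ≤ 0)
    (h2 : t 2 ≤ 0) (h3 : t 3 ≤ 0) :
    convexHull ℝ (range p) = convexHull ℝ {p 1, p 2, p 3} := by
  apply Subset.antisymm
  · intro x hx
    exact (mem_triangle_iff_bary (by decide)).2 (ht.exists_bary_zero h0 h1 h2 h3 hx)
  · apply convexHull_mono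
    rintro x (rfl | rfl | rfl) <;> exact mem_range_self _

theorem frontier_eq_triangle (ht : IsAffineCircuit p t)
    (hne : (interior (convexHull ℝ (range p))).Nonempty) (h0 : 0 < t 0) (h1 : t 1 ≤ 0)
    (h2 : t 2 ≤ 0) (h3 : t 3 ≤ 0) :
    frontier (convexHull ℝ (range p)) =
      segment ℝ (p 1) (p 2) ∪ (segment ℝ (p 1) (p 3) ∪ segment ℝ (p 2) (p 3)) := by
  apply Subset.antisymm
  · intro x hx
    rw [frontier_convexHull_range] at hx
    obtain ⟨w, hw, hb, hw0⟩ := ht.exists_bary_zero h0 h1 h2 h3 hx.1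
    by_cases c1 : w 1 = 0
    · exact Or.inr (Or.inr ((mem_segment_iff_bary (i := 0) (j := 1) (by decide)).2
        ⟨w, hw, hb, hw0, c1⟩))
    by_cases c2 : w 2 = 0
    · exact Or.inr (Or.inl ((mem_segment_iff_bary (i := 0) (j := 2) (by decide)).2
        ⟨w, hw, hb, hw0, c2⟩))
    by_cases c3 : w 3 = 0
    · exact Or.inl ((mem_segment_iff_bary (i := 0) (j := 3) (by decide)).2 ⟨w, hw, hb, hw0, c3⟩)
    refine absurd (ht.mem_interior_of_bary hne hb fun i => ?_) hx.2
    -- The only vanishing coordinate is the one at 0, where `t` is positive; a point off the three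
    -- sides is therefore interior.
    fin_cases i
    · exact Or.inr ⟨hw0, h0⟩
    · exact Or.inl ((hw 1).lt_of_ne' c1)
    · exact Or.inl ((hw 2).lt_of_ne' c2)
    · exact Or.inl ((hw 3).lt_of_ne' c3)
  · exact union_subset (ht.segment_subset_frontier hne (i := 0) (j := 3) (by decide) h0.le h3)
      (union_subset (ht.segment_subset_frontier hne (i := 0) (j := 2) (by decide) h0.le h2)
      (ht.segment_subset_frontier hne (i := 0) (j := 1) (by decide) h0.le h1))

/-- If the segments `p 0 p 1` and `p 2 p 3` cross, one of `p 2`, `p 3` can be eliminated from the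
barycentric coordinates of a point of the hull. -/
theorem exists_bary_two_or_three (ht : IsAffineCircuit p t) (h0 : 0 ≤ t 0) (h1 : 0 ≤ t 1)
    (h2 : t 2 < 0) (h3 : t 3 < 0) {x : S} (hx : x ∈ convexHull ℝ (range p)) :
    ∃ w : Fin 4 → ℝ, (∀ m, 0 ≤ w m) ∧ IsBary p w x ∧ (w 2 = 0 ∨ w 3 = 0) := by
  obtain ⟨w, hw, hb⟩ := mem_convexHull_range_iff.1 hx
  have hr2 : 0 ≤ w 2 / -t 2 := div_nonneg (hw 2) (by linarith)
  have hr3 : 0 ≤ w 3 / -t 3 := div_nonneg (hw 3) (by linarith)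
  have e2 : w 2 / -t 2 * t 2 = -w 2 := by have := h2.ne; field_simp
  have e3 : w 3 / -t 3 * t 3 = -w 3 := by have := h3.ne; field_simp
  -- The smaller ratio is the largest shift along `t` that keeps the coordinates at 2 and 3
  -- nonnegative, and it annihilates one of them.
  rcases le_total (w 2 / -t 2) (w 3 / -t 3) with h | h
  · refine ⟨_, fun m => ?_, ht.bary_shift hb (w 2 / -t 2), Or.inl (by linarith)⟩
    fin_cases m
    · simp only [Fin.zero_eta]; nlinarith [hw 0]
    · simp only [Fin.mk_one]; nlinarith [hw 1]
    · simp only [Fin.reduceFinMk]; linarith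
    · simp only [Fin.reduceFinMk]; nlinarith [hw 3]
  · refine ⟨_, fun m => ?_, ht.bary_shift hb (w 3 / -t 3), Or.inr (by linarith)⟩
    fin_cases m
    · simp only [Fin.zero_eta]; nlinarith [hw 0]
    · simp only [Fin.mk_one]; nlinarith [hw 1]
    · simp only [Fin.reduceFinMk]; nlinarith [hw 2]
    · simp only [Fin.reduceFinMk]; linarith

theorem convexHull_eq_union_triangles (ht : IsAffineCircuit p t) (h0 : 0 ≤ t 0) (h1 : 0 ≤ t 1)
    (h2 : t 2 < 0) (h3 : t 3 < 0) :
    convexHull ℝ (range p) = convexHull ℝ {p 0, p 1, p 2} ∪ convexHull ℝ {p 0, p 1, p 3} := by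
  apply Subset.antisymm
  · intro x hx
    obtain ⟨w, hw, hb, h | h⟩ := ht.exists_bary_two_or_three h0 h1 h2 h3 hx
    · exact Or.inr ((mem_triangle_iff_bary (i := 2) (by decide)).2 ⟨w, hw, hb, h⟩)
    · exact Or.inl ((mem_triangle_iff_bary (i := 3) (by decide)).2 ⟨w, hw, hb, h⟩)
  · apply union_subset <;> apply convexHull_mono <;>
      rintro x (rfl | rfl | rfl) <;> exact mem_range_self _

/-- The shift s between the two coordinate systems satisfies s ≥ 0 because it removes a nonnegative
coordinate at 2, and s ≤ 0 because it creates a nonnegative one at 3. -/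
theorem triangle_inter_triangle_subset (ht : IsAffineCircuit p t) (h2 : t 2 < 0) (h3 : t 3 < 0) :
    convexHull ℝ {p 0, p 1, p 2} ∩ convexHull ℝ {p 0, p 1, p 3} ⊆ segment ℝ (p 0) (p 1) := by
  rintro x ⟨hx, hx'⟩
  obtain ⟨w, hw, hb, hw3⟩ := (mem_triangle_iff_bary (i := 3) (by decide)).1 hx
  obtain ⟨w', hw', hb', hw2⟩ := (mem_triangle_iff_bary (i := 2) (by decide)).1 hx'
  obtain ⟨s, hs⟩ := ht.bary_unique hb hb'
  have e2 := hs 2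
  have e3 := hs 3
  have a2 := hw 2
  have a3 := hw' 3
  rw [hw2] at e2
  rw [hw3, zero_add] at e3
  have hs0 : s = 0 := by
    apply le_antisymm
    · by_contra hc
      nlinarith
    · by_contra hc
      nlinarith
  refine (mem_segment_iff_bary (i := 2) (j := 3) (by decide)).2 ⟨w, hw, hb, ?_, hw3⟩
  rw [hs0] at e2
  linarith

theorem frontier_eq_quadrilateral (ht : IsAffineCircuit p t)
    (hne : (interior (convexHull ℝ (range p))).Nonempty) (h0 : 0 < t 0) (h1 : 0 < t 1)
    (h2 : t 2 < 0) (h3 : t 3 < 0) :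
    frontier (convexHull ℝ (range p)) =
      segment ℝ (p 0) (p 2) ∪ (segment ℝ (p 0) (p 3) ∪
        (segment ℝ (p 1) (p 2) ∪ segment ℝ (p 1) (p 3))) := by
  apply Subset.antisymm
  · intro x hx
    rw [frontier_convexHull_range] at hx
    obtain ⟨w, hw, hb, h⟩ := ht.exists_bary_two_or_three h0.le h1.le h2 h3 hx.1
    -- If both coordinates were positive, a small shift along `-t` would make the coordinates at 2
    -- and 3 positive as well, and the point would be interior.
    have key : (w 0 = 0 ∨ w 1 = 0) := by
      by_contra! hc
      have hp0 := (hw 0).lt_of_ne' hc.1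
      have hp1 := (hw 1).lt_of_ne' hc.2
      refine absurd (ht.neg.mem_interior_of_bary hne hb fun i => ?_) hx.2
      fin_cases i
      · exact Or.inl hp0
      · exact Or.inl hp1
      · rcases (hw 2).eq_or_lt' with h | h
        · exact Or.inr ⟨h, by simpa using h2⟩
        · exact Or.inl h
      · rcases (hw 3).eq_or_lt' with h | h
        · exact Or.inr ⟨h, by simpa using h3⟩
        · exact Or.inl h
    rcases key with c | c <;> rcases h with h | h
    · exact Or.inr (Or.inr (Or.inr ((mem_segment_iff_bary (i := 0) (j := 2) (by decide)).2
        ⟨w, hw, hb, c, h⟩)))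
    · exact Or.inr (Or.inr (Or.inl ((mem_segment_iff_bary (i := 0) (j := 3) (by decide)).2
        ⟨w, hw, hb, c, h⟩)))
    · exact Or.inr (Or.inl ((mem_segment_iff_bary (i := 1) (j := 2) (by decide)).2
        ⟨w, hw, hb, c, h⟩))
    · exact Or.inl ((mem_segment_iff_bary (i := 1) (j := 3) (by decide)).2 ⟨w, hw, hb, c, h⟩)
  · exact union_subset (ht.segment_subset_frontier hne (i := 1) (j := 3) (by decide) h1.le h3.le)
      (union_subset (ht.segment_subset_frontier hne (i := 1) (j := 2) (by decide) h1.le h2.le)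
      (union_subset (ht.segment_subset_frontier hne (i := 0) (j := 3) (by decide) h0.le h3.le)
      (ht.segment_subset_frontier hne (i := 0) (j := 2) (by decide) h0.le h2.le)))

theorem ncard_extremePoints_triangle (ht : IsAffineCircuit p t) (h0 : 0 < t 0) (h1 : t 1 < 0)
    (h2 : t 2 < 0) (h3 : t 3 < 0) :
    ((convexHull ℝ (range p)).extremePoints ℝ).ncard = 3 := by
  have : (convexHull ℝ (range p)).extremePoints ℝ = {p 1, p 2, p 3} := by
    apply Subset.antisymm
    · rw [ht.convexHull_eq_triangle h0 h1.le h2.le h3.le]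
      exact extremePoints_convexHull_subset
    · rintro x (rfl | rfl | rfl)
      · exact ht.mem_extremePoints (i := 0) (j := 2) (by decide) (by decide) h0 h2
      · exact ht.mem_extremePoints (i := 0) (j := 1) (by decide) (by decide) h0 h1
      · exact ht.mem_extremePoints (i := 0) (j := 1) (by decide) (by decide) h0 h1
  rw [this, ncard_eq_three]
  exact ⟨_, _, _, ht.apply_ne_apply (i := 0) (by decide) (by decide) (by decide) h0.ne',
    ht.apply_ne_apply (i := 0) (by decide) (by decide) (by decide) h0.ne',
    ht.apply_ne_apply (i := 0) (by decide) (by decide) (by decide) h0.ne', rfl⟩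

theorem ncard_extremePoints_quadrilateral (ht : IsAffineCircuit p t) (h0 : 0 < t 0)
    (h1 : 0 < t 1) (h2 : t 2 < 0) (h3 : t 3 < 0) :
    ((convexHull ℝ (range p)).extremePoints ℝ).ncard = 4 := by
  have : (convexHull ℝ (range p)).extremePoints ℝ = range p := by
    apply Subset.antisymm
    · exact extremePoints_convexHull_subset
    · rintro x ⟨m, rfl⟩
      fin_cases m
      · exact ht.mem_extremePoints (i := 1) (j := 2) (by decide) (by decide) h1 h2
      · exact ht.mem_extremePoints (i := 0) (j := 2) (by decide) (by decide) h0 h2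
      · exact ht.mem_extremePoints (i := 1) (j := 3) (by decide) (by decide) h1 h3
      · exact ht.mem_extremePoints (i := 1) (j := 2) (by decide) (by decide) h1 h2
  have hinj : Function.Injective p := by
    intro m n hmn
    by_contra hc
    obtain ⟨i, him, hin⟩ : ∃ i : Fin 4, i ≠ m ∧ i ≠ n := by
      clear hmn; revert m n; decide
    refine ht.apply_ne_apply hc him hin ?_ hmn
    fin_cases i
    exacts [h0.ne', h1.ne', h2.ne, h3.ne]
  rw [this, ← image_univ, ncard_image_of_injective _ hinj]
  simp

end IsAffineCircuit

/-! ### Length of the boundary -/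

section Length

variable {S : Type*} [NormedAddCommGroup S] [NormedSpace ℝ S] [MeasurableSpace S] [BorelSpace S]

theorem measurableSet_segment (a b : S) : MeasurableSet (segment ℝ a b) := by
  rw [← convexHull_pair]
  exact ((toFinite {a, b}).isCompact_convexHull ℝ).isClosed.measurableSet

/-- One-dimensional Hausdorff measure has no atoms, so sides that share at most a corner contribute
additively to the perimeter. -/
theorem aedisjoint_hausdorffMeasure_of_subsingleton {S : Type*} [NormedAddCommGroup S]
    [MeasurableSpace S] [BorelSpace S] {A B : Set S} (h : (A ∩ B).Subsingleton) :
    AEDisjoint (Measure.hausdorffMeasure 1 : Measure S) A B :=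
  haveI := Measure.nullSingletonClass_hausdorff S (d := 1) one_pos
  h.measure_zero _

namespace IsAffineCircuit

variable {p : Fin 4 → S} {t : Fin 4 → ℝ}

theorem hausdorffMeasure_frontier_triangle (ht : IsAffineCircuit p t)
    (hne : (interior (convexHull ℝ (range p))).Nonempty) (h0 : 0 < t 0) (h1 : t 1 ≤ 0)
    (h2 : t 2 ≤ 0) (h3 : t 3 ≤ 0) :
    (Measure.hausdorffMeasure 1 : Measure S).real (frontier (convexHull ℝ (range p))) =
      dist (p 1) (p 2) + (dist (p 1) (p 3) + dist (p 2) (p 3)) := by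
  have d1 : AEDisjoint (Measure.hausdorffMeasure 1 : Measure S) (segment ℝ (p 1) (p 3))
      (segment ℝ (p 2) (p 3)) := by
    apply aedisjoint_hausdorffMeasure_of_subsingleton
    rw [segment_symm ℝ (p 1), segment_symm ℝ (p 2)]
    exact subsingleton_singleton.anti
      (ht.segment_inter_segment_subset (i := 0) (by decide) h0.ne')
  have d2 : AEDisjoint (Measure.hausdorffMeasure 1 : Measure S) (segment ℝ (p 1) (p 2))
      (segment ℝ (p 1) (p 3)) := by
    apply aedisjoint_hausdorffMeasure_of_subsingleton
    exact subsingleton_singleton.anti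
      (ht.segment_inter_segment_subset (i := 0) (by decide) h0.ne')
  have d3 : AEDisjoint (Measure.hausdorffMeasure 1 : Measure S) (segment ℝ (p 1) (p 2))
      (segment ℝ (p 2) (p 3)) := by
    apply aedisjoint_hausdorffMeasure_of_subsingleton
    rw [segment_symm ℝ (p 1)]
    exact subsingleton_singleton.anti
      (ht.segment_inter_segment_subset (i := 0) (by decide) h0.ne')
  rw [ht.frontier_eq_triangle hne h0 h1 h2 h3, measureReal_def,
    measure_union₀ ((measurableSet_segment _ _).union (measurableSet_segment _ _)).nullMeasurableSet
      (AEDisjoint.union_right_iff.2 ⟨d2, d3⟩),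
    measure_union₀ (measurableSet_segment _ _).nullMeasurableSet d1]
  simp only [hausdorffMeasure_segment]
  rw [ENNReal.toReal_add, ENNReal.toReal_add]
  · simp only [dist_edist]
  all_goals simp [edist_ne_top]

theorem hausdorffMeasure_frontier_quadrilateral (ht : IsAffineCircuit p t)
    (hne : (interior (convexHull ℝ (range p))).Nonempty) (h0 : 0 < t 0) (h1 : 0 < t 1)
    (h2 : t 2 < 0) (h3 : t 3 < 0) :
    (Measure.hausdorffMeasure 1 : Measure S).real (frontier (convexHull ℝ (range p))) =
      dist (p 0) (p 2) + (dist (p 0) (p 3) + (dist (p 1) (p 2) + dist (p 1) (p 3))) := by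
  have d1 : AEDisjoint (Measure.hausdorffMeasure 1 : Measure S) (segment ℝ (p 1) (p 2))
      (segment ℝ (p 1) (p 3)) := by
    apply aedisjoint_hausdorffMeasure_of_subsingleton
    exact subsingleton_singleton.anti
      (ht.segment_inter_segment_subset (i := 0) (by decide) h0.ne')
  have d2 : AEDisjoint (Measure.hausdorffMeasure 1 : Measure S) (segment ℝ (p 0) (p 3))
      (segment ℝ (p 1) (p 2)) := by
    apply aedisjoint_hausdorffMeasure_of_subsingleton
    rw [ht.segment_inter_segment_eq_empty (by decide) h1 h2]
    exact subsingleton_empty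
  have d3 : AEDisjoint (Measure.hausdorffMeasure 1 : Measure S) (segment ℝ (p 0) (p 3))
      (segment ℝ (p 1) (p 3)) := by
    apply aedisjoint_hausdorffMeasure_of_subsingleton
    rw [segment_symm ℝ (p 0), segment_symm ℝ (p 1)]
    exact subsingleton_singleton.anti
      (ht.segment_inter_segment_subset (i := 2) (by decide) h2.ne)
  have d4 : AEDisjoint (Measure.hausdorffMeasure 1 : Measure S) (segment ℝ (p 0) (p 2))
      (segment ℝ (p 0) (p 3)) := by
    apply aedisjoint_hausdorffMeasure_of_subsingleton
    exact subsingleton_singleton.anti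
      (ht.segment_inter_segment_subset (i := 1) (by decide) h1.ne')
  have d5 : AEDisjoint (Measure.hausdorffMeasure 1 : Measure S) (segment ℝ (p 0) (p 2))
      (segment ℝ (p 1) (p 2)) := by
    apply aedisjoint_hausdorffMeasure_of_subsingleton
    rw [segment_symm ℝ (p 0), segment_symm ℝ (p 1)]
    exact subsingleton_singleton.anti
      (ht.segment_inter_segment_subset (i := 3) (by decide) h3.ne)
  have d6 : AEDisjoint (Measure.hausdorffMeasure 1 : Measure S) (segment ℝ (p 0) (p 2))
      (segment ℝ (p 1) (p 3)) := by
    apply aedisjoint_hausdorffMeasure_of_subsingleton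
    rw [ht.segment_inter_segment_eq_empty (by decide) h1 h3]
    exact subsingleton_empty
  have m (i j : Fin 4) := measurableSet_segment (p i) (p j)
  rw [ht.frontier_eq_quadrilateral hne h0 h1 h2 h3, measureReal_def,
    measure_union₀ ((m 0 3).union ((m 1 2).union (m 1 3))).nullMeasurableSet
      (AEDisjoint.union_right_iff.2 ⟨d4, AEDisjoint.union_right_iff.2 ⟨d5, d6⟩⟩),
    measure_union₀ ((m 1 2).union (m 1 3)).nullMeasurableSet
      (AEDisjoint.union_right_iff.2 ⟨d2, d3⟩),
    measure_union₀ (m 1 3).nullMeasurableSet d1]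
  simp only [hausdorffMeasure_segment]
  rw [ENNReal.toReal_add, ENNReal.toReal_add, ENNReal.toReal_add]
  · simp only [dist_edist]
  all_goals simp [edist_ne_top]

end IsAffineCircuit

end Length

/-! ### Area of a triangle in a Euclidean plane -/

section TriangleArea

theorem volume_unitTriangle :
    (volume : Measure (ℝ × ℝ)) {q | 0 ≤ q.1 ∧ 0 ≤ q.2 ∧ q.1 + q.2 ≤ 1} = ENNReal.ofReal (1 / 2) := by
  have hm : MeasurableSet {q : ℝ × ℝ | 0 ≤ q.1 ∧ 0 ≤ q.2 ∧ q.1 + q.2 ≤ 1} := by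
    apply IsClosed.measurableSet
    apply (isClosed_le continuous_const continuous_fst).inter
    exact (isClosed_le continuous_const continuous_snd).inter
      (isClosed_le (continuous_fst.add continuous_snd) continuous_const)
  rw [Measure.volume_eq_prod, Measure.prod_apply hm]
  have hs : ∀ x : ℝ, volume (Prod.mk x ⁻¹' {q : ℝ × ℝ | 0 ≤ q.1 ∧ 0 ≤ q.2 ∧ q.1 + q.2 ≤ 1}) =
      (Icc (0 : ℝ) 1).indicator (fun x => ENNReal.ofReal (1 - x)) x := by
    intro x
    by_cases hx : 0 ≤ x
    · have : Prod.mk x ⁻¹' {q : ℝ × ℝ | 0 ≤ q.1 ∧ 0 ≤ q.2 ∧ q.1 + q.2 ≤ 1} = Icc 0 (1 - x) := by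
        ext y
        simp only [mem_preimage, mem_ofPred_eq, mem_Icc]
        constructor
        · rintro ⟨-, h1, h2⟩; exact ⟨h1, by linarith⟩
        · rintro ⟨h1, h2⟩; exact ⟨hx, h1, by linarith⟩
      rw [this, Real.volume_Icc, sub_zero]
      by_cases hx1 : x ≤ 1
      · rw [indicator_of_mem (by exact ⟨hx, hx1⟩)]
      · rw [indicator_of_notMem (by simp [hx1]), ENNReal.ofReal_eq_zero]
        linarith
    · have : Prod.mk x ⁻¹' {q : ℝ × ℝ | 0 ≤ q.1 ∧ 0 ≤ q.2 ∧ q.1 + q.2 ≤ 1} = ∅ := by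
        ext y; simp [hx]
      rw [this, indicator_of_notMem (by simp [hx])]; simp
  simp_rw [hs]
  rw [lintegral_indicator measurableSet_Icc, ← ofReal_integral_eq_lintegral_ofReal]
  · congr 1
    rw [integral_Icc_eq_integral_Ioc, ← intervalIntegral.integral_of_le zero_le_one]
    rw [intervalIntegral.integral_sub (by simp) (by simp)]
    norm_num
  · exact (by fun_prop : Continuous fun x : ℝ => 1 - x).continuousOn.integrableOn_Icc
  · filter_upwards [ae_restrict_mem measurableSet_Icc] with x hx
    simpa using hx.2

variable {E : Type*} [NormedAddCommGroup E] [InnerProductSpace ℝ E]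

/-- As an affine image of the coordinate triangle, any triangle has area equal to half an absolute
determinant. -/
theorem convexHull_triple_eq_image (b : OrthonormalBasis (Fin 2) ℝ E) (x y z : E) :
    convexHull ℝ {x, y, z} = (fun v => x + v) ''
      ((b.toBasis.constr ℝ ![y - x, z - x]) ''
        {v : E | 0 ≤ b.repr v 0 ∧ 0 ≤ b.repr v 1 ∧ b.repr v 0 + b.repr v 1 ≤ 1}) := by
  have hf : ∀ v : E, b.toBasis.constr ℝ ![y - x, z - x] v =
      b.repr v 0 • (y - x) + b.repr v 1 • (z - x) := by
    intro v
    rw [Module.Basis.constr_apply_fintype]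
    simp
  have hr : ({x, y, z} : Set E) = range ![x, y, z] := by
    ext q; simp; tauto
  ext q
  rw [hr, mem_convexHull_range_iff]
  simp only [mem_image, exists_exists_and_eq_and, hf]
  constructor
  · rintro ⟨w, hw, h1, h2⟩
    rw [Fin.sum_univ_three] at h1 h2
    refine ⟨b.repr.symm !₂[w 1, w 2], ⟨?_, ?_, ?_⟩, ?_⟩
    · simpa using hw 1
    · simpa using hw 2
    · simp; linarith [hw 0]
    · simp only [LinearIsometryEquiv.apply_symm_apply]
      rw [← h2]
      have : w 0 = 1 - w 1 - w 2 := by linarith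
      simp [this]
      module
  · rintro ⟨v, ⟨h0, h1, h2⟩, rfl⟩
    refine ⟨![1 - b.repr v 0 - b.repr v 1, b.repr v 0, b.repr v 1], fun i => ?_, ⟨?_, ?_⟩⟩
    · fin_cases i
      · simp; linarith
      · exact h0
      · exact h1
    · simp [Fin.sum_univ_three]; ring
    · simp [Fin.sum_univ_three]
      module

variable [FiniteDimensional ℝ E] [MeasurableSpace E] [BorelSpace E]

theorem volume_coord_triangle (b : OrthonormalBasis (Fin 2) ℝ E) :
    volume {x : E | 0 ≤ b.repr x 0 ∧ 0 ≤ b.repr x 1 ∧ b.repr x 0 + b.repr x 1 ≤ 1} =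
      ENNReal.ofReal (1 / 2) := by
  have hmp := (volume_preserving_finTwoArrow ℝ).comp
    ((PiLp.volume_preserving_ofLp (Fin 2)).comp b.measurePreserving_repr)
  rw [← volume_unitTriangle, ← hmp.measure_preimage]
  · rfl
  · apply MeasurableSet.nullMeasurableSet
    apply IsClosed.measurableSet
    apply (isClosed_le continuous_const continuous_fst).inter
    exact (isClosed_le continuous_const continuous_snd).inter
      (isClosed_le (continuous_fst.add continuous_snd) continuous_const)

/-- The area of a triangle in a Euclidean plane. -/
theorem volume_triangle (hE : Module.finrank ℝ E = 2) (x y z : E) :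
    volume (convexHull ℝ {x, y, z}) = ENNReal.ofReal
      (√(‖y - x‖ ^ 2 * ‖z - x‖ ^ 2 - inner ℝ (y - x) (z - x) ^ 2) / 2) := by
  let b : OrthonormalBasis (Fin 2) ℝ E := (stdOrthonormalBasis ℝ E).reindex (finCongr hE)
  rw [convexHull_triple_eq_image b, image_add_left, measure_preimage_add,
    Measure.addHaar_image_linearMap, volume_coord_triangle, ← ENNReal.ofReal_mul (abs_nonneg _)]
  congr 1
  have hdet : LinearMap.det (b.toBasis.constr ℝ ![y - x, z - x]) =
      b.repr (y - x) 0 * b.repr (z - x) 1 - b.repr (z - x) 0 * b.repr (y - x) 1 := by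
    rw [← LinearMap.det_toMatrix b.toBasis, Matrix.det_fin_two]
    simp [LinearMap.toMatrix_apply]
  -- The absolute determinant is the root of its square, which is the Gram determinant by Lagrange's
  -- identity.
  rw [hdet, ← Real.sqrt_sq_eq_abs, ← b.repr.norm_map (y - x), ← b.repr.norm_map (z - x),
    ← b.repr.inner_map_map (y - x) (z - x)]
  rw [EuclideanSpace.norm_sq_eq, EuclideanSpace.norm_sq_eq, PiLp.inner_apply]
  simp only [Fin.sum_univ_two, Real.norm_eq_abs, sq_abs, RCLike.inner_apply, conj_trivial]
  rw [mul_one_div]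
  congr 2
  ring

/-- A segment is a degenerate triangle with vanishing Gram determinant. -/
theorem volume_segment (hE : Module.finrank ℝ E = 2) (x y : E) :
    volume (segment ℝ x y) = 0 := by
  have := volume_triangle hE x y x
  rw [segment_symm]
  simpa [pair_comm, insert_comm] using this

end TriangleArea

/-! ### Metric relations of the regular tetrahedron -/

section Offsets

/-- The position of the vertex `v i` relative to the centroid. -/
noncomputable def offset (v : Fin 4 → E3) (i : Fin 4) : E3 := v i - (1 / 4 : ℝ) • ∑ j, v j

/-- The signed height of the vertex `v i` over the plane through the centroid orthogonal to `u`. -/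
noncomputable def height (v : Fin 4 → E3) (u : E3) (i : Fin 4) : ℝ := inner ℝ (offset v i) u

theorem offset_comp (v : Fin 4 → E3) (σ : Equiv.Perm (Fin 4)) :
    offset (v ∘ σ) = offset v ∘ σ := by
  funext i
  simp only [offset, Function.comp_apply, Equiv.sum_comp σ v]

theorem height_comp (v : Fin 4 → E3) (σ : Equiv.Perm (Fin 4)) (u : E3) :
    height (v ∘ σ) u = height v u ∘ σ := by
  funext i
  simp [height, offset_comp]

theorem height_neg (v : Fin 4 → E3) (u : E3) : height v (-u) = -height v u := by
  funext i
  simp [height]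

theorem tetrahedron_comp (v : Fin 4 → E3) (σ : Equiv.Perm (Fin 4)) :
    tetrahedron (v ∘ σ) = tetrahedron v := by
  rw [tetrahedron, tetrahedron, σ.surjective.range_comp]

theorem offset_sub_offset (v : Fin 4 → E3) (i j : Fin 4) :
    offset v i - offset v j = v i - v j := by
  simp [offset]

theorem sum_offset (v : Fin 4 → E3) : ∑ i, offset v i = 0 := by
  simp only [offset, Finset.sum_sub_distrib, Finset.sum_const, Finset.card_univ, Fintype.card_fin]
  module

theorem sum_height (v : Fin 4 → E3) (u : E3) : ∑ i, height v u i = 0 := by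
  simp only [height, ← sum_inner, sum_offset, inner_zero_left]

theorem sum_smul_eq_sum_smul_offset (v : Fin 4 → E3) {a : Fin 4 → ℝ} (ha : ∑ i, a i = 0) :
    ∑ i, a i • v i = ∑ i, a i • offset v i := by
  simp only [offset, smul_sub, Finset.sum_sub_distrib, ← Finset.sum_smul, ha, zero_smul, sub_zero]

variable {v : Fin 4 → E3}

theorem IsUnitRegularSimplex.comp (hv : IsUnitRegularSimplex v) (σ : Equiv.Perm (Fin 4)) :
    IsUnitRegularSimplex (v ∘ σ) :=
  fun _ _ hij => hv (σ.injective.ne hij)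

theorem inner_sub_sub_eq (a b c d : E3) : inner ℝ (a - b) (c - d) =
    (dist a d ^ 2 + dist b c ^ 2 - dist a c ^ 2 - dist b d ^ 2) / 2 := by
  simp only [dist_eq_norm, ← real_inner_self_eq_norm_sq, inner_sub_left, inner_sub_right,
    real_inner_comm]
  ring

theorem IsUnitRegularSimplex.dist_sq (hv : IsUnitRegularSimplex v) (i j : Fin 4) :
    dist (v i) (v j) ^ 2 = if i = j then 0 else 1 := by
  split_ifs with h
  · simp [h]
  · rw [hv h, one_pow]

/-- Each offset is the mean of the differences `v i - v m`, so polarisation expresses these products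
through distances. The metric facts below rest on this Gram matrix. -/
theorem IsUnitRegularSimplex.inner_offset (hv : IsUnitRegularSimplex v) (i j : Fin 4) :
    inner ℝ (offset v i) (offset v j) = if i = j then 3 / 8 else -1 / 8 := by
  have ho : ∀ i, offset v i = (1 / 4 : ℝ) • ∑ m, (v i - v m) := by
    intro i
    simp only [offset, Finset.sum_sub_distrib, Finset.sum_const, Finset.card_univ,
      Fintype.card_fin]
    module
  rw [ho, ho, inner_smul_left, inner_smul_right, sum_inner]
  simp only [inner_sum, inner_sub_sub_eq, hv.dist_sq]
  fin_cases i <;> fin_cases j <;> simp [Fin.sum_univ_four] <;> norm_num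

/-- The orthonormal basis attached to the pair of opposite edges `i j` and `k l`. -/
theorem IsUnitRegularSimplex.exists_basis (hv : IsUnitRegularSimplex v) {i j k l : Fin 4}
    (hu : ({i, j, k, l} : Finset (Fin 4)) = Finset.univ) :
    ∃ b : OrthonormalBasis (Fin 3) ℝ E3, b 0 = offset v i - offset v j ∧
      b 1 = √2 • (offset v i + offset v j) ∧ b 2 = offset v k - offset v l := by
  have hd : i ≠ j ∧ i ≠ k ∧ i ≠ l ∧ j ≠ k ∧ j ≠ l ∧ k ≠ l := by
    revert i j k l; decide
  obtain ⟨h1, h2, h3, h4, h5, h6⟩ := hd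
  -- Opposite edges are orthogonal unit vectors. The sum of the offsets of i and j has squared norm
  -- 3/8 + 3/8 - 2/8 = 1/2, whence the factor √2.
  have hon : Orthonormal ℝ
      ![offset v i - offset v j, √2 • (offset v i + offset v j), offset v k - offset v l] := by
    rw [orthonormal_iff_ite]
    have hs : √2 * √2 = 2 := Real.mul_self_sqrt (by norm_num)
    intro m n
    fin_cases m <;> fin_cases n <;>
      simp only [Fin.zero_eta, Fin.mk_one, Fin.reduceFinMk, Matrix.cons_val, inner_sub_left,
        inner_sub_right, inner_add_left, inner_add_right, inner_smul_left, inner_smul_right,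
        conj_trivial, hv.inner_offset, h1, h2, h3, h4, h5, h6, h1.symm, h2.symm, h3.symm,
        h4.symm, h5.symm, h6.symm, if_true, if_false, Fin.reduceEq] <;> linarith
  obtain ⟨b, hb⟩ := Orthonormal.exists_orthonormalBasis_extension_of_card_eq (𝕜 := ℝ) (E := E3)
    (ι := Fin 3) (by simp) (v := _) (s := univ) (hon.comp _ Subtype.val_injective)
  exact ⟨b, hb 0 trivial, hb 1 trivial, hb 2 trivial⟩

/-- The offsets form a tight frame. Since the heights sum to 0, the Gram matrix acts on them as 3/8
+ 1/8 = 1/2, so both sides have equal products with all offsets, and these span. -/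
theorem IsUnitRegularSimplex.eq_sum_smul_offset (hv : IsUnitRegularSimplex v) (x : E3) :
    x = ∑ i, (2 * height v x i) • offset v i := by
  obtain ⟨b, h0, h1, h2⟩ := hv.exists_basis (i := 0) (j := 1) (k := 2) (l := 3) (by decide)
  have key : ∀ j, inner ℝ (offset v j) x =
      inner ℝ (offset v j) (∑ i, (2 * height v x i) • offset v i) := by
    intro j
    have hs := sum_height v x
    rw [Fin.sum_univ_four] at hs
    simp only [inner_sum, inner_smul_right, hv.inner_offset]
    rw [← height, Fin.sum_univ_four]
    fin_cases j <;> simp <;> linarith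
  apply InnerProductSpace.ext_inner_left_basis b.toBasis
  intro i
  fin_cases i <;>
    simp only [OrthonormalBasis.coe_toBasis, Fin.zero_eta, Fin.mk_one, Fin.reduceFinMk, h0, h1, h2,
      inner_sub_left, inner_smul_left, inner_add_left, ← key]

theorem IsUnitRegularSimplex.sum_height_sq (hv : IsUnitRegularSimplex v) (u : E3) :
    ∑ i, height v u i ^ 2 = ‖u‖ ^ 2 / 2 := by
  have h : inner ℝ u u = inner ℝ (∑ i, (2 * height v u i) • offset v i) u := by
    rw [← hv.eq_sum_smul_offset u]
  rw [real_inner_self_eq_norm_sq, sum_inner] at h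
  simp only [inner_smul_left] at h
  rw [h, Finset.sum_div]
  refine Finset.sum_congr rfl fun i _ => ?_
  simp only [height, conj_trivial]
  ring

end Offsets

/-! ### The projected vertices and their dependence -/

section Projection

/-- The projection of the vertex `v i` on the plane orthogonal to `u`. -/
noncomputable def shadowPoint (v : Fin 4 → E3) (u : E3) (i : Fin 4) : orthPlane u :=
  (orthPlane u).orthogonalProjectionOnto (v i)

theorem shadow_tetrahedron (v : Fin 4 → E3) (u : E3) :
    shadow (tetrahedron v) (orthPlane u) = convexHull ℝ (range (shadowPoint v u)) := by
  have := ((orthPlane u).orthogonalProjectionOnto : E3 →ₗ[ℝ] orthPlane u).image_convexHull (range v)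
  rw [shadow, tetrahedron]
  refine this.trans ?_
  rw [← range_comp]
  rfl

theorem inner_projection {u : E3} (hu : ‖u‖ = 1) (x y : E3) :
    inner ℝ ((orthPlane u).orthogonalProjectionOnto x) ((orthPlane u).orthogonalProjectionOnto y) =
      inner ℝ x y - inner ℝ x u * inner ℝ y u := by
  have hp : ∀ x : E3, ((orthPlane u).orthogonalProjectionOnto x : E3) = x - inner ℝ u x • u := by
    intro x
    rw [← Submodule.starProjection_apply, Submodule.starProjection_orthogonal_val,
      Submodule.starProjection_unit_singleton ℝ hu]
  rw [Submodule.coe_inner, hp, hp]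
  simp only [inner_sub_left, inner_sub_right, inner_smul_left, inner_smul_right, conj_trivial]
  rw [real_inner_self_eq_norm_sq u, hu, real_inner_comm u x, real_inner_comm u y]
  ring

theorem finrank_orthPlane {u : E3} (hu : ‖u‖ = 1) : Module.finrank ℝ (orthPlane u) = 2 := by
  have : Fact (Module.finrank ℝ E3 = 2 + 1) := ⟨by simp⟩
  exact Submodule.finrank_orthogonal_span_singleton (by rintro rfl; simp at hu)

theorem shadowPoint_sub (v : Fin 4 → E3) (u : E3) (i j : Fin 4) :
    shadowPoint v u i - shadowPoint v u j =
      (orthPlane u).orthogonalProjectionOnto (offset v i - offset v j) := by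
  rw [offset_sub_offset, map_sub]; rfl

variable {v : Fin 4 → E3} {u : E3}

theorem IsUnitRegularSimplex.inner_shadowPoint_sub (hv : IsUnitRegularSimplex v) (hu : ‖u‖ = 1)
    (i j k : Fin 4) (hij : i ≠ j) (hik : i ≠ k) :
    inner ℝ (shadowPoint v u j - shadowPoint v u i) (shadowPoint v u k - shadowPoint v u i) =
      (if j = k then 1 else 1 / 2) -
        (height v u j - height v u i) * (height v u k - height v u i) := by
  rw [shadowPoint_sub, shadowPoint_sub, inner_projection hu]
  simp only [inner_sub_left, inner_sub_right, hv.inner_offset, height]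
  by_cases h : j = k
  · subst h; simp [hij, hij.symm, -inner_self_eq_norm_sq_to_K]; norm_num
  · simp [hik, hij.symm, h]; norm_num

/-- The length of the projection of a unit segment with height difference `a - b`. -/
noncomputable def edgeLength (a b : ℝ) : ℝ := √(1 - (a - b) ^ 2)

theorem edgeLength_comm (a b : ℝ) : edgeLength a b = edgeLength b a := by
  rw [edgeLength, edgeLength, sub_sq_comm]

theorem edgeLength_neg (a b : ℝ) : edgeLength (-a) (-b) = edgeLength a b := by
  rw [edgeLength, edgeLength]; congr 1; ring

theorem IsUnitRegularSimplex.dist_shadowPoint (hv : IsUnitRegularSimplex v) (hu : ‖u‖ = 1)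
    {i j : Fin 4} (hij : i ≠ j) :
    dist (shadowPoint v u i) (shadowPoint v u j) = edgeLength (height v u i) (height v u j) := by
  have h := hv.inner_shadowPoint_sub hu i j j hij hij
  rw [real_inner_self_eq_norm_sq, if_pos rfl] at h
  rw [edgeLength_comm, dist_comm, dist_eq_norm, edgeLength, ← Real.sqrt_sq (norm_nonneg _), h]
  congr 1
  ring

/-- The face has area √3/4 and its normal is the offset of i, of norm √6/4; projection multiplies
the area by |height i| / (√6/4). -/
theorem IsUnitRegularSimplex.volume_shadow_face (hv : IsUnitRegularSimplex v) (hu : ‖u‖ = 1)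
    {i j k l : Fin 4} (h : ({i, j, k, l} : Finset (Fin 4)) = Finset.univ) :
    volume (convexHull ℝ {shadowPoint v u j, shadowPoint v u k, shadowPoint v u l}) =
      ENNReal.ofReal (|height v u i| / √2) := by
  have hd : i ≠ j ∧ i ≠ k ∧ i ≠ l ∧ j ≠ k ∧ j ≠ l ∧ k ≠ l := by
    revert i j k l; decide
  obtain ⟨h1, h2, h3, h4, h5, h6⟩ := hd
  rw [volume_triangle (finrank_orthPlane hu), ← real_inner_self_eq_norm_sq,
    ← real_inner_self_eq_norm_sq, hv.inner_shadowPoint_sub hu j k k h4 h4,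
    hv.inner_shadowPoint_sub hu j l l h5 h5, hv.inner_shadowPoint_sub hu j k l h4 h5,
    if_pos rfl, if_pos rfl, if_neg h6]
  congr 1
  have hs := sum_height v u
  have hq := hv.sum_height_sq u
  rw [sum_univ_eq_of_four h] at hs hq
  rw [hu] at hq
  -- The Gram determinant reduces to this square because the heights have sum 0 and sum of squares
  -- 1/2.
  have hgram : (1 - (height v u k - height v u j) * (height v u k - height v u j)) *
      (1 - (height v u l - height v u j) * (height v u l - height v u j)) -
      (1 / 2 - (height v u k - height v u j) * (height v u l - height v u j)) ^ 2 =
      2 * height v u i ^ 2 := by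
    have hi : height v u i = -(height v u j + height v u k + height v u l) := by linarith
    rw [hi] at hq ⊢
    linear_combination (-3 / 2) * hq
  rw [hgram, Real.sqrt_mul (by norm_num), Real.sqrt_sq_eq_abs, div_eq_div_iff (by norm_num)
    (by positivity)]
  rw [mul_right_comm, Real.mul_self_sqrt (by norm_num), mul_comm]

/-- The combination of the vertices with the heights as weights is u/2, which projects to 0.
Conversely, a dependence of the projections lifts to a multiple s u; pairing with the offsets gives
weights 2 s times the heights. -/
theorem IsUnitRegularSimplex.isAffineCircuit (hv : IsUnitRegularSimplex v) (u : E3) :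
    IsAffineCircuit (shadowPoint v u) (height v u) := by
  have hproj : ∀ a : Fin 4 → ℝ, ∑ i, a i • shadowPoint v u i =
      (orthPlane u).orthogonalProjectionOnto (∑ i, a i • v i) := by
    intro a
    simp only [map_sum, map_smul]; rfl
  have hu2 : ∑ i, height v u i • v i = (1 / 2 : ℝ) • u := by
    rw [sum_smul_eq_sum_smul_offset v (sum_height v u)]
    conv_rhs => rw [hv.eq_sum_smul_offset u]
    rw [Finset.smul_sum]
    refine Finset.sum_congr rfl fun i _ => ?_
    rw [smul_smul]; congr 1; ring
  refine ⟨sum_height v u, ?_, fun μ h1 h2 => ?_⟩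
  · rw [hproj, hu2, map_smul, Submodule.orthogonalProjectionOnto_orthogonalComplement_singleton_eq_zero,
      smul_zero]
  · rw [hproj, Submodule.orthogonalProjectionOnto_eq_zero_iff, Submodule.orthogonal_orthogonal,
      Submodule.mem_span_singleton] at h2
    obtain ⟨s, hs⟩ := h2
    refine ⟨2 * s, fun i => ?_⟩
    have h3 : s * height v u i = inner ℝ (offset v i) (∑ j, μ j • v j) := by
      rw [← hs, inner_smul_right]; rfl
    rw [sum_smul_eq_sum_smul_offset v h1, inner_sum] at h3
    simp only [inner_smul_right, hv.inner_offset, Fin.sum_univ_four] at h3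
    rw [Fin.sum_univ_four] at h1
    rw [mul_assoc, h3]
    fin_cases i <;> simp <;> linarith

/-- By the tight frame identity, x has barycentric coordinates 1/4 plus twice the heights of x - c,
where c is the projected centroid. They are positive near c. -/
theorem IsUnitRegularSimplex.interior_nonempty (hv : IsUnitRegularSimplex v) (u : E3) :
    (interior (convexHull ℝ (range (shadowPoint v u)))).Nonempty := by
  set c : orthPlane u := (orthPlane u).orthogonalProjectionOnto ((1 / 4 : ℝ) • ∑ j, v j) with hc
  refine ⟨c, mem_interior.2 ⟨{x | ∀ i, 0 < 1 / 4 + 2 * height v (x - c : orthPlane u) i}, ?_, ?_, ?_⟩⟩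
  · intro x hx
    have h0 : ∑ i, 2 * height v (x - c : orthPlane u) i = 0 := by
      rw [← Finset.mul_sum, sum_height, mul_zero]
    refine mem_convexHull_range_iff.2 ⟨_, fun i => (hx i).le, ⟨?_, ?_⟩⟩
    · rw [Finset.sum_add_distrib, h0]; simp
    · have h1 : ∑ i, (2 * height v (x - c : orthPlane u) i) • shadowPoint v u i = x - c := by
        have : ∑ i, (2 * height v (x - c : orthPlane u) i) • shadowPoint v u i =
            (orthPlane u).orthogonalProjectionOnto
              (∑ i, (2 * height v (x - c : orthPlane u) i) • v i) := by
          simp only [map_sum, map_smul]; rfl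
        rw [this, sum_smul_eq_sum_smul_offset v h0, ← hv.eq_sum_smul_offset,
          Submodule.orthogonalProjectionOnto_mem_subspace_eq_self]
      have h2 : ∑ i, (1 / 4 : ℝ) • shadowPoint v u i = c := by
        rw [hc, map_smul, map_sum, Finset.smul_sum]; rfl
      simp only [add_smul, Finset.sum_add_distrib, h1, h2]
      abel
  · simp only [ofPred_forall]
    refine isOpen_iInter_of_finite fun i => isOpen_lt continuous_const ?_
    unfold height
    fun_prop
  · intro i
    simp [height]

end Projection

/-! ### Sign patterns of the heights -/

section SignPatterns

/-- The sign pattern in which the first point projects into the triangle of the others. -/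
def IsTrianglePattern (t : Fin 4 → ℝ) : Prop := 0 < t 0 ∧ t 1 ≤ 0 ∧ t 2 ≤ 0 ∧ t 3 ≤ 0

/-- The sign pattern in which the edges `0 1` and `2 3` cross in the projection. -/
def IsQuadPattern (t : Fin 4 → ℝ) : Prop := 0 < t 0 ∧ 0 < t 1 ∧ t 2 < 0 ∧ t 3 < 0

/-- After sorting, the least entry is negative and the greatest positive, since they sum to zero
without all vanishing; the signs of the two middle entries separate the three cases. -/
theorem exists_perm_pattern {t : Fin 4 → ℝ} (hs : ∑ i, t i = 0) (hq : 0 < ∑ i, t i ^ 2) :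
    ∃ σ : Equiv.Perm (Fin 4), IsTrianglePattern (t ∘ σ) ∨ IsTrianglePattern (-(t ∘ σ)) ∨
      IsQuadPattern (t ∘ σ) := by
  set τ := Tuple.sort t with hτ
  have hm : Monotone (t ∘ τ) := Tuple.monotone_sort t
  set r := t ∘ τ with hr
  have h01 : r 0 ≤ r 1 := hm (by decide)
  have h12 : r 1 ≤ r 2 := hm (by decide)
  have h23 : r 2 ≤ r 3 := hm (by decide)
  have hs' : r 0 + r 1 + r 2 + r 3 = 0 := by
    rw [← Fin.sum_univ_four, ← hs]; exact Equiv.sum_comp τ t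
  have hq' : 0 < r 0 ^ 2 + r 1 ^ 2 + r 2 ^ 2 + r 3 ^ 2 := by
    rw [← Fin.sum_univ_four (fun i => r i ^ 2)]
    exact hq.trans_eq (Equiv.sum_comp τ fun i => t i ^ 2).symm
  have h3 : 0 < r 3 := by
    by_contra! hc
    have e3 : r 3 = 0 := by linarith
    have e2 : r 2 = 0 := by linarith
    have e1 : r 1 = 0 := by linarith
    have e0 : r 0 = 0 := by linarith
    simp [e0, e1, e2, e3] at hq'
  have h0 : r 0 < 0 := by
    by_contra! hc
    linarith
  rcases le_or_gt (r 2) 0 with h2 | h2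
  · refine ⟨τ * Equiv.swap 0 3, Or.inl ⟨?_, ?_, ?_, ?_⟩⟩
    · exact h3
    · exact h12.trans h2
    · exact h2
    · exact h0.le
  · rcases le_or_gt 0 (r 1) with h1 | h1
    · refine ⟨τ, Or.inr (Or.inl ⟨?_, ?_, ?_, ?_⟩)⟩
      · exact neg_pos.2 h0
      · exact neg_nonpos.2 h1
      · exact neg_nonpos.2 h2.le
      · exact neg_nonpos.2 h3.le
    · refine ⟨τ * (Equiv.swap 0 2 * Equiv.swap 1 3), Or.inr (Or.inr ⟨?_, ?_, ?_, ?_⟩)⟩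
      · exact h2
      · exact h3
      · exact h0
      · exact h1

end SignPatterns

/-! ### Area and perimeter of the shadow in terms of heights -/

section Shadow

variable {v : Fin 4 → E3} {u : E3}

theorem orthPlane_neg (u : E3) : orthPlane (-u) = orthPlane u := by
  rw [orthPlane, orthPlane, ← Set.neg_singleton, Submodule.span_neg]

theorem IsUnitRegularSimplex.sum_height_sq_pos (hv : IsUnitRegularSimplex v) (hu : ‖u‖ = 1) :
    0 < ∑ i, height v u i ^ 2 := by
  rw [hv.sum_height_sq, hu]; norm_num

theorem IsUnitRegularSimplex.chorowidth_triangle (hv : IsUnitRegularSimplex v) (hu : ‖u‖ = 1)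
    (h : IsTrianglePattern (height v u)) :
    chorowidth (tetrahedron v) (orthPlane u) = (∑ i, |height v u i|) / (2 * √2) := by
  obtain ⟨h0, h1, h2, h3⟩ := h
  have hs := sum_height v u
  rw [Fin.sum_univ_four] at hs
  rw [chorowidth, measureReal_def, shadow_tetrahedron,
    (hv.isAffineCircuit u).convexHull_eq_triangle h0 h1 h2 h3,
    hv.volume_shadow_face hu (i := 0) (by decide), ENNReal.toReal_ofReal (by positivity),
    Fin.sum_univ_four, abs_of_pos h0, abs_of_nonpos h1, abs_of_nonpos h2, abs_of_nonpos h3,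
    div_eq_div_iff (by positivity) (by positivity)]
  -- The shadow is the projection of the face opposite to 0, and a zero sum makes height 0 half of
  -- the sum of absolute values.
  linear_combination √2 * hs

theorem IsUnitRegularSimplex.chorowidth_quad (hv : IsUnitRegularSimplex v) (hu : ‖u‖ = 1)
    (h : IsQuadPattern (height v u)) :
    chorowidth (tetrahedron v) (orthPlane u) = (∑ i, |height v u i|) / (2 * √2) := by
  obtain ⟨h0, h1, h2, h3⟩ := h
  have hs := sum_height v u
  rw [Fin.sum_univ_four] at hs
  have hc := hv.isAffineCircuit u
  have hm : MeasurableSet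
      (convexHull ℝ {shadowPoint v u 0, shadowPoint v u 1, shadowPoint v u 3}) :=
    ((toFinite _).isCompact_convexHull ℝ).isClosed.measurableSet
  rw [chorowidth, measureReal_def, shadow_tetrahedron,
    hc.convexHull_eq_union_triangles h0.le h1.le h2 h3,
    measure_union₀ hm.nullMeasurableSet (measure_mono_null (hc.triangle_inter_triangle_subset h2 h3)
      (volume_segment (finrank_orthPlane hu) _ _)),
    hv.volume_shadow_face hu (i := 3) (by decide), hv.volume_shadow_face hu (i := 2) (by decide),
    ENNReal.toReal_add (by simp) (by simp), ENNReal.toReal_ofReal (by positivity),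
    ENNReal.toReal_ofReal (by positivity),
    Fin.sum_univ_four, abs_of_pos h0, abs_of_pos h1, abs_of_neg h2, abs_of_neg h3, ← add_div,
    div_eq_div_iff (by positivity) (by positivity)]
  -- The diagonal 0 1 cuts the shadow into the faces opposite to 3 and to 2; the two negative
  -- heights carry half of the sum of absolute values.
  linear_combination (-√2) * hs

/-- The area of the projection of a regular tetrahedron. -/
theorem IsUnitRegularSimplex.chorowidth_eq (hv : IsUnitRegularSimplex v) (hu : ‖u‖ = 1) :
    chorowidth (tetrahedron v) (orthPlane u) = (∑ i, |height v u i|) / (2 * √2) := by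
  obtain ⟨σ, h⟩ := exists_perm_pattern (sum_height v u) (hv.sum_height_sq_pos hu)
  rw [← tetrahedron_comp v σ, ← Equiv.sum_comp σ]
  have hh : (fun i => |height v u (σ i)|) = fun i => |height (v ∘ σ) u i| := by
    simp [height_comp]
  rw [hh]
  rw [← height_comp] at h
  rcases h with h | h | h
  · exact (hv.comp σ).chorowidth_triangle hu h
  -- Reversing `u` keeps the plane and negates the heights, which turns the pattern into the first
  -- one.
  · rw [← height_neg] at h
    have := (hv.comp σ).chorowidth_triangle (u := -u) (by simpa using hu) h
    simpa [orthPlane_neg, height_neg] using this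
  · exact (hv.comp σ).chorowidth_quad hu h

theorem IsUnitRegularSimplex.periwidth_triangle (hv : IsUnitRegularSimplex v) (hu : ‖u‖ = 1)
    (h : IsTrianglePattern (height v u)) :
    periwidth (tetrahedron v) (orthPlane u) =
      edgeLength (height v u 1) (height v u 2) + edgeLength (height v u 1) (height v u 3) +
        edgeLength (height v u 2) (height v u 3) := by
  obtain ⟨h0, h1, h2, h3⟩ := h
  rw [periwidth, shadow_tetrahedron, (hv.isAffineCircuit u).hausdorffMeasure_frontier_triangle
    (hv.interior_nonempty u) h0 h1 h2 h3, hv.dist_shadowPoint hu (by decide),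
    hv.dist_shadowPoint hu (by decide), hv.dist_shadowPoint hu (by decide), add_assoc]

theorem IsUnitRegularSimplex.periwidth_triangle' (hv : IsUnitRegularSimplex v) (hu : ‖u‖ = 1)
    (h : IsTrianglePattern (-height v u)) :
    periwidth (tetrahedron v) (orthPlane u) =
      edgeLength (height v u 1) (height v u 2) + edgeLength (height v u 1) (height v u 3) +
        edgeLength (height v u 2) (height v u 3) := by
  rw [← height_neg] at h
  have := hv.periwidth_triangle (u := -u) (by simpa using hu) h
  simpa only [orthPlane_neg, height_neg, Pi.neg_apply, edgeLength_neg] using this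

theorem IsUnitRegularSimplex.periwidth_quad (hv : IsUnitRegularSimplex v) (hu : ‖u‖ = 1)
    (h : IsQuadPattern (height v u)) :
    periwidth (tetrahedron v) (orthPlane u) =
      edgeLength (height v u 0) (height v u 2) + edgeLength (height v u 0) (height v u 3) +
        edgeLength (height v u 1) (height v u 2) + edgeLength (height v u 1) (height v u 3) := by
  obtain ⟨h0, h1, h2, h3⟩ := h
  rw [periwidth, shadow_tetrahedron, (hv.isAffineCircuit u).hausdorffMeasure_frontier_quadrilateral
    (hv.interior_nonempty u) h0 h1 h2 h3, hv.dist_shadowPoint hu (by decide),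
    hv.dist_shadowPoint hu (by decide), hv.dist_shadowPoint hu (by decide),
    hv.dist_shadowPoint hu (by decide), add_assoc, add_assoc]

/-- The boundary case of a quadrilateral shadow with the vertex `2` on the edge `0 1`. -/
theorem IsUnitRegularSimplex.periwidth_quad_of_eq_zero (hv : IsUnitRegularSimplex v)
    (hu : ‖u‖ = 1) (h0 : 0 ≤ height v u 0) (h1 : 0 ≤ height v u 1) (h2 : height v u 2 ≤ 0)
    (h3 : height v u 3 = 0) :
    periwidth (tetrahedron v) (orthPlane u) =
      edgeLength (height v u 0) (height v u 2) + edgeLength (height v u 0) (height v u 3) +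
        edgeLength (height v u 1) (height v u 2) + edgeLength (height v u 1) (height v u 3) := by
  have hs := sum_height v u
  have hq := hv.sum_height_sq_pos hu
  rw [Fin.sum_univ_four] at hs hq
  have h2' : height v u 2 < 0 := by
    refine h2.lt_of_ne fun h => ?_
    have e0 : height v u 0 = 0 := by linarith
    have e1 : height v u 1 = 0 := by linarith
    simp [e0, e1, h, h3] at hq
  -- Vertex 2 is the only one of negative height, so the shadow is the triangle of the vertices 0,
  -- 1, 3.
  have hpat : IsTrianglePattern (-height (v ∘ (Equiv.swap 0 2)) u) := by
    rw [height_comp]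
    refine ⟨?_, ?_, ?_, ?_⟩
    · exact neg_pos.2 h2'
    · exact neg_nonpos.2 h1
    · exact neg_nonpos.2 h0
    · exact neg_nonpos.2 h3.ge
  have hp := (hv.comp (Equiv.swap 0 2)).periwidth_triangle' hu hpat
  rw [tetrahedron_comp, height_comp] at hp
  have hp' : periwidth (tetrahedron v) (orthPlane u) =
      edgeLength (height v u 1) (height v u 0) + edgeLength (height v u 1) (height v u 3) +
        edgeLength (height v u 0) (height v u 3) := hp
  -- With height 3 equal to zero, the dependence writes point 2 as a convex combination of points 0
  -- and 1. The side 0 1 then splits at 2, which recovers the four-term formula.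
  have hmem : shadowPoint v u 2 ∈ segment ℝ (shadowPoint v u 0) (shadowPoint v u 1) := by
    have hz := (hv.isAffineCircuit u).sum_smul_eq_zero
    rw [Fin.sum_univ_four, h3, zero_smul, add_zero] at hz
    have hne : -height v u 2 ≠ 0 := by linarith
    refine ⟨height v u 0 / -height v u 2, height v u 1 / -height v u 2,
      div_nonneg h0 (by linarith), div_nonneg h1 (by linarith), ?_, ?_⟩
    · rw [← add_div, div_eq_one_iff_eq hne]; linarith
    · rw [div_eq_inv_mul, div_eq_inv_mul, mul_smul, mul_smul, ← smul_add,
        eq_neg_of_add_eq_zero_left hz, ← neg_smul, smul_smul, inv_mul_cancel₀ hne, one_smul]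
  have hd := dist_add_dist_of_mem_segment hmem
  rw [hv.dist_shadowPoint hu (by decide), hv.dist_shadowPoint hu (by decide),
    hv.dist_shadowPoint hu (by decide)] at hd
  rw [hp', edgeLength_comm (height v u 1) (height v u 0), ← hd,
    edgeLength_comm (height v u 1) (height v u 2)]
  ring

/-- The regions of the dodecant are closed, so the four-term formula is needed also where heights
vanish. Relabelling, and reversing `u` when a zero occurs at 0 or 1, moves the zero to the last
place. -/
theorem IsUnitRegularSimplex.periwidth_weakQuad (hv : IsUnitRegularSimplex v) (hu : ‖u‖ = 1)
    (h0 : 0 ≤ height v u 0) (h1 : 0 ≤ height v u 1) (h2 : height v u 2 ≤ 0)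
    (h3 : height v u 3 ≤ 0) :
    periwidth (tetrahedron v) (orthPlane u) =
      edgeLength (height v u 0) (height v u 2) + edgeLength (height v u 0) (height v u 3) +
        edgeLength (height v u 1) (height v u 2) + edgeLength (height v u 1) (height v u 3) := by
  rcases h3.eq_or_lt with e3 | l3
  · exact hv.periwidth_quad_of_eq_zero hu h0 h1 h2 e3
  rcases h2.eq_or_lt with e2 | l2
  · have := (hv.comp (Equiv.swap 2 3)).periwidth_quad_of_eq_zero hu
      (by rw [height_comp]; exact h0) (by rw [height_comp]; exact h1)
      (by rw [height_comp]; exact h3) (by rw [height_comp]; exact e2)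
    rw [tetrahedron_comp, height_comp] at this
    have hp : periwidth (tetrahedron v) (orthPlane u) =
      edgeLength (height v u 0) (height v u 3) + edgeLength (height v u 0) (height v u 2) +
        edgeLength (height v u 1) (height v u 3) + edgeLength (height v u 1) (height v u 2) := this
    rw [hp]; ring
  have hu' : ‖-u‖ = 1 := by simpa using hu
  rcases h1.eq_or_lt with e1 | l1
  · have := (hv.comp (Equiv.swap 0 2 * Equiv.swap 1 3)).periwidth_quad_of_eq_zero hu'
      (by rw [height_comp, height_neg]; exact neg_nonneg.2 h2)
      (by rw [height_comp, height_neg]; exact neg_nonneg.2 h3)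
      (by rw [height_comp, height_neg]; exact neg_nonpos.2 h0)
      (by rw [height_comp, height_neg]; exact neg_eq_zero.2 e1.symm)
    rw [tetrahedron_comp, height_comp, height_neg, orthPlane_neg] at this
    simp only [Function.comp_apply, Pi.neg_apply, edgeLength_neg] at this
    have hp : periwidth (tetrahedron v) (orthPlane u) =
      edgeLength (height v u 2) (height v u 0) + edgeLength (height v u 2) (height v u 1) +
        edgeLength (height v u 3) (height v u 0) + edgeLength (height v u 3) (height v u 1) := this
    rw [hp, edgeLength_comm (height v u 2), edgeLength_comm (height v u 2),
      edgeLength_comm (height v u 3), edgeLength_comm (height v u 3)]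
    ring
  rcases h0.eq_or_lt with e0 | l0
  · have := (hv.comp (Equiv.swap 0 2 * Equiv.swap 1 3 * Equiv.swap 2 3)).periwidth_quad_of_eq_zero hu'
      (by rw [height_comp, height_neg]; exact neg_nonneg.2 h2)
      (by rw [height_comp, height_neg]; exact neg_nonneg.2 h3)
      (by rw [height_comp, height_neg]; exact neg_nonpos.2 h1)
      (by rw [height_comp, height_neg]; exact neg_eq_zero.2 e0.symm)
    rw [tetrahedron_comp, height_comp, height_neg, orthPlane_neg] at this
    simp only [Function.comp_apply, Pi.neg_apply, edgeLength_neg] at this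
    have hp : periwidth (tetrahedron v) (orthPlane u) =
      edgeLength (height v u 2) (height v u 1) + edgeLength (height v u 2) (height v u 0) +
        edgeLength (height v u 3) (height v u 1) + edgeLength (height v u 3) (height v u 0) := this
    rw [hp, edgeLength_comm (height v u 2), edgeLength_comm (height v u 2),
      edgeLength_comm (height v u 3), edgeLength_comm (height v u 3)]
    ring
  exact hv.periwidth_quad hu ⟨l0, l1, l2, l3⟩

/-- The perimeter of the projection depends only on the heights of the vertices. -/
theorem periwidth_eq_of_height_eq {v' : Fin 4 → E3} {u' : E3} (hv : IsUnitRegularSimplex v)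
    (hv' : IsUnitRegularSimplex v') (hu : ‖u‖ = 1) (hu' : ‖u'‖ = 1)
    (h : height v u = height v' u') :
    periwidth (tetrahedron v) (orthPlane u) = periwidth (tetrahedron v') (orthPlane u') := by
  obtain ⟨σ, hσ⟩ := exists_perm_pattern (sum_height v u) (hv.sum_height_sq_pos hu)
  have hh : height (v ∘ σ) u = height (v' ∘ σ) u' := by rw [height_comp, height_comp, h]
  rw [← tetrahedron_comp v σ, ← tetrahedron_comp v' σ]
  rw [← height_comp] at hσ
  have hσ' := hσ
  rw [hh] at hσ'
  rcases hσ with hσ | hσ | hσ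
  · rw [(hv.comp σ).periwidth_triangle hu hσ,
      (hv'.comp σ).periwidth_triangle hu' (by rwa [← hh]), hh]
  · rw [(hv.comp σ).periwidth_triangle' hu hσ,
      (hv'.comp σ).periwidth_triangle' hu' (by rwa [← hh]), hh]
  · rw [(hv.comp σ).periwidth_quad hu hσ, (hv'.comp σ).periwidth_quad hu' (by rwa [← hh]), hh]

end Shadow

/-! ### Directions in general position: sums over silhouette edges -/

section Generic

open Classical in
/-- The sum of `g` over the edges `k l` for which the heights of the two opposite vertices have
opposite signs. -/
noncomputable def silhouetteSum (g : ℝ → ℝ → ℝ) (t : Fin 4 → ℝ) : ℝ :=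
  (if t 0 * t 1 < 0 then g (t 2) (t 3) else 0) + (if t 0 * t 2 < 0 then g (t 1) (t 3) else 0) +
  (if t 0 * t 3 < 0 then g (t 1) (t 2) else 0) + (if t 1 * t 2 < 0 then g (t 0) (t 3) else 0) +
  (if t 1 * t 3 < 0 then g (t 0) (t 2) else 0) + (if t 2 * t 3 < 0 then g (t 0) (t 1) else 0)

theorem silhouetteSum_swap {g : ℝ → ℝ → ℝ} (hg : ∀ a b, g a b = g b a) (t : Fin 4 → ℝ)
    {x y : Fin 4} (hxy : x < y) :
    silhouetteSum g (t ∘ Equiv.swap x y) = silhouetteSum g t := by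
  have e1 : ∀ i j : Fin 4, t i * t j = t j * t i := fun i j => mul_comm _ _
  have e2 : ∀ i j : Fin 4, g (t i) (t j) = g (t j) (t i) := fun i j => hg _ _
  have n1 := e1 1 0
  have n2 := e1 2 0
  have n3 := e1 3 0
  have n4 := e1 2 1
  have n5 := e1 3 1
  have n6 := e1 3 2
  have m1 := e2 1 0
  have m2 := e2 2 0
  have m3 := e2 3 0
  have m4 := e2 2 1
  have m5 := e2 3 1
  have m6 := e2 3 2
  fin_cases x <;> fin_cases y <;> first
    | exact absurd hxy (by decide)
    | (simp [silhouetteSum, Equiv.swap_apply_def, n1, n2, n3, n4, n5, n6, m1, m2, m3, m4, m5, m6]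
       try ring)

/-- Transpositions generate all relabellings. This allows the sum to be evaluated in a normalised
sign pattern. -/
theorem silhouetteSum_comp {g : ℝ → ℝ → ℝ} (hg : ∀ a b, g a b = g b a) (t : Fin 4 → ℝ)
    (σ : Equiv.Perm (Fin 4)) : silhouetteSum g (t ∘ σ) = silhouetteSum g t := by
  induction σ using Equiv.Perm.swap_induction_on generalizing t with
  | one => rfl
  | swap_mul f x y hxy ih =>
    have : t ∘ ⇑(Equiv.swap x y * f) = (t ∘ Equiv.swap x y) ∘ f := rfl
    rw [this, ih]
    rcases hxy.lt_or_gt with h | h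
    · exact silhouetteSum_swap hg t h
    · rw [Equiv.swap_comm]; exact silhouetteSum_swap hg t h

theorem silhouetteSum_triangle (g : ℝ → ℝ → ℝ) {t : Fin 4 → ℝ} (h0 : 0 < t 0) (h1 : t 1 < 0)
    (h2 : t 2 < 0) (h3 : t 3 < 0) :
    silhouetteSum g t = g (t 1) (t 2) + g (t 1) (t 3) + g (t 2) (t 3) := by
  rw [silhouetteSum, if_pos (mul_neg_of_pos_of_neg h0 h1), if_pos (mul_neg_of_pos_of_neg h0 h2),
    if_pos (mul_neg_of_pos_of_neg h0 h3), if_neg (mul_pos_of_neg_of_neg h1 h2).not_gt,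
    if_neg (mul_pos_of_neg_of_neg h1 h3).not_gt, if_neg (mul_pos_of_neg_of_neg h2 h3).not_gt]
  ring

theorem silhouetteSum_triangle' (g : ℝ → ℝ → ℝ) {t : Fin 4 → ℝ} (h0 : t 0 < 0) (h1 : 0 < t 1)
    (h2 : 0 < t 2) (h3 : 0 < t 3) :
    silhouetteSum g t = g (t 1) (t 2) + g (t 1) (t 3) + g (t 2) (t 3) := by
  rw [silhouetteSum, if_pos (mul_neg_of_neg_of_pos h0 h1), if_pos (mul_neg_of_neg_of_pos h0 h2),
    if_pos (mul_neg_of_neg_of_pos h0 h3), if_neg (mul_pos h1 h2).not_gt,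
    if_neg (mul_pos h1 h3).not_gt, if_neg (mul_pos h2 h3).not_gt]
  ring

theorem silhouetteSum_quad (g : ℝ → ℝ → ℝ) {t : Fin 4 → ℝ} (h : IsQuadPattern t) :
    silhouetteSum g t = g (t 0) (t 2) + g (t 0) (t 3) + g (t 1) (t 2) + g (t 1) (t 3) := by
  obtain ⟨h0, h1, h2, h3⟩ := h
  rw [silhouetteSum, if_neg (mul_pos h0 h1).not_gt, if_pos (mul_neg_of_pos_of_neg h0 h2),
    if_pos (mul_neg_of_pos_of_neg h0 h3), if_pos (mul_neg_of_pos_of_neg h1 h2),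
    if_pos (mul_neg_of_pos_of_neg h1 h3), if_neg (mul_pos_of_neg_of_neg h2 h3).not_gt]
  ring

variable {v : Fin 4 → E3} {u : E3}

theorem shadowVertexCount_tetrahedron (v : Fin 4 → E3) (u : E3) :
    shadowVertexCount (tetrahedron v) (orthPlane u) =
      ((convexHull ℝ (range (shadowPoint v u))).extremePoints ℝ).ncard := by
  rw [shadowVertexCount, shadow_tetrahedron]

/-- Perimeter and number of vertices of a projection in general position. -/
theorem IsUnitRegularSimplex.generic_shadow (hv : IsUnitRegularSimplex v) (hu : ‖u‖ = 1)
    (hgen : ∀ i, height v u i ≠ 0) :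
    periwidth (tetrahedron v) (orthPlane u) = silhouetteSum edgeLength (height v u) ∧
    (shadowVertexCount (tetrahedron v) (orthPlane u) : ℝ) =
      silhouetteSum (fun _ _ => 1) (height v u) ∧
    (shadowVertexCount (tetrahedron v) (orthPlane u) = 3 ∨
      shadowVertexCount (tetrahedron v) (orthPlane u) = 4) := by
  obtain ⟨σ, h⟩ := exists_perm_pattern (sum_height v u) (hv.sum_height_sq_pos hu)
  rw [← silhouetteSum_comp edgeLength_comm (height v u) σ,
    ← silhouetteSum_comp (g := fun _ _ => 1) (fun _ _ => rfl) (height v u) σ,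
    ← tetrahedron_comp v σ]
  rw [← height_comp] at h ⊢
  have hg : ∀ i, height (v ∘ σ) u i ≠ 0 := by
    intro i; rw [height_comp]; exact hgen (σ i)
  have hc := (hv.comp σ).isAffineCircuit u
  rcases h with h | h | h
  · rw [(hv.comp σ).periwidth_triangle hu h]
    obtain ⟨h0, h1, h2, h3⟩ := h
    have h1 := h1.lt_of_ne (hg 1)
    have h2 := h2.lt_of_ne (hg 2)
    have h3 := h3.lt_of_ne (hg 3)
    rw [shadowVertexCount_tetrahedron, hc.ncard_extremePoints_triangle h0 h1 h2 h3,
      silhouetteSum_triangle _ h0 h1 h2 h3, silhouetteSum_triangle _ h0 h1 h2 h3]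
    norm_num
  · rw [(hv.comp σ).periwidth_triangle' hu h]
    obtain ⟨h0, h1, h2, h3⟩ := h
    have h0' := neg_pos.1 h0
    have h1' := (neg_nonpos.1 h1).lt_of_ne' (hg 1)
    have h2' := (neg_nonpos.1 h2).lt_of_ne' (hg 2)
    have h3' := (neg_nonpos.1 h3).lt_of_ne' (hg 3)
    rw [shadowVertexCount_tetrahedron, hc.neg.ncard_extremePoints_triangle h0 (neg_neg_of_pos h1')
      (neg_neg_of_pos h2') (neg_neg_of_pos h3'),
      silhouetteSum_triangle' _ h0' h1' h2' h3', silhouetteSum_triangle' _ h0' h1' h2' h3']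
    norm_num
  · rw [(hv.comp σ).periwidth_quad hu h, silhouetteSum_quad _ h, silhouetteSum_quad _ h]
    obtain ⟨h0, h1, h2, h3⟩ := h
    rw [shadowVertexCount_tetrahedron, hc.ncard_extremePoints_quadrilateral h0 h1 h2 h3]
    norm_num

end Generic

/-! ### Sphere averages of homogeneous functions -/

section SphereIntegral

/-- The radial integral `∫₀^∞ r ^ n exp (-r²) dr`. -/
noncomputable def radialGaussian (n : ℕ) : ℝ := ∫ r in Ioi (0 : ℝ), r ^ n * exp (-r ^ 2)

theorem radialGaussian_eq (n : ℕ) : radialGaussian n = Real.Gamma ((n + 1) / 2) / 2 := by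
  have h := integral_rpow_mul_exp_neg_rpow (p := 2) (q := n) (by norm_num)
    (by have : (0 : ℝ) ≤ n := n.cast_nonneg
        linarith)
  have h2 : radialGaussian n = ∫ x in Ioi (0 : ℝ), x ^ (n : ℝ) * exp (-x ^ (2 : ℝ)) := by
    simp [radialGaussian]
  rw [h2, h]; ring

theorem radialGaussian_one : radialGaussian 1 = 1 / 2 := by
  rw [radialGaussian_eq]; norm_num

theorem radialGaussian_two : radialGaussian 2 = √π / 4 := by
  have := Real.Gamma_nat_add_half 1
  rw [radialGaussian_eq]
  norm_num at this ⊢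
  rw [this]; ring

theorem radialGaussian_three : radialGaussian 3 = 1 / 2 := by
  rw [radialGaussian_eq]; norm_num

theorem radialGaussian_four : radialGaussian 4 = 3 * √π / 8 := by
  have := Real.Gamma_nat_add_half 2
  rw [radialGaussian_eq]
  norm_num [Nat.doubleFactorial] at this ⊢
  rw [this]; ring

/-- Integration of a homogeneous function against a Gaussian in polar coordinates of space. -/
theorem integral_homogeneous_mul_exp {f : E3 → ℝ} {k : ℕ}
    (hf : ∀ (r : ℝ) (x : E3), 0 < r → f (r • x) = r ^ k * f x) :
    ∫ x, f x * exp (-‖x‖ ^ 2) =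
      (∫ u : Metric.sphere (0 : E3) 1, f u ∂(volume : Measure E3).toSphere) *
        radialGaussian (k + 2) := by
  calc ∫ x, f x * exp (-‖x‖ ^ 2)
      = ∫ x : ({(0)}ᶜ : Set E3), f x * exp (-‖(x : E3)‖ ^ 2) ∂((volume : Measure E3).comap (↑)) := by
        rw [integral_subtype_comap (measurableSet_singleton _).compl
          fun x : E3 => f x * exp (-‖x‖ ^ 2), restrict_compl_singleton]
    _ = ∫ q, f q.1 * ((q.2 : ℝ) ^ k * exp (-(q.2 : ℝ) ^ 2))
          ∂(volume : Measure E3).toSphere.prod (.volumeIoiPow (Module.finrank ℝ E3 - 1)) := by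
        rw [← (volume : Measure E3).measurePreserving_homeomorphUnitSphereProd.integral_comp
          (Homeomorph.measurableEmbedding _)]
        refine integral_congr_ae (.of_forall fun x => ?_)
        have hx : (x : E3) = ((homeomorphUnitSphereProd E3 x).2 : ℝ) •
            ((homeomorphUnitSphereProd E3 x).1 : E3) := by
          rw [← homeomorphUnitSphereProd_symm_apply_coe, Homeomorph.symm_apply_apply]
        have hn : ‖(x : E3)‖ = ((homeomorphUnitSphereProd E3 x).2 : ℝ) := by simp
        dsimp only
        rw [hn]
        conv_lhs => rw [hx, hf _ _ (homeomorphUnitSphereProd E3 x).2.2]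
        ring
    _ = (∫ u : Metric.sphere (0 : E3) 1, f u ∂(volume : Measure E3).toSphere) *
          ∫ r : Ioi (0 : ℝ), (r : ℝ) ^ k * exp (-(r : ℝ) ^ 2)
            ∂(.volumeIoiPow (Module.finrank ℝ E3 - 1)) :=
        integral_prod_mul (fun u : Metric.sphere (0 : E3) 1 => f u)
          fun r : Ioi (0 : ℝ) => (r : ℝ) ^ k * exp (-(r : ℝ) ^ 2)
    _ = _ := by
      congr 1
      -- The radial measure has density r², which accounts for the shift from `k` to `k + 2`.
      have h3 : Module.finrank ℝ E3 - 1 = 2 := by simp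
      rw [h3]
      simp only [Measure.volumeIoiPow, ENNReal.ofReal]
      rw [integral_withDensity_eq_integral_smul, integral_subtype_comap measurableSet_Ioi
        fun a => Real.toNNReal (a ^ 2) • (a ^ k * exp (-a ^ 2)), radialGaussian]
      · refine setIntegral_congr_fun measurableSet_Ioi fun x hx => ?_
        simp only [NNReal.smul_def, Real.coe_toNNReal _ (sq_nonneg x), smul_eq_mul]
        ring
      · exact (measurable_subtype_coe.pow_const _).real_toNNReal

/-- The third coordinate is placed first so that it splits off from the plane of the other two. -/
theorem OrthonormalBasis.exists_measurePreserving_coord (b : OrthonormalBasis (Fin 3) ℝ E3) :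
    ∃ e : E3 ≃ᵐ ℝ × (ℝ × ℝ), MeasurePreserving e ∧
      ∀ x, e x = (inner ℝ (b 2) x, inner ℝ (b 0) x, inner ℝ (b 1) x) := by
  refine ⟨((b.measurableEquiv.trans (MeasurableEquiv.toLp 2 (Fin 3 → ℝ)).symm).trans
    (MeasurableEquiv.piFinSuccAbove (fun _ => ℝ) 2)).trans
    ((MeasurableEquiv.refl ℝ).prodCongr MeasurableEquiv.finTwoArrow), ?_, fun x => ?_⟩
  · exact (((MeasurePreserving.id volume).prod (volume_preserving_finTwoArrow ℝ)).comp
      (volume_preserving_piFinSuccAbove (fun _ : Fin 3 => ℝ) 2)).comp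
      ((PiLp.volume_preserving_ofLp (Fin 3)).comp b.measurePreserving_repr)
  · simp only [← b.repr_apply_apply]
    rfl

/-- Integration of a homogeneous function of two coordinates over the sphere. -/
theorem integral_sphere_mul_radialGaussian (b : OrthonormalBasis (Fin 3) ℝ E3) {h : ℝ × ℝ → ℝ}
    {k : ℕ} (hh : ∀ (r : ℝ) (q : ℝ × ℝ), 0 < r → h (r • q) = r ^ k * h q) :
    (∫ u : Metric.sphere (0 : E3) 1, h (inner ℝ (b 0) (u : E3), inner ℝ (b 1) (u : E3))
        ∂(volume : Measure E3).toSphere) * radialGaussian (k + 2) =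
      √π * (radialGaussian (k + 1) * ∫ θ in (-π)..π, h (cos θ, sin θ)) := by
  -- The Gaussian integral is evaluated a second time in cylindrical coordinates: the third
  -- coordinate gives √π, and polar coordinates in the plane give a radial factor of exponent k + 1.
  rw [← integral_homogeneous_mul_exp (f := fun x => h (inner ℝ (b 0) x, inner ℝ (b 1) x))]
  swap
  · intro r x hr
    rw [← hh r _ hr]
    simp [inner_smul_right]
  obtain ⟨e, he, hex⟩ := b.exists_measurePreserving_coord
  have hnorm : ∀ x : E3, ‖x‖ ^ 2 =
      inner ℝ (b 2) x ^ 2 + (inner ℝ (b 0) x ^ 2 + inner ℝ (b 1) x ^ 2) := by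
    intro x
    rw [← b.sum_sq_norm_inner_right x, Fin.sum_univ_three]
    simp only [Real.norm_eq_abs, sq_abs]
    ring
  calc ∫ x, h (inner ℝ (b 0) x, inner ℝ (b 1) x) * exp (-‖x‖ ^ 2)
      = ∫ q : ℝ × (ℝ × ℝ), exp (-q.1 ^ 2) * (h q.2 * exp (-(q.2.1 ^ 2 + q.2.2 ^ 2))) := by
        rw [← he.integral_comp']
        refine integral_congr_ae (.of_forall fun x => ?_)
        simp only [hex, hnorm, neg_add, Real.exp_add]
        ring
    _ = (∫ z : ℝ, exp (-z ^ 2)) * ∫ q : ℝ × ℝ, h q * exp (-(q.1 ^ 2 + q.2 ^ 2)) :=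
        integral_prod_mul (fun z : ℝ => exp (-z ^ 2))
          fun q : ℝ × ℝ => h q * exp (-(q.1 ^ 2 + q.2 ^ 2))
    _ = √π * ∫ q : ℝ × ℝ, h q * exp (-(q.1 ^ 2 + q.2 ^ 2)) := by
        congr 1
        simpa using integral_gaussian 1
    _ = √π * ∫ q in Ioi (0 : ℝ) ×ˢ Ioo (-π) π,
          (q.1 ^ (k + 1) * exp (-q.1 ^ 2)) * h (cos q.2, sin q.2) := by
        congr 1
        rw [← integral_comp_polarCoord_symm, polarCoord_target]
        refine setIntegral_congr_fun (measurableSet_Ioi.prod measurableSet_Ioo) fun q hq => ?_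
        have hq1 : 0 < q.1 := hq.1
        have e1 : (q.1 * cos q.2, q.1 * sin q.2) = q.1 • (cos q.2, sin q.2) := rfl
        have e2 : (q.1 * cos q.2) ^ 2 + (q.1 * sin q.2) ^ 2 = q.1 ^ 2 := by
          linear_combination q.1 ^ 2 * Real.sin_sq_add_cos_sq q.2
        simp only [polarCoord_symm_apply, smul_eq_mul]
        rw [e2, e1, hh _ _ hq1]
        ring
    _ = _ := by
        rw [Measure.volume_eq_prod, setIntegral_prod_mul (fun r : ℝ => r ^ (k + 1) * exp (-r ^ 2))
          fun θ : ℝ => h (cos θ, sin θ), radialGaussian,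
          intervalIntegral.integral_of_le (by linarith [Real.pi_pos]),
          integral_Ioc_eq_integral_Ioo]

/-- The constant function 1, of degree 0, yields the area of the sphere. -/
theorem toSphere_real_univ_mul :
    ((volume : Measure E3).toSphere.real univ) * radialGaussian 2 =
      √π * (radialGaussian 1 * (2 * π)) := by
  have b : OrthonormalBasis (Fin 3) ℝ E3 := EuclideanSpace.basisFun (Fin 3) ℝ
  have := integral_sphere_mul_radialGaussian b (h := fun _ => 1) (k := 0) (by simp)
  simp only [integral_const, smul_eq_mul, mul_one, intervalIntegral.integral_const] at this
  rw [this]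
  ring

theorem toSphere_real_univ : (volume : Measure E3).toSphere.real univ = 4 * π := by
  have h := toSphere_real_univ_mul
  rw [radialGaussian_one, radialGaussian_two] at h
  have : √π ≠ 0 := by positivity
  have h2 : √π * ((volume : Measure E3).toSphere.real univ) = √π * (4 * π) := by linarith
  exact mul_left_cancel₀ this h2

theorem integral_uniformSphere (f : Metric.sphere (0 : E3) 1 → ℝ) :
    ∫ u, f u ∂uniformSphere = (∫ u, f u ∂(volume : Measure E3).toSphere) / (4 * π) := by
  rw [uniformSphere, integral_smul_measure, ENNReal.toReal_inv, ← measureReal_def,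
    toSphere_real_univ, smul_eq_mul]
  ring

instance : IsProbabilityMeasure uniformSphere := by
  constructor
  rw [uniformSphere, Measure.smul_apply, smul_eq_mul]
  refine ENNReal.inv_mul_cancel ?_ (measure_ne_top _ _)
  intro h
  have := toSphere_real_univ
  rw [measureReal_def, h, ENNReal.toReal_zero] at this
  linarith [Real.pi_pos]

/-- The degrees used below are 0 for indicators, 1 for lengths and single heights, and 2 for
products of heights. -/
theorem integral_uniformSphere_coord (b : OrthonormalBasis (Fin 3) ℝ E3) {h : ℝ × ℝ → ℝ}
    {k : ℕ} (hh : ∀ (r : ℝ) (q : ℝ × ℝ), 0 < r → h (r • q) = r ^ k * h q) :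
    (∫ u, h (inner ℝ (b 0) (u : E3), inner ℝ (b 1) (u : E3)) ∂uniformSphere) *
      radialGaussian (k + 2) = 1 / (4 * √π) * radialGaussian (k + 1) *
        ∫ θ in (-π)..π, h (cos θ, sin θ) := by
  have := integral_sphere_mul_radialGaussian b hh
  rw [integral_uniformSphere, div_mul_eq_mul_div, this]
  have h2 : √π * √π = π := Real.mul_self_sqrt Real.pi_pos.le
  have h3 : √π ≠ 0 := by positivity
  rw [div_eq_iff (by positivity)]
  field_simp
  linear_combination (radialGaussian (k + 1) * ∫ θ in (-π)..π, h (cos θ, sin θ)) * h2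

theorem integral_uniformSphere_coord_zero (b : OrthonormalBasis (Fin 3) ℝ E3) {h : ℝ × ℝ → ℝ}
    (hh : ∀ (r : ℝ) (q : ℝ × ℝ), 0 < r → h (r • q) = h q) :
    ∫ u, h (inner ℝ (b 0) (u : E3), inner ℝ (b 1) (u : E3)) ∂uniformSphere =
      1 / (2 * π) * ∫ θ in (-π)..π, h (cos θ, sin θ) := by
  have := integral_uniformSphere_coord b (h := h) (k := 0) (by simpa using hh)
  rw [radialGaussian_one, radialGaussian_two] at this
  have h2 : √π * √π = π := Real.mul_self_sqrt Real.pi_pos.le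
  have h3 : √π ≠ 0 := by positivity
  have h4 : (√π / 4 : ℝ) ≠ 0 := by positivity
  apply mul_right_cancel₀ h4
  rw [this]
  have h5 : 1 / (2 * π) = 1 / (2 * (√π * √π)) := by rw [h2]
  rw [h5]
  field_simp

theorem integral_uniformSphere_coord_one (b : OrthonormalBasis (Fin 3) ℝ E3) {h : ℝ × ℝ → ℝ}
    (hh : ∀ (r : ℝ) (q : ℝ × ℝ), 0 < r → h (r • q) = r * h q) :
    ∫ u, h (inner ℝ (b 0) (u : E3), inner ℝ (b 1) (u : E3)) ∂uniformSphere =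
      1 / 8 * ∫ θ in (-π)..π, h (cos θ, sin θ) := by
  have := integral_uniformSphere_coord b (h := h) (k := 1) (by simpa using hh)
  rw [radialGaussian_three, radialGaussian_two] at this
  have h3 : √π ≠ 0 := by positivity
  have h4 : (1 / 2 : ℝ) ≠ 0 := by norm_num
  apply mul_right_cancel₀ h4
  rw [this]
  field_simp
  ring

theorem integral_uniformSphere_coord_two (b : OrthonormalBasis (Fin 3) ℝ E3) {h : ℝ × ℝ → ℝ}
    (hh : ∀ (r : ℝ) (q : ℝ × ℝ), 0 < r → h (r • q) = r ^ 2 * h q) :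
    ∫ u, h (inner ℝ (b 0) (u : E3), inner ℝ (b 1) (u : E3)) ∂uniformSphere =
      1 / (3 * π) * ∫ θ in (-π)..π, h (cos θ, sin θ) := by
  have := integral_uniformSphere_coord b hh
  rw [radialGaussian_three, radialGaussian_four] at this
  have h2 : √π * √π = π := Real.mul_self_sqrt Real.pi_pos.le
  have h3 : √π ≠ 0 := by positivity
  have h4 : (3 * √π / 8 : ℝ) ≠ 0 := by positivity
  apply mul_right_cancel₀ h4
  rw [this]
  have h5 : 1 / (3 * π) = 1 / (3 * (√π * √π)) := by rw [h2]
  rw [h5]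
  field_simp
  ring

end SphereIntegral

/-! ### Integrals over the circle -/

section AngularIntegrals

theorem integral_neg_pi_pi_eq {f : ℝ → ℝ} (hf : ∀ a b, IntervalIntegrable f volume a b)
    (h1 : ∀ θ, f (-θ) = f θ) (h2 : ∀ θ, f (π - θ) = f θ) :
    ∫ θ in (-π)..π, f θ = 4 * ∫ θ in (0 : ℝ)..(π / 2), f θ := by
  have e1 : ∫ θ in (-π)..0, f θ = ∫ θ in (0 : ℝ)..π, f θ := by
    have := intervalIntegral.integral_comp_neg (a := 0) (b := π) f
    simp only [h1, neg_zero] at this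
    exact this.symm
  have e2 : ∫ θ in (π / 2)..π, f θ = ∫ θ in (0 : ℝ)..(π / 2), f θ := by
    have := intervalIntegral.integral_comp_sub_left (a := 0) (b := π / 2) f π
    simp only [h2, sub_zero, sub_half] at this
    exact this.symm
  rw [← intervalIntegral.integral_add_adjacent_intervals (hf (-π) 0) (hf 0 π), e1,
    ← intervalIntegral.integral_add_adjacent_intervals (hf 0 (π / 2)) (hf (π / 2) π), e2]
  ring

theorem cos_sq_arctan_sqrt_two : cos (arctan √2) ^ 2 = 1 / 3 := by
  rw [Real.cos_sq_arctan, Real.sq_sqrt (by norm_num)]; norm_num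

theorem arctan_sqrt_two_pos : 0 < arctan √2 := Real.arctan_pos.2 (by positivity)

/-- With ψ = arctan √2 one has cos² ψ = 1/3, hence cos (π - 2ψ) = 1/3. The angle arcsec 3 is the
dihedral angle of the tetrahedron. -/
theorem two_mul_arctan_sqrt_two : 2 * arctan √2 = π - arcsec 3 := by
  have h : Real.cos (π - 2 * arctan √2) = 1 / 3 := by
    rw [Real.cos_pi_sub, Real.cos_two_mul, cos_sq_arctan_sqrt_two]; norm_num
  rw [arcsec, ← h, Real.arccos_cos]
  · ring
  · linarith [Real.arctan_lt_pi_div_two √2]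
  · linarith [arctan_sqrt_two_pos]

/-- The condition amounts to cos² θ > 1/3. Comparing cosines instead of tangents includes the
endpoint π/2. -/
theorem sin_sq_lt_two_mul_cos_sq_iff {θ : ℝ} (h0 : 0 ≤ θ) (h1 : θ ≤ π / 2) :
    sin θ ^ 2 < 2 * cos θ ^ 2 ↔ θ < arctan √2 := by
  have hc : 0 ≤ cos θ := Real.cos_nonneg_of_mem_Icc ⟨by linarith [Real.pi_pos], h1⟩
  have hψ := arctan_sqrt_two_pos
  have hψ' := Real.arctan_lt_pi_div_two √2
  have hcψ : 0 ≤ cos (arctan √2) := (Real.cos_arctan_pos _).le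
  rw [← Real.strictAntiOn_cos.lt_iff_gt (a := arctan √2) (b := θ)
    ⟨hψ.le, by linarith⟩ ⟨h0, by linarith⟩, ← sq_lt_sq₀ hcψ hc, cos_sq_arctan_sqrt_two,
    Real.sin_sq]
  constructor <;> intro h <;> linarith

open Classical in
theorem integral_ite_sin_sq_lt :
    ∫ θ in (-π)..π, (if sin θ ^ 2 < 2 * cos θ ^ 2 then (1 : ℝ) else 0) = 4 * arctan √2 := by
  have hint : ∀ a b, IntervalIntegrable
      (fun θ => if sin θ ^ 2 < 2 * cos θ ^ 2 then (1 : ℝ) else 0) volume a b := by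
    intro a b
    have hm : Measurable (fun θ : ℝ => if sin θ ^ 2 < 2 * cos θ ^ 2 then (1 : ℝ) else 0) :=
      Measurable.ite (measurableSet_lt (by fun_prop) (by fun_prop)) measurable_const
        measurable_const
    refine (intervalIntegrable_const (c := (1 : ℝ))).mono_fun hm.aestronglyMeasurable
      (.of_forall fun θ => ?_)
    dsimp only
    split_ifs <;> simp
  rw [integral_neg_pi_pi_eq hint (by simp) (by simp)]
  congr 1
  have hψ := arctan_sqrt_two_pos
  have hψ' := Real.arctan_lt_pi_div_two √2
  rw [← intervalIntegral.integral_add_adjacent_intervals (hint 0 (arctan √2)) (hint _ (π / 2))]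
  have e1 : ∫ θ in (0 : ℝ)..(arctan √2), (if sin θ ^ 2 < 2 * cos θ ^ 2 then (1 : ℝ) else 0) =
      ∫ θ in (0 : ℝ)..(arctan √2), 1 := by
    -- At the right endpoint the strict inequality fails, so the integrands are compared on the open
    -- interval.
    rw [intervalIntegral.integral_of_le hψ.le, intervalIntegral.integral_of_le hψ.le,
      integral_Ioc_eq_integral_Ioo, integral_Ioc_eq_integral_Ioo]
    refine setIntegral_congr_fun measurableSet_Ioo fun θ hθ => ?_
    exact if_pos ((sin_sq_lt_two_mul_cos_sq_iff hθ.1.le (hθ.2.trans hψ').le).2 hθ.2)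
  have e2 : ∫ θ in (arctan √2)..(π / 2), (if sin θ ^ 2 < 2 * cos θ ^ 2 then (1 : ℝ) else 0) =
      ∫ θ in (arctan √2)..(π / 2), 0 := by
    refine intervalIntegral.integral_congr fun θ hθ => ?_
    rw [uIcc_of_le hψ'.le] at hθ
    exact if_neg fun h =>
      ((sin_sq_lt_two_mul_cos_sq_iff (hψ.le.trans hθ.1) hθ.2).1 h).not_ge hθ.1
  rw [e1, e2]
  simp

theorem integral_two_mul_cos_sq_sub_sin_sq (a b : ℝ) :
    ∫ θ in a..b, (2 * cos θ ^ 2 - sin θ ^ 2) =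
      (b / 2 + 3 / 2 * (sin b * cos b)) - (a / 2 + 3 / 2 * (sin a * cos a)) := by
  apply intervalIntegral.integral_eq_sub_of_hasDerivAt
    (f := fun θ => θ / 2 + 3 / 2 * (sin θ * cos θ))
  · intro θ _
    have h : HasDerivAt (fun θ : ℝ => θ / 2 + 3 / 2 * (sin θ * cos θ))
        (1 / 2 + 3 / 2 * (cos θ * cos θ + sin θ * -sin θ)) θ :=
      ((hasDerivAt_id θ).div_const 2).add
        (((Real.hasDerivAt_sin θ).mul (Real.hasDerivAt_cos θ)).const_mul (3 / 2))
    refine h.congr_deriv ?_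
    linear_combination (-1 / 2 : ℝ) * Real.sin_sq_add_cos_sq θ
  · exact (by fun_prop : Continuous fun θ : ℝ => 2 * cos θ ^ 2 - sin θ ^ 2).intervalIntegrable _ _

theorem integral_abs_sin_sq_sub :
    ∫ θ in (-π)..π, |sin θ ^ 2 - 2 * cos θ ^ 2| = 4 * arctan √2 + 4 * √2 - π := by
  have hint : ∀ a b, IntervalIntegrable
      (fun θ => |sin θ ^ 2 - 2 * cos θ ^ 2|) volume a b := fun a b =>
    (by fun_prop : Continuous fun θ : ℝ => |sin θ ^ 2 - 2 * cos θ ^ 2|).intervalIntegrable _ _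
  have hψ := arctan_sqrt_two_pos
  have hψ' := Real.arctan_lt_pi_div_two √2
  -- This value enters through the antiderivative at the sign change and produces the term 4√2.
  have hsc : sin (arctan √2) * cos (arctan √2) = √2 / 3 := by
    have hc := cos_sq_arctan_sqrt_two
    have ht := Real.tan_mul_cos (Real.cos_arctan_pos √2).ne'
    rw [Real.tan_arctan] at ht
    rw [← ht, mul_assoc, ← sq, hc]; ring
  rw [integral_neg_pi_pi_eq hint (by simp) (by simp),
    ← intervalIntegral.integral_add_adjacent_intervals (hint 0 (arctan √2)) (hint _ (π / 2))]
  have e1 : ∫ θ in (0 : ℝ)..(arctan √2), |sin θ ^ 2 - 2 * cos θ ^ 2| =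
      ∫ θ in (0 : ℝ)..(arctan √2), (2 * cos θ ^ 2 - sin θ ^ 2) := by
    refine intervalIntegral.integral_congr fun θ hθ => ?_
    rw [uIcc_of_le hψ.le] at hθ
    rcases hθ.2.eq_or_lt with h | h
    · have hc := cos_sq_arctan_sqrt_two
      have hs := Real.sin_sq_add_cos_sq (arctan √2)
      have hz : sin (arctan √2) ^ 2 - 2 * cos (arctan √2) ^ 2 = 0 := by linarith
      rw [h, hz, abs_zero]; linarith
    · have := (sin_sq_lt_two_mul_cos_sq_iff hθ.1 (h.trans hψ').le).2 h
      rw [abs_of_neg (by linarith)]; ring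
  have e2 : ∫ θ in (arctan √2)..(π / 2), |sin θ ^ 2 - 2 * cos θ ^ 2| =
      -∫ θ in (arctan √2)..(π / 2), (2 * cos θ ^ 2 - sin θ ^ 2) := by
    rw [← intervalIntegral.integral_neg]
    refine intervalIntegral.integral_congr fun θ hθ => ?_
    rw [uIcc_of_le hψ'.le] at hθ
    have := (sin_sq_lt_two_mul_cos_sq_iff (hψ.le.trans hθ.1) hθ.2).not.2 hθ.1.not_gt
    rw [abs_of_nonneg (by linarith)]; ring
  rw [e1, e2, integral_two_mul_cos_sq_sub_sin_sq, integral_two_mul_cos_sq_sub_sin_sq, hsc]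
  simp
  ring

theorem integral_abs_cos : ∫ θ in (-π)..π, |cos θ| = 4 := by
  have hint : ∀ a b, IntervalIntegrable (fun θ => |cos θ|) volume a b := fun a b =>
    (by fun_prop : Continuous fun θ : ℝ => |cos θ|).intervalIntegrable _ _
  rw [integral_neg_pi_pi_eq hint (by simp) (by simp)]
  have : ∫ θ in (0 : ℝ)..(π / 2), |cos θ| = ∫ θ in (0 : ℝ)..(π / 2), cos θ := by
    refine intervalIntegral.integral_congr fun θ hθ => ?_
    rw [uIcc_of_le (by positivity)] at hθ
    exact abs_of_nonneg (Real.cos_nonneg_of_mem_Icc ⟨by linarith [hθ.1, Real.pi_pos], hθ.2⟩)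
  rw [this]
  simp

end AngularIntegrals

/-! ### Averages attached to a single edge or vertex -/

section PairIntegrals

variable {v : Fin 4 → E3}

theorem continuous_height (v : Fin 4 → E3) (i : Fin 4) :
    Continuous fun u : Metric.sphere (0 : E3) 1 => height v u i := by
  unfold height
  fun_prop

theorem integrable_uniformSphere_of_bound {f : Metric.sphere (0 : E3) 1 → ℝ} (hf : Measurable f)
    (C : ℝ) (hC : ∀ u, |f u| ≤ C) : Integrable f uniformSphere :=
  Integrable.of_bound hf.aestronglyMeasurable C (.of_forall hC)

theorem norm_sphere (u : Metric.sphere (0 : E3) 1) : ‖(u : E3)‖ = 1 := by simp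

theorem IsUnitRegularSimplex.norm_offset (hv : IsUnitRegularSimplex v) (i : Fin 4) :
    ‖offset v i‖ = √6 / 4 := by
  have h := hv.inner_offset i i
  rw [if_pos rfl, real_inner_self_eq_norm_sq] at h
  rw [← Real.sqrt_sq (norm_nonneg (offset v i)), h,
    show (3 / 8 : ℝ) = 6 / 4 ^ 2 by norm_num, Real.sqrt_div (by norm_num),
    Real.sqrt_sq (by norm_num)]

theorem IsUnitRegularSimplex.abs_height_le (hv : IsUnitRegularSimplex v) (i : Fin 4)
    (u : Metric.sphere (0 : E3) 1) : |height v u i| ≤ 1 := by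
  have h := hv.sum_height_sq (u : E3)
  rw [norm_sphere] at h
  rw [← sq_le_one_iff_abs_le_one]
  have := Finset.single_le_sum (f := fun i => height v (u : E3) i ^ 2)
    (fun j _ => sq_nonneg _) (Finset.mem_univ i)
  linarith

theorem edgeLength_le_one (a b : ℝ) : edgeLength a b ≤ 1 := by
  rw [edgeLength, Real.sqrt_le_one]
  nlinarith [sq_nonneg (a - b)]

theorem edgeLength_nonneg (a b : ℝ) : 0 ≤ edgeLength a b := Real.sqrt_nonneg _

/-- The product of heights i and j is a difference of squares of their sum and difference, which are
coordinates 1 and 0 up to scale. The height difference along k l is coordinate 2, so one minus its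
square is the sum of the squares of coordinates 0 and 1. -/
theorem IsUnitRegularSimplex.exists_basis_height (hv : IsUnitRegularSimplex v) {i j k l : Fin 4}
    (hu : ({i, j, k, l} : Finset (Fin 4)) = Finset.univ) :
    ∃ b : OrthonormalBasis (Fin 3) ℝ E3, ∀ u : Metric.sphere (0 : E3) 1,
      height v u i * height v u j =
        (inner ℝ (b 1) (u : E3) ^ 2 - 2 * inner ℝ (b 0) (u : E3) ^ 2) / 8 ∧
      edgeLength (height v u k) (height v u l) =
        √(inner ℝ (b 0) (u : E3) ^ 2 + inner ℝ (b 1) (u : E3) ^ 2) := by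
  obtain ⟨b, h0, h1, h2⟩ := hv.exists_basis hu
  refine ⟨b, fun u => ⟨?_, ?_⟩⟩
  · rw [h0, h1]
    simp only [inner_sub_left, inner_add_left, inner_smul_left, conj_trivial, height]
    have hs : √2 ^ 2 = 2 := Real.sq_sqrt (by norm_num)
    rw [mul_pow, hs]
    ring
  · have hn := b.sum_sq_norm_inner_right (u : E3)
    rw [norm_sphere, Fin.sum_univ_three] at hn
    simp only [Real.norm_eq_abs, sq_abs] at hn
    have e : inner ℝ (b 2) (u : E3) = height v u k - height v u l := by
      rw [h2, inner_sub_left]; rfl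
    rw [e] at hn
    rw [edgeLength]
    congr 1
    linarith

open Classical in
theorem IsUnitRegularSimplex.integral_ite (hv : IsUnitRegularSimplex v) {i j k l : Fin 4}
    (hu : ({i, j, k, l} : Finset (Fin 4)) = Finset.univ) :
    ∫ u : Metric.sphere (0 : E3) 1, (if height v u i * height v u j < 0 then (1 : ℝ) else 0)
      ∂uniformSphere = 2 * arctan √2 / π := by
  obtain ⟨b, hb⟩ := hv.exists_basis_height hu
  have key := integral_uniformSphere_coord_zero b
    (h := fun q => if q.2 ^ 2 < 2 * q.1 ^ 2 then (1 : ℝ) else 0) (fun r q hr => by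
      have : (r • q).2 ^ 2 < 2 * (r • q).1 ^ 2 ↔ q.2 ^ 2 < 2 * q.1 ^ 2 := by
        simp only [Prod.smul_fst, Prod.smul_snd, smul_eq_mul, mul_pow]
        rw [mul_left_comm, mul_lt_mul_iff_right₀ (by positivity)]
      simp only [this])
  dsimp only at key
  rw [integral_ite_sin_sq_lt] at key
  rw [show 2 * arctan √2 / π = 1 / (2 * π) * (4 * arctan √2) by field_simp; norm_num, ← key]
  refine integral_congr_ae (.of_forall fun u => ?_)
  dsimp only
  congr 1
  rw [(hb u).1, eq_iff_iff]
  constructor <;> intro h <;> linarith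

open Classical in
-- On the unit circle the length factor is 1, so the angular integral is the one of the bare
-- indicator; only the constant for degree 1 differs.
theorem IsUnitRegularSimplex.integral_ite_edgeLength (hv : IsUnitRegularSimplex v)
    {i j k l : Fin 4} (hu : ({i, j, k, l} : Finset (Fin 4)) = Finset.univ) :
    ∫ u : Metric.sphere (0 : E3) 1, (if height v u i * height v u j < 0 then
      edgeLength (height v u k) (height v u l) else 0) ∂uniformSphere = arctan √2 / 2 := by
  obtain ⟨b, hb⟩ := hv.exists_basis_height hu
  have key := integral_uniformSphere_coord_one b
    (h := fun q => if q.2 ^ 2 < 2 * q.1 ^ 2 then √(q.1 ^ 2 + q.2 ^ 2) else 0)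
    (fun r q hr => by
      have : (r • q).2 ^ 2 < 2 * (r • q).1 ^ 2 ↔ q.2 ^ 2 < 2 * q.1 ^ 2 := by
        simp only [Prod.smul_fst, Prod.smul_snd, smul_eq_mul, mul_pow]
        rw [mul_left_comm, mul_lt_mul_iff_right₀ (by positivity)]
      have h2 : √((r • q).1 ^ 2 + (r • q).2 ^ 2) = r * √(q.1 ^ 2 + q.2 ^ 2) := by
        simp only [Prod.smul_fst, Prod.smul_snd, smul_eq_mul, mul_pow]
        rw [← mul_add, Real.sqrt_mul (by positivity), Real.sqrt_sq hr.le]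
      simp only [this, h2, mul_ite, mul_zero])
  simp only [Real.cos_sq_add_sin_sq, Real.sqrt_one] at key
  rw [integral_ite_sin_sq_lt] at key
  rw [show arctan √2 / 2 = 1 / 8 * (4 * arctan √2) by ring, ← key]
  refine integral_congr_ae (.of_forall fun u => ?_)
  dsimp only
  rw [(hb u).2]
  congr 1
  rw [(hb u).1, eq_iff_iff]
  constructor <;> intro h <;> linarith

theorem IsUnitRegularSimplex.integral_abs_mul (hv : IsUnitRegularSimplex v)
    {i j k l : Fin 4} (hu : ({i, j, k, l} : Finset (Fin 4)) = Finset.univ) :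
    ∫ u : Metric.sphere (0 : E3) 1, |height v u i| * |height v u j| ∂uniformSphere =
      (4 * arctan √2 + 4 * √2 - π) / (24 * π) := by
  obtain ⟨b, hb⟩ := hv.exists_basis_height hu
  have key := integral_uniformSphere_coord_two b
    (h := fun q => |q.2 ^ 2 - 2 * q.1 ^ 2|) (fun r q hr => by
      simp only [Prod.smul_fst, Prod.smul_snd, smul_eq_mul, mul_pow]
      rw [mul_left_comm, ← mul_sub, abs_mul, abs_of_pos (by positivity : 0 < r ^ 2)])
  dsimp only at key
  rw [integral_abs_sin_sq_sub] at key
  rw [show (4 * arctan √2 + 4 * √2 - π) / (24 * π) =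
    (1 / (3 * π) * (4 * arctan √2 + 4 * √2 - π)) / 8 by field_simp; ring, ← key,
    ← integral_div]
  refine integral_congr_ae (.of_forall fun u => ?_)
  dsimp only
  rw [← abs_mul, (hb u).1, abs_div, abs_of_pos (by norm_num : (0 : ℝ) < 8)]

theorem IsUnitRegularSimplex.integral_abs_height (hv : IsUnitRegularSimplex v) (i : Fin 4) :
    ∫ u : Metric.sphere (0 : E3) 1, |height v u i| ∂uniformSphere = √6 / 8 := by
  have hn := hv.norm_offset i
  have hpos : 0 < ‖offset v i‖ := by rw [hn]; positivity
  -- A basis whose first vector is the normalised offset makes the height a multiple of one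
  -- coordinate.
  have hon : Orthonormal ℝ (({0} : Set (Fin 3)).domRestrict
      fun _ => (‖offset v i‖⁻¹ • offset v i)) := by
    constructor
    · intro m
      simp [norm_smul, hpos.ne']
    · intro m n hmn
      exact absurd (Subsingleton.elim m n) hmn
  obtain ⟨b, hb⟩ := Orthonormal.exists_orthonormalBasis_extension_of_card_eq (𝕜 := ℝ) (E := E3)
    (ι := Fin 3) (by simp) hon
  have hb0 : b 0 = ‖offset v i‖⁻¹ • offset v i := hb 0 rfl
  have key := integral_uniformSphere_coord_one b (h := fun q => |q.1|) (fun r q hr => by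
    simp only [Prod.smul_fst, smul_eq_mul, abs_mul, abs_of_pos hr])
  dsimp only at key
  rw [integral_abs_cos] at key
  have hh : ∀ u : Metric.sphere (0 : E3) 1,
      |height v u i| = √6 / 4 * |inner ℝ (b 0) (u : E3)| := by
    intro u
    rw [hb0, inner_smul_left, conj_trivial, abs_mul, abs_of_pos (inv_pos.2 hpos), ← hn, ← mul_assoc,
      mul_inv_cancel₀ hpos.ne', one_mul, height]
  simp only [hh]
  rw [integral_const_mul, key]
  ring

open scoped Pointwise in
-- Spherical measure is computed from the volume of the cone over a set, and the cone over a great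
-- circle lies in a plane.
theorem IsUnitRegularSimplex.ae_height_ne_zero (hv : IsUnitRegularSimplex v) :
    ∀ᵐ u : Metric.sphere (0 : E3) 1 ∂uniformSphere, ∀ i, height v u i ≠ 0 := by
  rw [ae_all_iff]
  intro i
  have hm : MeasurableSet {u : Metric.sphere (0 : E3) 1 | height v u i = 0} :=
    (isClosed_eq (continuous_height v i) continuous_const).measurableSet
  have h0 : uniformSphere {u : Metric.sphere (0 : E3) 1 | height v u i = 0} = 0 := by
    rw [uniformSphere, Measure.smul_apply, Measure.toSphere_apply' _ hm]
    have hz : (volume : Measure E3) ((orthPlane (offset v i) : Submodule ℝ E3) : Set E3) = 0 := by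
      apply Measure.addHaar_submodule
      intro h
      have hmem : offset v i ∈ orthPlane (offset v i) := by rw [h]; trivial
      rw [Submodule.mem_orthogonal_singleton_iff_inner_right] at hmem
      have := hv.inner_offset i i
      rw [hmem, if_pos rfl] at this
      norm_num at this
    have hsub : Ioo (0 : ℝ) 1 • (Subtype.val ''
        {u : Metric.sphere (0 : E3) 1 | height v u i = 0}) ⊆
        ((orthPlane (offset v i) : Submodule ℝ E3) : Set E3) := by
      rintro _ ⟨r, -, _, ⟨u, hu, rfl⟩, rfl⟩
      refine Submodule.smul_mem _ r ?_
      rw [Submodule.mem_orthogonal_singleton_iff_inner_right]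
      exact hu
    rw [measure_mono_null hsub hz]
    simp
  rw [ae_iff]
  simpa using h0

end PairIntegrals

/-! ### Moments and vertex probabilities -/

section Moments

variable {v : Fin 4 → E3}

theorem IsUnitRegularSimplex.cw_eq (hv : IsUnitRegularSimplex v) (u : Metric.sphere (0 : E3) 1) :
    cw v u = (∑ i, |height v u i|) / (2 * √2) :=
  hv.chorowidth_eq (norm_sphere u)

theorem IsUnitRegularSimplex.integrable_abs_height (hv : IsUnitRegularSimplex v) (i : Fin 4) :
    Integrable (fun u : Metric.sphere (0 : E3) 1 => |height v u i|) uniformSphere :=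
  integrable_uniformSphere_of_bound (continuous_height v i).abs.measurable 1
    fun u => by rw [abs_abs]; exact hv.abs_height_le i u

theorem IsUnitRegularSimplex.integrable_abs_mul (hv : IsUnitRegularSimplex v) (i j : Fin 4) :
    Integrable (fun u : Metric.sphere (0 : E3) 1 => |height v u i| * |height v u j|)
      uniformSphere :=
  integrable_uniformSphere_of_bound
    ((continuous_height v i).abs.mul (continuous_height v j).abs).measurable 1 fun u => by
      rw [abs_mul, abs_abs, abs_abs]
      exact mul_le_one₀ (hv.abs_height_le i u) (abs_nonneg _) (hv.abs_height_le j u)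

theorem IsUnitRegularSimplex.integrable_cw (hv : IsUnitRegularSimplex v) :
    Integrable (cw v) uniformSphere := by
  have : cw v = fun u : Metric.sphere (0 : E3) 1 => (∑ i, |height v u i|) / (2 * √2) :=
    funext hv.cw_eq
  rw [this]
  exact (integrable_finsetSum _ fun i _ => hv.integrable_abs_height i).div_const _

theorem IsUnitRegularSimplex.integral_cw (hv : IsUnitRegularSimplex v) :
    ∫ u, cw v u ∂uniformSphere = √3 / 4 := by
  simp only [hv.cw_eq]
  rw [integral_div, integral_finsetSum _ fun i _ => hv.integrable_abs_height i]
  simp only [hv.integral_abs_height, Finset.sum_const, Finset.card_univ, Fintype.card_fin]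
  have h6 : √6 = √2 * √3 := by rw [← Real.sqrt_mul (by norm_num)]; norm_num
  have h2 : √2 ≠ 0 := by positivity
  rw [h6, nsmul_eq_mul]
  field_simp
  norm_num

/-- In the expanded square of ∑ |height i| the diagonal terms have the constant sum 1/2, which
leaves the six products. -/
theorem IsUnitRegularSimplex.cw_sq_eq (hv : IsUnitRegularSimplex v)
    (u : Metric.sphere (0 : E3) 1) :
    cw v u ^ 2 = 1 / 16 + (|height v u 0| * |height v u 1| + |height v u 0| * |height v u 2| +
      |height v u 0| * |height v u 3| + |height v u 1| * |height v u 2| +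
      |height v u 1| * |height v u 3| + |height v u 2| * |height v u 3|) / 4 := by
  have hq := hv.sum_height_sq (u : E3)
  rw [norm_sphere, Fin.sum_univ_four, ← sq_abs, ← sq_abs (height v u 1), ← sq_abs (height v u 2),
    ← sq_abs (height v u 3)] at hq
  rw [hv.cw_eq, div_pow, mul_pow, Real.sq_sqrt (by norm_num), Fin.sum_univ_four]
  linear_combination (1 / 8 : ℝ) * hq

theorem IsUnitRegularSimplex.integrable_cw_sq (hv : IsUnitRegularSimplex v) :
    Integrable (fun u => cw v u ^ 2) uniformSphere := by
  simp only [hv.cw_sq_eq]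
  have h := hv.integrable_abs_mul
  exact (integrable_const _).add (((((((h 0 1).add (h 0 2)).add (h 0 3)).add (h 1 2)).add
    (h 1 3)).add (h 2 3)).div_const _)

theorem IsUnitRegularSimplex.integral_cw_sq (hv : IsUnitRegularSimplex v) :
    ∫ u, cw v u ^ 2 ∂uniformSphere = 1 / 8 + √2 / (4 * π) - arcsec 3 / (8 * π) := by
  simp only [hv.cw_sq_eq]
  have h := hv.integrable_abs_mul
  have i1 := (h 0 1).add (h 0 2)
  have i2 := i1.add (h 0 3)
  have i3 := i2.add (h 1 2)
  have i4 := i3.add (h 1 3)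
  have i5 := i4.add (h 2 3)
  have e0 := integral_add (integrable_const (μ := uniformSphere) (1 / 16 : ℝ)) (i5.div_const 4)
  have e5 := integral_add i4 (h 2 3)
  have e4 := integral_add i3 (h 1 3)
  have e3 := integral_add i2 (h 1 2)
  have e2 := integral_add i1 (h 0 3)
  have e1 := integral_add (h 0 1) (h 0 2)
  simp only [Pi.add_apply] at e0 e5 e4 e3 e2
  rw [e0, integral_const, integral_div, e5, e4, e3, e2, e1,
    hv.integral_abs_mul (i := 0) (j := 1) (k := 2) (l := 3) (by decide),
    hv.integral_abs_mul (i := 0) (j := 2) (k := 1) (l := 3) (by decide),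
    hv.integral_abs_mul (i := 0) (j := 3) (k := 1) (l := 2) (by decide),
    hv.integral_abs_mul (i := 1) (j := 2) (k := 0) (l := 3) (by decide),
    hv.integral_abs_mul (i := 1) (j := 3) (k := 0) (l := 2) (by decide),
    hv.integral_abs_mul (i := 2) (j := 3) (k := 0) (l := 1) (by decide)]
  simp only [probReal_univ, one_smul]
  have hψ := two_mul_arctan_sqrt_two
  have ha : arcsec 3 = π - 2 * arctan √2 := by linarith
  rw [ha]
  field_simp
  ring

/-- Integration of the sum over the silhouette, term by term. -/
theorem IsUnitRegularSimplex.integral_silhouetteSum {g : ℝ → ℝ → ℝ} {c : ℝ}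
    (hg : Measurable (Function.uncurry g)) (hb : ∀ a b, |g a b| ≤ 1)
    (hc : ∀ i j k l : Fin 4, ({i, j, k, l} : Finset (Fin 4)) = Finset.univ →
      ∫ u : Metric.sphere (0 : E3) 1, (if height v u i * height v u j < 0 then
        g (height v u k) (height v u l) else 0) ∂uniformSphere = c) :
    Integrable (fun u : Metric.sphere (0 : E3) 1 => silhouetteSum g (height v u)) uniformSphere ∧
      ∫ u : Metric.sphere (0 : E3) 1, silhouetteSum g (height v u) ∂uniformSphere = 6 * c := by
  classical
  have h : ∀ i j k l : Fin 4, Integrable (fun u : Metric.sphere (0 : E3) 1 =>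
      if height v u i * height v u j < 0 then g (height v u k) (height v u l) else 0)
        uniformSphere := by
    intro i j k l
    have m := fun i => (continuous_height v i).measurable
    refine integrable_uniformSphere_of_bound (Measurable.ite
      (measurableSet_lt ((m i).mul (m j)) measurable_const) (hg.comp ((m k).prodMk (m l)))
      measurable_const) 1 fun u => ?_
    split_ifs
    · exact hb _ _
    · simp
  have i1 := (h 0 1 2 3).add (h 0 2 1 3)
  have i2 := i1.add (h 0 3 1 2)
  have i3 := i2.add (h 1 2 0 3)
  have i4 := i3.add (h 1 3 0 2)
  have i5 := i4.add (h 2 3 0 1)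
  refine ⟨?_, ?_⟩
  · refine i5.congr (.of_forall fun u => ?_)
    simp only [Pi.add_apply, silhouetteSum]
  have e5 := integral_add i4 (h 2 3 0 1)
  have e4 := integral_add i3 (h 1 3 0 2)
  have e3 := integral_add i2 (h 1 2 0 3)
  have e2 := integral_add i1 (h 0 3 1 2)
  have e1 := integral_add (h 0 1 2 3) (h 0 2 1 3)
  simp only [Pi.add_apply] at e5 e4 e3 e2
  simp only [silhouetteSum]
  refine Eq.trans ?_ (e5.trans ?_)
  · refine integral_congr_ae (.of_forall fun u => ?_)
    rfl
  rw [e4, e3, e2, e1]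
  have c1 := hc 0 1 2 3 (by decide)
  have c2 := hc 0 2 1 3 (by decide)
  have c3 := hc 0 3 1 2 (by decide)
  have c4 := hc 1 2 0 3 (by decide)
  have c5 := hc 1 3 0 2 (by decide)
  have c6 := hc 2 3 0 1 (by decide)
  linarith

theorem measurable_edgeLength : Measurable (Function.uncurry edgeLength) := by
  unfold edgeLength Function.uncurry
  fun_prop

theorem IsUnitRegularSimplex.pw_ae_eq (hv : IsUnitRegularSimplex v) :
    pw v =ᵐ[uniformSphere] fun u => silhouetteSum edgeLength (height v u) := by
  filter_upwards [hv.ae_height_ne_zero] with u hu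
  exact (hv.generic_shadow (norm_sphere u) hu).1

theorem IsUnitRegularSimplex.integrable_pw_and_integral_pw (hv : IsUnitRegularSimplex v) :
    Integrable (pw v) uniformSphere ∧ ∫ u, pw v u ∂uniformSphere = 3 / 2 * (π - arcsec 3) := by
  obtain ⟨h1, h2⟩ := IsUnitRegularSimplex.integral_silhouetteSum (v := v) measurable_edgeLength
    (fun a b => by rw [abs_of_nonneg (edgeLength_nonneg a b)]; exact edgeLength_le_one a b)
    (c := arctan √2 / 2) (fun i j k l hu => hv.integral_ite_edgeLength hu)
  refine ⟨h1.congr hv.pw_ae_eq.symm, ?_⟩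
  rw [integral_congr_ae hv.pw_ae_eq, h2, ← two_mul_arctan_sqrt_two]
  ring

theorem IsUnitRegularSimplex.integral_vertexCount (hv : IsUnitRegularSimplex v) :
    Integrable (fun u => (vertexCount v u : ℝ)) uniformSphere ∧
      ∫ u, (vertexCount v u : ℝ) ∂uniformSphere = 6 * (2 * arctan √2 / π) := by
  obtain ⟨h1, h2⟩ := IsUnitRegularSimplex.integral_silhouetteSum (v := v) (g := fun _ _ => 1)
    measurable_const (by simp) (c := 2 * arctan √2 / π) (fun i j k l hu => hv.integral_ite hu)
  have hae : (fun u => (vertexCount v u : ℝ)) =ᵐ[uniformSphere]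
      fun u => silhouetteSum (fun _ _ => 1) (height v u) := by
    filter_upwards [hv.ae_height_ne_zero] with u hu
    exact (hv.generic_shadow (norm_sphere u) hu).2.1
  exact ⟨h1.congr hae.symm, by rw [integral_congr_ae hae, h2]⟩

theorem IsUnitRegularSimplex.ae_vertexCount (hv : IsUnitRegularSimplex v) :
    ∀ᵐ u ∂uniformSphere, vertexCount v u = 3 ∨ vertexCount v u = 4 := by
  filter_upwards [hv.ae_height_ne_zero] with u hu
  exact (hv.generic_shadow (norm_sphere u) hu).2.2

/-- The count agrees almost everywhere with a measurable silhouette sum, which gives measurability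
up to null sets. -/
theorem IsUnitRegularSimplex.nullMeasurableSet_vertexCount (hv : IsUnitRegularSimplex v) (n : ℕ) :
    NullMeasurableSet {u | vertexCount v u = n} uniformSphere := by
  have h := hv.integral_vertexCount.1.aestronglyMeasurable.aemeasurable
  have := h.nullMeasurableSet_preimage (measurableSet_singleton (n : ℝ))
  convert this using 1
  ext u
  simp

theorem IsUnitRegularSimplex.measure_vertexCount_eq_four (hv : IsUnitRegularSimplex v) :
    uniformSphere.real {u | vertexCount v u = 4} = 3 / π * (π - 2 * arcsec 3) := by
  have h1 : ∫ u, ({u | vertexCount v u = 4} : Set _).indicator (fun _ => (1 : ℝ)) u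
      ∂uniformSphere = uniformSphere.real {u | vertexCount v u = 4} := by
    rw [integral_indicator₀ (hv.nullMeasurableSet_vertexCount 4)]
    simp
  -- A count that is almost surely 3 or 4 exceeds 3 by the indicator of the value 4, so its mean
  -- gives the probability.
  have h2 : ({u | vertexCount v u = 4} : Set _).indicator (fun _ => (1 : ℝ)) =ᵐ[uniformSphere]
      fun u => (vertexCount v u : ℝ) - 3 := by
    filter_upwards [hv.ae_vertexCount] with u hu
    rcases hu with hu | hu
    · simp [hu]
    · simp [hu]; norm_num
  obtain ⟨i, e⟩ := hv.integral_vertexCount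
  rw [← h1, integral_congr_ae h2, integral_sub i (integrable_const _), e]
  simp only [integral_const, probReal_univ, one_smul]
  have hψ := two_mul_arctan_sqrt_two
  rw [hψ]
  field_simp
  ring

theorem IsUnitRegularSimplex.measure_vertexCount_eq_three (hv : IsUnitRegularSimplex v) :
    uniformSphere.real {u | vertexCount v u = 3} = 2 / π * (3 * arcsec 3 - π) := by
  have h1 : ∫ u, ({u | vertexCount v u = 3} : Set _).indicator (fun _ => (1 : ℝ)) u
      ∂uniformSphere = uniformSphere.real {u | vertexCount v u = 3} := by
    rw [integral_indicator₀ (hv.nullMeasurableSet_vertexCount 3)]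
    simp
  have h2 : ({u | vertexCount v u = 3} : Set _).indicator (fun _ => (1 : ℝ)) =ᵐ[uniformSphere]
      fun u => 4 - (vertexCount v u : ℝ) := by
    filter_upwards [hv.ae_vertexCount] with u hu
    rcases hu with hu | hu
    · simp [hu]; norm_num
    · simp [hu]
  obtain ⟨i, e⟩ := hv.integral_vertexCount
  rw [← h1, integral_congr_ae h2, integral_sub (integrable_const _) i, e]
  simp only [integral_const, probReal_univ, one_smul]
  have hψ := two_mul_arctan_sqrt_two
  rw [hψ]
  field_simp
  ring

end Moments

/-! ### The standard tetrahedron and its symmetries -/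

section StandardPosition

theorem sqrt_six_eq : √6 = √2 * √3 := by rw [← Real.sqrt_mul (by norm_num)]; norm_num

theorem sqrt_two_sq : √2 ^ 2 = 2 := Real.sq_sqrt (by norm_num)

theorem sqrt_three_sq : √3 ^ 2 = 3 := Real.sq_sqrt (by norm_num)

theorem isUnitRegularSimplex_stdVertex : IsUnitRegularSimplex stdVertex := by
  have h2 := sqrt_two_sq
  have h3 := sqrt_three_sq
  intro i j hij
  rw [EuclideanSpace.dist_eq, Real.sqrt_eq_one, Fin.sum_univ_three]
  simp only [Real.dist_eq, sq_abs]
  fin_cases i <;> fin_cases j <;> first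
    | exact absurd rfl hij
    | (simp [stdVertex, sqrt_six_eq]
       ring_nf
       norm_num [h2, h3])

theorem offset_stdVertex : offset stdVertex = stdVertex := by
  funext i
  have : ∑ j, stdVertex j = 0 := by
    ext m
    rw [Fin.sum_univ_four]
    fin_cases m <;> simp [stdVertex] <;> ring
  rw [offset, this, smul_zero, sub_zero]

theorem height_stdVertex (u : E3) : height stdVertex u =
    ![√6 / 4 * u 2, √3 / 3 * u 0 - √6 / 12 * u 2, -√3 / 6 * u 0 + 1 / 2 * u 1 - √6 / 12 * u 2,
      -√3 / 6 * u 0 - 1 / 2 * u 1 - √6 / 12 * u 2] := by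
  funext i
  rw [height, offset_stdVertex, PiLp.inner_apply, Fin.sum_univ_three]
  fin_cases i <;> simp [stdVertex] <;> ring

theorem norm_sphericalPoint (θ φ : ℝ) : ‖sphericalPoint θ φ‖ = 1 := by
  rw [EuclideanSpace.norm_eq, Real.sqrt_eq_one, Fin.sum_univ_three]
  simp only [sphericalPoint, Real.norm_eq_abs, sq_abs]
  simp
  linear_combination sin φ ^ 2 * Real.sin_sq_add_cos_sq θ + Real.sin_sq_add_cos_sq φ

/-- Area and perimeter depend only on the unordered heights, so a symmetry need only be checked on
these. -/
theorem stdCw_stdPw_eq_of_height {θ φ θ' φ' : ℝ} (σ : Equiv.Perm (Fin 4))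
    (h : height stdVertex (sphericalPoint θ' φ') =
      height stdVertex (sphericalPoint θ φ) ∘ σ) :
    stdCw θ' φ' = stdCw θ φ ∧ stdPw θ' φ' = stdPw θ φ := by
  have hv := isUnitRegularSimplex_stdVertex
  constructor
  · rw [stdCw, stdCw, hv.chorowidth_eq (norm_sphericalPoint _ _),
      hv.chorowidth_eq (norm_sphericalPoint _ _), h]
    congr 1
    exact Equiv.sum_comp σ fun i => |height stdVertex (sphericalPoint θ φ) i|
  · have := periwidth_eq_of_height_eq hv (hv.comp σ) (norm_sphericalPoint θ' φ')
      (norm_sphericalPoint θ φ) (by rw [h, height_comp])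
    rw [stdPw, stdPw, this, tetrahedron_comp]

theorem cos_add_two_pi_div_three (θ : ℝ) :
    cos (θ + 2 * π / 3) = -(1 / 2) * cos θ - √3 / 2 * sin θ := by
  rw [Real.cos_add, show 2 * π / 3 = π - π / 3 by ring, Real.cos_pi_sub, Real.sin_pi_sub,
    Real.cos_pi_div_three, Real.sin_pi_div_three]
  ring

theorem sin_add_two_pi_div_three (θ : ℝ) :
    sin (θ + 2 * π / 3) = -(1 / 2) * sin θ + √3 / 2 * cos θ := by
  rw [Real.sin_add, show 2 * π / 3 = π - π / 3 by ring, Real.cos_pi_sub, Real.sin_pi_sub,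
    Real.cos_pi_div_three, Real.sin_pi_div_three]
  ring

theorem stdCw_stdPw_rotate (θ φ : ℝ) :
    stdCw (θ + 2 * π / 3) φ = stdCw θ φ ∧ stdPw (θ + 2 * π / 3) φ = stdPw θ φ := by
  have h3 : √3 * √3 = 3 := Real.mul_self_sqrt (by norm_num)
  -- The rotation permutes the base vertices in the cycle 1 ↦ 3 ↦ 2 ↦ 1 and fixes the apex 0.
  refine stdCw_stdPw_eq_of_height (Equiv.swap 1 3 * Equiv.swap 2 3) ?_
  rw [height_stdVertex, height_stdVertex]
  funext i
  have hσ : (Equiv.swap 1 3 * Equiv.swap 2 3 : Equiv.Perm (Fin 4)) 0 = 0 ∧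
      (Equiv.swap 1 3 * Equiv.swap 2 3 : Equiv.Perm (Fin 4)) 1 = 3 ∧
      (Equiv.swap 1 3 * Equiv.swap 2 3 : Equiv.Perm (Fin 4)) 2 = 1 ∧
      (Equiv.swap 1 3 * Equiv.swap 2 3 : Equiv.Perm (Fin 4)) 3 = 2 := by decide
  obtain ⟨s0, s1, s2, s3⟩ := hσ
  fin_cases i
  · simp only [Fin.zero_eta, Function.comp_apply, s0]
    simp [sphericalPoint]
  · simp only [Fin.mk_one, Function.comp_apply, s1]
    simp [sphericalPoint, cos_add_two_pi_div_three]
    linear_combination (-(1 / 6) * sin θ * sin φ) * h3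
  · simp only [Fin.reduceFinMk, Function.comp_apply, s2]
    simp [sphericalPoint, cos_add_two_pi_div_three, sin_add_two_pi_div_three]
    linear_combination ((1 / 12) * sin θ * sin φ) * h3
  · simp only [Fin.reduceFinMk, Function.comp_apply, s3]
    simp [sphericalPoint, cos_add_two_pi_div_three, sin_add_two_pi_div_three]
    linear_combination ((1 / 12) * sin θ * sin φ) * h3

theorem stdCw_stdPw_reflect (θ φ : ℝ) :
    stdCw (-θ) φ = stdCw θ φ ∧ stdPw (-θ) φ = stdPw θ φ := by
  refine stdCw_stdPw_eq_of_height (Equiv.swap 2 3) ?_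
  rw [height_stdVertex, height_stdVertex]
  funext i
  have hσ : (Equiv.swap 2 3 : Equiv.Perm (Fin 4)) 0 = 0 ∧
      (Equiv.swap 2 3 : Equiv.Perm (Fin 4)) 1 = 1 ∧
      (Equiv.swap 2 3 : Equiv.Perm (Fin 4)) 2 = 3 ∧
      (Equiv.swap 2 3 : Equiv.Perm (Fin 4)) 3 = 2 := by decide
  obtain ⟨s0, s1, s2, s3⟩ := hσ
  fin_cases i
  · simp only [Fin.zero_eta, Function.comp_apply, s0]
    simp [sphericalPoint]
  · simp only [Fin.mk_one, Function.comp_apply, s1]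
    simp [sphericalPoint]
  · simp only [Fin.reduceFinMk, Function.comp_apply, s2]
    simp [sphericalPoint]
    ring
  · simp only [Fin.reduceFinMk, Function.comp_apply, s3]
    simp [sphericalPoint]

theorem stdCw_stdPw_antipode (θ φ : ℝ) :
    stdCw (θ + π) (π - φ) = stdCw θ φ ∧ stdPw (θ + π) (π - φ) = stdPw θ φ := by
  have h : sphericalPoint (θ + π) (π - φ) = -sphericalPoint θ φ := by
    ext m
    fin_cases m <;> simp [sphericalPoint]
  rw [stdCw, stdCw, stdPw, stdPw, h, orthPlane_neg]
  exact ⟨rfl, rfl⟩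

end StandardPosition

/-! ### The boundary curves and the covering of the dodecant -/

section Dodecant

theorem cos_arccot_eq_mul_sin (x : ℝ) : cos (arccot x) = x * sin (arccot x) := by
  rw [arccot, Real.cos_pi_div_two_sub, Real.sin_pi_div_two_sub]
  have := Real.tan_mul_cos (Real.cos_arctan_pos x).ne'
  rw [Real.tan_arctan] at this
  exact this.symm

theorem arccot_mem {x : ℝ} (hx : 0 < x) : 0 < arccot x ∧ arccot x < π / 2 := by
  rw [arccot]
  constructor
  · linarith [Real.arctan_lt_pi_div_two x]
  · linarith [Real.arctan_pos.2 hx]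

/-- Monotonicity of the cotangent in a form free of division; the companion bound `mul_sin_le_cos`
then covers φ = 0. -/
theorem cos_le_mul_sin {x φ : ℝ} (hx : 0 < x) (h0 : arccot x ≤ φ) (h1 : φ ≤ π / 2) :
    cos φ ≤ x * sin φ := by
  obtain ⟨ha, hb⟩ := arccot_mem hx
  calc cos φ ≤ cos (arccot x) := Real.cos_le_cos_of_nonneg_of_le_pi ha.le (by linarith) h0
    _ = x * sin (arccot x) := cos_arccot_eq_mul_sin x
    _ ≤ x * sin φ := by
      gcongr
      exact Real.sin_le_sin_of_le_of_le_pi_div_two (by linarith) h1 h0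

theorem mul_sin_le_cos {x φ : ℝ} (hx : 0 < x) (h0 : 0 ≤ φ) (h1 : φ ≤ arccot x) :
    x * sin φ ≤ cos φ := by
  obtain ⟨ha, hb⟩ := arccot_mem hx
  calc x * sin φ ≤ x * sin (arccot x) := by
        gcongr
        exact Real.sin_le_sin_of_le_of_le_pi_div_two (by linarith) (by linarith) h1
    _ = cos (arccot x) := (cos_arccot_eq_mul_sin x).symm
    _ ≤ cos φ := Real.cos_le_cos_of_nonneg_of_le_pi h0 (by linarith) h1

theorem gammaAngle_le_deltaAngle : gammaAngle ≤ deltaAngle := by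
  have : arctan √2 ≤ arctan (2 * √2) := Real.arctan_mono (by linarith [Real.sqrt_nonneg 2])
  rw [gammaAngle, deltaAngle, arccot, arccot]
  linarith

theorem sin_pos_of_gammaAngle_le {φ : ℝ} (h0 : gammaAngle ≤ φ) (h1 : φ ≤ π / 2) : 0 < sin φ := by
  have := (arccot_mem (x := 2 * √2) (by positivity)).1
  rw [← gammaAngle] at this
  exact Real.sin_pos_of_pos_of_lt_pi (by linarith) (by linarith [Real.pi_pos])

theorem alphaFn_spec {φ : ℝ} (h0 : gammaAngle ≤ φ) (h1 : φ ≤ π / 2) :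
    0 ≤ alphaFn φ ∧ alphaFn φ ≤ π / 2 ∧ 2 * √2 * sin φ * cos (alphaFn φ) = cos φ := by
  have hs := sin_pos_of_gammaAngle_le h0 h1
  have hc : 0 ≤ cos φ := by
    have := (arccot_mem (x := 2 * √2) (by positivity)).1
    rw [← gammaAngle] at this
    exact Real.cos_nonneg_of_mem_Icc ⟨by linarith [Real.pi_pos], h1⟩
  have hle := cos_le_mul_sin (x := 2 * √2) (by positivity) h0 h1
  -- This holds at φ = π/2 too: both sides are 0, by the conventions for the tangent and for
  -- division by zero.
  have hy : 1 / (2 * √2 * tan φ) = cos φ / (2 * √2 * sin φ) := by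
    rw [Real.tan_eq_sin_div_cos, one_div, mul_div_assoc', inv_div]
  rw [alphaFn, if_pos h0, arcsec, hy]
  have hpos : 0 < 2 * √2 * sin φ := by positivity
  refine ⟨Real.arccos_nonneg _, Real.arccos_le_pi_div_two.2 (by positivity), ?_⟩
  rw [Real.cos_arccos (by linarith [div_nonneg hc hpos.le]) ((div_le_one hpos).2 hle),
    mul_div_cancel₀ _ hpos.ne']

/-- At δ one has cos φ = √2 sin φ, hence cos α = 1/2. There α and β meet at π/3, and the order of α
and β changes. -/
theorem alphaFn_le_pi_div_three {φ : ℝ} (h0 : gammaAngle ≤ φ) (h1 : φ ≤ π / 2)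
    (h2 : φ ≤ deltaAngle) : alphaFn φ ≤ π / 3 := by
  obtain ⟨a0, a1, a2⟩ := alphaFn_spec h0 h1
  have hs := sin_pos_of_gammaAngle_le h0 h1
  have hγ := (arccot_mem (x := 2 * √2) (by positivity)).1
  rw [← gammaAngle] at hγ
  have h := mul_sin_le_cos (x := √2) (by positivity) (by linarith) h2
  by_contra! hc
  have := Real.cos_lt_cos_of_nonneg_of_le_pi_div_two (by linarith [Real.pi_pos]) a1 hc
  rw [Real.cos_pi_div_three] at this
  nlinarith [mul_pos (show 0 < √2 by positivity) hs]

theorem pi_div_three_le_alphaFn {φ : ℝ} (h1 : φ ≤ π / 2) (h2 : deltaAngle ≤ φ) :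
    π / 3 ≤ alphaFn φ := by
  have h0 := gammaAngle_le_deltaAngle.trans h2
  obtain ⟨a0, a1, a2⟩ := alphaFn_spec h0 h1
  have hs := sin_pos_of_gammaAngle_le h0 h1
  have h := cos_le_mul_sin (x := √2) (by positivity) h2 h1
  by_contra! hc
  have := Real.cos_lt_cos_of_nonneg_of_le_pi_div_two a0 (by linarith [Real.pi_pos]) hc
  rw [Real.cos_pi_div_three] at this
  nlinarith [mul_pos (show 0 < √2 by positivity) hs]

theorem region_cover {θ φ : ℝ} (hθ0 : 0 ≤ θ) (hθ1 : θ ≤ π / 3) (hφ0 : 0 ≤ φ) (hφ1 : φ ≤ π / 2) :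
    region1 θ φ ∨ region2 θ φ ∨ region3 θ φ := by
  rcases le_or_gt gammaAngle φ with hγ | hγ
  · rcases le_or_gt θ (min (alphaFn φ) (betaFn φ)) with hm | hm
    · exact Or.inr (Or.inl ⟨hγ, hφ1, hθ0, hm⟩)
    · rcases le_total φ deltaAngle with hδ | hδ
      · have ha := alphaFn_le_pi_div_three hγ hφ1 hδ
        refine Or.inr (Or.inr ⟨hφ0, hδ, ?_, hθ1⟩)
        rcases min_lt_iff.1 hm with h | h
        · exact h.le
        · rw [betaFn] at h; linarith
      · have ha := pi_div_three_le_alphaFn hφ1 hδ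
        refine Or.inl ⟨hδ, hφ1, ?_, hθ1⟩
        rcases min_lt_iff.1 hm with h | h
        · linarith
        · exact h.le
  · refine Or.inr (Or.inr ⟨hφ0, hγ.le.trans gammaAngle_le_deltaAngle, ?_, hθ1⟩)
    rw [alphaFn, if_neg hγ.not_ge]
    exact hθ0

end Dodecant

/-! ### Signs of the heights and formulas on the three regions -/

section RegionFormulas

theorem sqrt_eq_mul_sqrt {a b c : ℝ} (hc : 0 ≤ c) (h : a = c ^ 2 * b) : √a = c * √b := by
  rw [h, Real.sqrt_mul (sq_nonneg c), Real.sqrt_sq hc]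

/-- The heights of the vertices of the standard tetrahedron over the plane orthogonal to
`(x, y, z)`. -/
noncomputable def stdHeight (x y z : ℝ) : Fin 4 → ℝ :=
  ![√6 / 4 * z, √3 / 3 * x - √6 / 12 * z, -√3 / 6 * x + 1 / 2 * y - √6 / 12 * z,
    -√3 / 6 * x - 1 / 2 * y - √6 / 12 * z]

theorem height_sphericalPoint (θ φ : ℝ) : height stdVertex (sphericalPoint θ φ) =
    stdHeight (cos θ * sin φ) (sin θ * sin φ) (cos φ) :=
  height_stdVertex _

theorem edgeLength_stdHeight_zero_one (x y z : ℝ) :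
    edgeLength (stdHeight x y z 0) (stdHeight x y z 1) = √3 / 3 * √(3 - (x - √2 * z) ^ 2) := by
  refine sqrt_eq_mul_sqrt (by positivity) ?_
  simp only [stdHeight, Matrix.cons_val, sqrt_six_eq]
  rw [div_pow, sqrt_three_sq]
  linear_combination (-(1 / 9) * (√2 * z - x) ^ 2) * sqrt_three_sq

theorem edgeLength_stdHeight_zero_two (x y z : ℝ) :
    edgeLength (stdHeight x y z 0) (stdHeight x y z 2) =
      √3 / 6 * √(12 - (x - √3 * y + 2 * √2 * z) ^ 2) := by
  refine sqrt_eq_mul_sqrt (by positivity) ?_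
  simp only [stdHeight, Matrix.cons_val, sqrt_six_eq]
  have h : √2 * √3 / 4 * z - (-√3 / 6 * x + 1 / 2 * y - √2 * √3 / 12 * z) =
      √3 / 6 * (x - √3 * y + 2 * √2 * z) := by
    linear_combination (1 / 6 * y) * sqrt_three_sq
  rw [h, mul_pow, div_pow, sqrt_three_sq]
  ring

theorem edgeLength_stdHeight_zero_three (x y z : ℝ) :
    edgeLength (stdHeight x y z 0) (stdHeight x y z 3) =
      √3 / 6 * √(12 - (x + √3 * y + 2 * √2 * z) ^ 2) := by
  refine sqrt_eq_mul_sqrt (by positivity) ?_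
  simp only [stdHeight, Matrix.cons_val, sqrt_six_eq]
  have h : √2 * √3 / 4 * z - (-√3 / 6 * x - 1 / 2 * y - √2 * √3 / 12 * z) =
      √3 / 6 * (x + √3 * y + 2 * √2 * z) := by
    linear_combination (-1 / 6 * y) * sqrt_three_sq
  rw [h, mul_pow, div_pow, sqrt_three_sq]
  ring

theorem edgeLength_stdHeight_one_two (x y z : ℝ) :
    edgeLength (stdHeight x y z 1) (stdHeight x y z 2) = 1 / 2 * √(4 - (√3 * x - y) ^ 2) := by
  refine sqrt_eq_mul_sqrt (by norm_num) ?_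
  simp only [stdHeight, Matrix.cons_val]
  ring

theorem edgeLength_stdHeight_one_three (x y z : ℝ) :
    edgeLength (stdHeight x y z 1) (stdHeight x y z 3) = 1 / 2 * √(4 - (√3 * x + y) ^ 2) := by
  refine sqrt_eq_mul_sqrt (by norm_num) ?_
  simp only [stdHeight, Matrix.cons_val]
  ring

theorem edgeLength_stdHeight_two_three (x y z : ℝ) :
    edgeLength (stdHeight x y z 2) (stdHeight x y z 3) = √(1 - y ^ 2) := by
  rw [edgeLength]
  congr 1
  simp only [stdHeight, Matrix.cons_val]
  ring

variable {θ φ : ℝ}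

theorem stdCw_eq (θ φ : ℝ) : stdCw θ φ = (∑ i,
    |stdHeight (cos θ * sin φ) (sin θ * sin φ) (cos φ) i|) / (2 * √2) := by
  rw [stdCw, isUnitRegularSimplex_stdVertex.chorowidth_eq (norm_sphericalPoint _ _),
    height_sphericalPoint]

theorem stdHeight_one_eq (θ φ : ℝ) :
    stdHeight (cos θ * sin φ) (sin θ * sin φ) (cos φ) 1 =
      √6 / 12 * (2 * √2 * sin φ * cos θ - cos φ) := by
  simp only [stdHeight, Matrix.cons_val, sqrt_six_eq]
  linear_combination (-(1 / 6) * √3 * cos θ * sin φ) * sqrt_two_sq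

/-- This is height 1 with θ replaced by 2π/3 - θ, which explains why its zero curve is β = 2π/3 - α.
-/
theorem stdHeight_two_eq (θ φ : ℝ) :
    stdHeight (cos θ * sin φ) (sin θ * sin φ) (cos φ) 2 =
      √6 / 12 * (2 * √2 * sin φ * cos (2 * π / 3 - θ) - cos φ) := by
  have h : cos (2 * π / 3 - θ) = -(1 / 2) * cos θ + √3 / 2 * sin θ := by
    rw [Real.cos_sub, show 2 * π / 3 = π - π / 3 by ring, Real.cos_pi_sub, Real.sin_pi_sub,
      Real.cos_pi_div_three, Real.sin_pi_div_three]
  rw [h]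
  simp only [stdHeight, Matrix.cons_val, sqrt_six_eq]
  linear_combination (1 / 12 * √3 * cos θ * sin φ - 1 / 12 * √3 ^ 2 * sin θ * sin φ) * sqrt_two_sq -
    (1 / 6 * sin θ * sin φ) * sqrt_three_sq

theorem stdHeight_zero_nonneg (hφ0 : 0 ≤ φ) (hφ1 : φ ≤ π / 2) :
    0 ≤ stdHeight (cos θ * sin φ) (sin θ * sin φ) (cos φ) 0 := by
  have : 0 ≤ cos φ := Real.cos_nonneg_of_mem_Icc ⟨by linarith, hφ1⟩
  simp only [stdHeight, Matrix.cons_val]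
  positivity

theorem stdHeight_three_nonpos (hθ0 : 0 ≤ θ) (hθ1 : θ ≤ π / 3) (hφ0 : 0 ≤ φ) (hφ1 : φ ≤ π / 2) :
    stdHeight (cos θ * sin φ) (sin θ * sin φ) (cos φ) 3 ≤ 0 := by
  have hc : 0 ≤ cos φ := Real.cos_nonneg_of_mem_Icc ⟨by linarith, hφ1⟩
  have hs : 0 ≤ sin φ := Real.sin_nonneg_of_nonneg_of_le_pi hφ0 (by linarith)
  have hc' : 0 ≤ cos θ := Real.cos_nonneg_of_mem_Icc ⟨by linarith, by linarith⟩
  have hs' : 0 ≤ sin θ := Real.sin_nonneg_of_nonneg_of_le_pi hθ0 (by linarith)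
  simp only [stdHeight, Matrix.cons_val]
  have h1 : 0 ≤ √3 / 6 * (cos θ * sin φ) := by positivity
  have h2 : 0 ≤ 1 / 2 * (sin θ * sin φ) := by positivity
  have h3 : 0 ≤ √6 / 12 * cos φ := by positivity
  linarith

/-- The sign of the second height in terms of the boundary curve `α`. -/
theorem stdHeight_one_nonneg (h0 : gammaAngle ≤ φ) (h1 : φ ≤ π / 2) (hθ0 : 0 ≤ θ)
    (hα : θ ≤ alphaFn φ) : 0 ≤ stdHeight (cos θ * sin φ) (sin θ * sin φ) (cos φ) 1 := by
  obtain ⟨a0, a1, a2⟩ := alphaFn_spec h0 h1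
  have hs := sin_pos_of_gammaAngle_le h0 h1
  have hcos := Real.cos_le_cos_of_nonneg_of_le_pi hθ0 (by linarith) hα
  rw [stdHeight_one_eq]
  refine mul_nonneg (by positivity) ?_
  rw [← a2, ← mul_sub]
  exact mul_nonneg (by positivity) (by linarith)

theorem stdHeight_two_nonneg (h0 : gammaAngle ≤ φ) (h1 : φ ≤ π / 2) (hθ1 : θ ≤ π / 3)
    (hβ : betaFn φ ≤ θ) : 0 ≤ stdHeight (cos θ * sin φ) (sin θ * sin φ) (cos φ) 2 := by
  obtain ⟨a0, a1, a2⟩ := alphaFn_spec h0 h1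
  have hs := sin_pos_of_gammaAngle_le h0 h1
  rw [betaFn] at hβ
  have hcos := Real.cos_le_cos_of_nonneg_of_le_pi (x := 2 * π / 3 - θ) (y := alphaFn φ)
    (by linarith [Real.pi_pos]) (by linarith) (by linarith)
  rw [stdHeight_two_eq]
  refine mul_nonneg (by positivity) ?_
  rw [← a2, ← mul_sub]
  exact mul_nonneg (by positivity) (by linarith)

theorem stdHeight_two_nonpos (h0 : gammaAngle ≤ φ) (h1 : φ ≤ π / 2) (hθ0 : 0 ≤ θ)
    (hβ : θ ≤ betaFn φ) : stdHeight (cos θ * sin φ) (sin θ * sin φ) (cos φ) 2 ≤ 0 := by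
  obtain ⟨a0, a1, a2⟩ := alphaFn_spec h0 h1
  have hs := sin_pos_of_gammaAngle_le h0 h1
  rw [betaFn] at hβ
  have hcos := Real.cos_le_cos_of_nonneg_of_le_pi (x := alphaFn φ) (y := 2 * π / 3 - θ)
    a0 (by linarith [Real.pi_pos]) (by linarith)
  rw [stdHeight_two_eq]
  refine mul_nonpos_of_nonneg_of_nonpos (by positivity) ?_
  rw [← a2, ← mul_sub]
  exact mul_nonpos_of_nonneg_of_nonpos (by positivity) (by linarith)

/-- At γ the extreme case cos a = 1 becomes an equality. Up to γ the azimuth does not matter, and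
heights 1 and 2 stay nonpositive. -/
theorem two_mul_sqrt_two_mul_sin_mul_le (hφ0 : 0 ≤ φ) (h : φ ≤ gammaAngle) (a : ℝ) :
    2 * √2 * sin φ * cos a ≤ cos φ := by
  have h1 := mul_sin_le_cos (x := 2 * √2) (by positivity) hφ0 h
  have hγ := (arccot_mem (x := 2 * √2) (by positivity)).2
  rw [← gammaAngle] at hγ
  have hs : 0 ≤ sin φ := Real.sin_nonneg_of_nonneg_of_le_pi hφ0 (by linarith [Real.pi_pos])
  exact (mul_le_of_le_one_right (by positivity) (Real.cos_le_one a)).trans h1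

theorem stdHeight_nonpos_of_region3 (h : region3 θ φ) :
    stdHeight (cos θ * sin φ) (sin θ * sin φ) (cos φ) 1 ≤ 0 ∧
      stdHeight (cos θ * sin φ) (sin θ * sin φ) (cos φ) 2 ≤ 0 := by
  obtain ⟨h0, h1, h2, h3⟩ := h
  have hδ := (arccot_mem (x := √2) (by positivity)).2
  rw [← deltaAngle] at hδ
  rcases le_or_gt gammaAngle φ with hγ | hγ
  · obtain ⟨a0, a1, a2⟩ := alphaFn_spec hγ (h1.trans hδ.le)
    refine ⟨?_, stdHeight_two_nonpos hγ (h1.trans hδ.le) (a0.trans h2)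
      (by rw [betaFn]; linarith)⟩
    have hs := sin_pos_of_gammaAngle_le hγ (h1.trans hδ.le)
    have hcos := Real.cos_le_cos_of_nonneg_of_le_pi a0 (by linarith [Real.pi_pos]) h2
    rw [stdHeight_one_eq]
    refine mul_nonpos_of_nonneg_of_nonpos (by positivity) ?_
    rw [← a2, ← mul_sub]
    exact mul_nonpos_of_nonneg_of_nonpos (by positivity) (by linarith)
  · rw [stdHeight_one_eq, stdHeight_two_eq]
    constructor <;> refine mul_nonpos_of_nonneg_of_nonpos (by positivity) ?_
    · linarith [two_mul_sqrt_two_mul_sin_mul_le h0 hγ.le θ]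
    · linarith [two_mul_sqrt_two_mul_sin_mul_le h0 hγ.le (2 * π / 3 - θ)]

variable {x y z : ℝ}

theorem region1_formulas (hθ0 : 0 ≤ θ) (hθ1 : θ ≤ π / 3) (hφ0 : 0 ≤ φ) (hφ1 : φ ≤ π / 2)
    (hx : x = cos θ * sin φ) (hy : y = sin θ * sin φ) (hz : z = cos φ) (h : region1 θ φ) :
    stdCw θ φ = 1 / 12 * (√6 * x + 3 * √2 * y + √3 * z) ∧
    stdPw θ φ = 1 / 6 * (3 * √(4 - (√3 * x - y) ^ 2)
      + √3 * √(12 - (x - √3 * y + 2 * √2 * z) ^ 2)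
      + 2 * √3 * √(3 - (x - √2 * z) ^ 2)) := by
  obtain ⟨hδ, -, hβ, -⟩ := h
  have hγ := gammaAngle_le_deltaAngle.trans hδ
  have t0 := stdHeight_zero_nonneg (θ := θ) hφ0 hφ1
  have t2 := stdHeight_two_nonneg hγ hφ1 hθ1 hβ
  -- From 2π/3 - α ≤ θ ≤ π/3 follows θ ≤ π/3 ≤ α.
  have t1 := stdHeight_one_nonneg hγ hφ1 hθ0 (by rw [betaFn] at hβ; linarith)
  have t3 := stdHeight_three_nonpos hθ0 hθ1 hφ0 hφ1
  have hv := isUnitRegularSimplex_stdVertex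
  have hn := norm_sphericalPoint θ φ
  have hsum := sum_height stdVertex (sphericalPoint θ φ)
  have hsq := hv.sum_height_sq_pos hn
  rw [height_sphericalPoint, Fin.sum_univ_four] at hsum hsq
  have hh := height_sphericalPoint θ φ
  have hcw := stdCw_eq θ φ
  rw [← hx, ← hy, ← hz] at t0 t1 t2 t3 hsum hsq hh hcw
  constructor
  · rw [hcw, Fin.sum_univ_four, abs_of_nonneg t0, abs_of_nonneg t1, abs_of_nonneg t2,
      abs_of_nonpos t3, div_eq_iff (by positivity)]
    simp only [stdHeight, Matrix.cons_val, sqrt_six_eq]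
    linear_combination (-(1 / 6) * √3 * x - 1 / 2 * y) * sqrt_two_sq
  -- Were height 3 zero, the other heights, being nonnegative with sum zero, would vanish too. Its
  -- strict sign makes the shadow the face opposite to 3.
  · have t3' : stdHeight x y z 3 < 0 := by
      refine t3.lt_of_ne fun e => ?_
      have e0 : stdHeight x y z 0 = 0 := by linarith
      have e1 : stdHeight x y z 1 = 0 := by linarith
      have e2 : stdHeight x y z 2 = 0 := by linarith
      simp [e0, e1, e2, e] at hsq
    have hp := (hv.comp (Equiv.swap 0 3)).periwidth_triangle' hn (by
      rw [height_comp, hh]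
      exact ⟨neg_pos.2 t3', neg_nonpos.2 t1, neg_nonpos.2 t2, neg_nonpos.2 t0⟩)
    rw [height_comp, tetrahedron_comp, hh] at hp
    have hp' : stdPw θ φ = edgeLength (stdHeight x y z 1) (stdHeight x y z 2) +
        edgeLength (stdHeight x y z 1) (stdHeight x y z 0) +
        edgeLength (stdHeight x y z 2) (stdHeight x y z 0) := hp
    rw [hp', edgeLength_comm (stdHeight x y z 1) (stdHeight x y z 0),
      edgeLength_comm (stdHeight x y z 2) (stdHeight x y z 0), edgeLength_stdHeight_one_two,
      edgeLength_stdHeight_zero_one, edgeLength_stdHeight_zero_two]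
    ring

theorem region2_formulas (hθ0 : 0 ≤ θ) (hθ1 : θ ≤ π / 3) (hφ0 : 0 ≤ φ) (hφ1 : φ ≤ π / 2)
    (hx : x = cos θ * sin φ) (hy : y = sin θ * sin φ) (hz : z = cos φ) (h : region2 θ φ) :
    stdCw θ φ = √3 / 6 * (√2 * x + z) ∧
    stdPw θ φ = √3 / 6 * (√3 * √(4 - (√3 * x - y) ^ 2)
      + √3 * √(4 - (√3 * x + y) ^ 2)
      + √(12 - (x - √3 * y + 2 * √2 * z) ^ 2)
      + √(12 - (x + √3 * y + 2 * √2 * z) ^ 2)) := by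
  obtain ⟨hγ, -, -, hm⟩ := h
  have t0 := stdHeight_zero_nonneg (θ := θ) hφ0 hφ1
  have t1 := stdHeight_one_nonneg hγ hφ1 hθ0 (hm.trans (min_le_left _ _))
  have t2 := stdHeight_two_nonpos hγ hφ1 hθ0 (hm.trans (min_le_right _ _))
  have t3 := stdHeight_three_nonpos hθ0 hθ1 hφ0 hφ1
  have hv := isUnitRegularSimplex_stdVertex
  have hn := norm_sphericalPoint θ φ
  have hh := height_sphericalPoint θ φ
  have hcw := stdCw_eq θ φ
  rw [← hx, ← hy, ← hz] at t0 t1 t2 t3 hh hcw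
  constructor
  · rw [hcw, Fin.sum_univ_four, abs_of_nonneg t0, abs_of_nonneg t1, abs_of_nonpos t2,
      abs_of_nonpos t3, div_eq_iff (by positivity)]
    simp only [stdHeight, Matrix.cons_val, sqrt_six_eq]
    linear_combination (-(1 / 3) * √3 * x) * sqrt_two_sq
  -- Heights 0 and 1 are nonnegative, 2 and 3 nonpositive; zeros occur on the curves α and β, so the
  -- weak form is required.
  · have hp := hv.periwidth_weakQuad hn (by rwa [hh]) (by rwa [hh]) (by rwa [hh]) (by rwa [hh])
    rw [stdPw, hp, hh, edgeLength_stdHeight_zero_two, edgeLength_stdHeight_zero_three,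
      edgeLength_stdHeight_one_two, edgeLength_stdHeight_one_three]
    linear_combination (-(1 / 6) * √(4 - (√3 * x - y) ^ 2) - 1 / 6 * √(4 - (√3 * x + y) ^ 2)) *
      sqrt_three_sq

theorem region3_formulas (hθ0 : 0 ≤ θ) (hθ1 : θ ≤ π / 3) (hφ0 : 0 ≤ φ) (hφ1 : φ ≤ π / 2)
    (hx : x = cos θ * sin φ) (hy : y = sin θ * sin φ) (hz : z = cos φ) (h : region3 θ φ) :
    stdCw θ φ = √3 / 4 * z ∧
    stdPw θ φ = 1 / 2 * (√(4 - (√3 * x - y) ^ 2)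
      + 2 * √(1 - y ^ 2)
      + √(4 - (√3 * x + y) ^ 2)) := by
  obtain ⟨t1, t2⟩ := stdHeight_nonpos_of_region3 h
  have t3 := stdHeight_three_nonpos hθ0 hθ1 hφ0 hφ1
  have t0 : 0 < stdHeight (cos θ * sin φ) (sin θ * sin φ) (cos φ) 0 := by
    have hδ := (arccot_mem (x := √2) (by positivity)).2
    rw [← deltaAngle] at hδ
    -- The bound φ ≤ δ < π/2 keeps the apex strictly above, so the shadow is that of the base.
    have : 0 < cos φ := Real.cos_pos_of_mem_Ioo ⟨by linarith [Real.pi_pos], h.2.1.trans_lt hδ⟩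
    simp only [stdHeight, Matrix.cons_val]
    positivity
  have hv := isUnitRegularSimplex_stdVertex
  have hn := norm_sphericalPoint θ φ
  have hh := height_sphericalPoint θ φ
  have hcw := stdCw_eq θ φ
  rw [← hx, ← hy, ← hz] at t0 t1 t2 t3 hh hcw
  constructor
  · rw [hcw, Fin.sum_univ_four, abs_of_pos t0, abs_of_nonpos t1, abs_of_nonpos t2,
      abs_of_nonpos t3, div_eq_iff (by positivity)]
    simp only [stdHeight, Matrix.cons_val, sqrt_six_eq]
    ring
  · have hp := hv.periwidth_triangle hn (by rw [hh]; exact ⟨t0, t1, t2, t3⟩)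
    rw [stdPw, hp, hh, edgeLength_stdHeight_one_two, edgeLength_stdHeight_one_three,
      edgeLength_stdHeight_two_three]
    ring

end RegionFormulas

theorem mainTheorem2 :
    -- moments and vertex probabilities, for every regular tetrahedron of unit edge
    (∀ v : Fin 4 → E3, IsUnitRegularSimplex v →
      (Integrable (cw v) uniformSphere ∧ ∫ u, cw v u ∂uniformSphere = √3 / 4) ∧
      (Integrable (fun u => cw v u ^ 2) uniformSphere ∧
        ∫ u, cw v u ^ 2 ∂uniformSphere = 1 / 8 + √2 / (4 * π) - arcsec 3 / (8 * π)) ∧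
      (Integrable (pw v) uniformSphere ∧
        ∫ u, pw v u ∂uniformSphere = 3 / 2 * (π - arcsec 3)) ∧
      uniformSphere.real {u | vertexCount v u = 3} = 2 / π * (3 * arcsec 3 - π) ∧
      uniformSphere.real {u | vertexCount v u = 4} = 3 / π * (π - 2 * arcsec 3)) ∧
    -- the standard tetrahedron is one of them
    IsUnitRegularSimplex stdVertex ∧
    -- `cw` and `pw` are invariant under the symmetries that carry the dodecant over the sphere
    (∀ θ φ : ℝ,
      (stdCw (θ + 2 * π / 3) φ = stdCw θ φ ∧ stdPw (θ + 2 * π / 3) φ = stdPw θ φ) ∧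
      (stdCw (-θ) φ = stdCw θ φ ∧ stdPw (-θ) φ = stdPw θ φ) ∧
      (stdCw (θ + π) (π - φ) = stdCw θ φ ∧ stdPw (θ + π) (π - φ) = stdPw θ φ)) ∧
    -- the piecewise formulas on the dodecant
    (∀ θ φ x y z : ℝ, 0 ≤ θ → θ ≤ π / 3 → 0 ≤ φ → φ ≤ π / 2 →
      x = cos θ * sin φ → y = sin θ * sin φ → z = cos φ →
      (region1 θ φ ∨ region2 θ φ ∨ region3 θ φ) ∧
      (region1 θ φ →
        stdCw θ φ = 1 / 12 * (√6 * x + 3 * √2 * y + √3 * z) ∧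
        stdPw θ φ = 1 / 6 * (3 * √(4 - (√3 * x - y) ^ 2)
          + √3 * √(12 - (x - √3 * y + 2 * √2 * z) ^ 2)
          + 2 * √3 * √(3 - (x - √2 * z) ^ 2))) ∧
      (region2 θ φ →
        stdCw θ φ = √3 / 6 * (√2 * x + z) ∧
        stdPw θ φ = √3 / 6 * (√3 * √(4 - (√3 * x - y) ^ 2)
          + √3 * √(4 - (√3 * x + y) ^ 2)
          + √(12 - (x - √3 * y + 2 * √2 * z) ^ 2)
          + √(12 - (x + √3 * y + 2 * √2 * z) ^ 2))) ∧
      (region3 θ φ →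
        stdCw θ φ = √3 / 4 * z ∧
        stdPw θ φ = 1 / 2 * (√(4 - (√3 * x - y) ^ 2)
          + 2 * √(1 - y ^ 2)
          + √(4 - (√3 * x + y) ^ 2)))) := by
  refine ⟨fun v hv => ⟨⟨hv.integrable_cw, hv.integral_cw⟩, ⟨hv.integrable_cw_sq, hv.integral_cw_sq⟩,
      hv.integrable_pw_and_integral_pw, hv.measure_vertexCount_eq_three,
      hv.measure_vertexCount_eq_four⟩, isUnitRegularSimplex_stdVertex,
    fun θ φ => ⟨stdCw_stdPw_rotate θ φ, stdCw_stdPw_reflect θ φ, stdCw_stdPw_antipode θ φ⟩,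
    fun θ φ x y z hθ0 hθ1 hφ0 hφ1 hx hy hz => ⟨region_cover hθ0 hθ1 hφ0 hφ1,
      region1_formulas hθ0 hθ1 hφ0 hφ1 hx hy hz, region2_formulas hθ0 hθ1 hφ0 hφ1 hx hy hz,
      region3_formulas hθ0 hθ1 hφ0 hφ1 hx hy hz⟩⟩
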